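/- **Setting.** Let $\nu\ge 2$, $0\le k\le \nu$, $0<r<1/4$. Two balls of unit mass and radius $r$ move uniformly in $[-r,1+r]^k\times\mathbb{T}^{\nu-k}$, $\mathbb{T}=\mathbb{R}/\mathbb{Z}$, and collide elastically with each other and with the walls. Let $\pi_2$ denote the projection onto the last $\nu-k$ (periodic) coordinates and $\mathcal{A}=\{1,\dots,k\}$ the set of non-periodic axes. The configuration space is $$\mathbf{Q}=\{(q_1,q_2)\in([0,1]^k\times\mathbb{T}^{\nu-k})^2 : \operatorname{dist}(q_1,q_2)\ge 2r,\ \pi_2(q_1+q_2)=0\},$$ and the phase space $\mathbf{M}$ consists of all $(q,v)$ with $q\in\mathbf{Q}$, $\|v_1\|^2+\|v_2\|^2=1$, $\pi_2(v_1+v_2)=0$, where incoming and outgoing velocities at $\partial\mathbf{Q}$ are identified; $\dim\mathbf{M}=2(\nu+k)-1$. Let $S^t$ be the resulting billiard flow. An orbit segment $\omega=S^{[a,b]}x_0$ ($a\le 0\le b$, $a$ and $b$ not moments of collision) is non-singular if it has no tangential collision and never hits two smooth components of $\partial\mathbf{Q}$ simultaneously. Its neutral space $\mathcal{N}(\omega)$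 is the space of all tangent vectors $w\in\mathcal{T}_{x_0}\mathbf{M}$ for which the velocity part of $DS^t(w)$ vanishes for all $t\in[a,b]$; $\omega$ is called sufficient if $\dim\mathcal{N}(\omega)=1$. Let $t_0<t_1<\dots<t_n$ be the moments of the ball-to-ball collisions $\sigma_0,\dots,\sigma_n$ of $\omega$. For $1\le i\le n$ let $Z_i(\beta)\subset\mathcal{A}$ be the set of those $j\in\mathcal{A}$ for which the $\beta$-th ball hits the walls $(q)_j=0$ and $(q)_j=1$ altogether an odd number of times during $(t_{i-1},t_i)$, and let $Z_i=Z_i(1)\,\triangle\,Z_i(2)$. The symbolic collision sequence of $\omega$ is $\Sigma(\omega)=(\sigma_0,Z_1,\sigma_1,\dots,Z_n,\sigma_n)$. A symbolic sequence $\Sigma=(\sigma_0,Z_1,\sigma_1,\dots,Z_n,\sigma_n)$ is called combinatorially rich if $\bigcup_{i=1}^n Z_i=\mathcal{A}$ and $0<|Z_i|<\nu$ for some $i$. **Key Lemma.** Let $\Sigma$ be a combinatorially rich symbolic sequence. Then there exists a countable union $E=E(\Sigma)\subset\mathbf{M}$ of smooth submanifolds of $\mathbf{M}$, each of dimension less than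 $\dim\mathbf{M}$, with the following property: if $\omega=S^{[a,b]}x_0$ is a non-singular orbit segment with $\Sigma(\omega)=\Sigma$ and $x_0\notin E$, then $\omega$ is sufficient, i.e. $\dim\mathcal{N}(\omega)=1$. -/

import Mathlib

open scoped Topology

namespace TwoBalls

/-- Vectors of `ℝ^ν` with the Euclidean norm; the coordinate axes are indexed by `Fin ν`, and the
first `k` of them (`j.val < k`) are the non-periodic ones. -/
abbrev Vec (ν : ℕ) := EuclideanSpace ℝ (Fin ν)

/-- A pair of vectors, one for each ball (ball `0` and ball `1`). -/
abbrev Pair (ν : ℕ) := Fin 2 → Vec ν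

/-- Positions and velocities `(q, v)` of the two balls. A position in the periodic factor
`(ℝ/ℤ)^(ν-k)` is represented by a real lift. -/
abbrev State (ν : ℕ) := Pair ν × Pair ν

/-- The set `𝒜` of non-periodic axes. -/
def nonperiodicAxes (ν k : ℕ) : Set (Fin ν) := {j | j.val < k}

/-- Integer vectors supported on the periodic axes, that is, the period lattice of
`ℝ^k × (ℝ/ℤ)^(ν-k)`. -/
def IsPeriod {ν : ℕ} (k : ℕ) (m : Fin ν → ℤ) : Prop := ∀ j : Fin ν, j.val < k → m j = 0

/-- An integer vector as an element of `ℝ^ν`. -/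
noncomputable def intVec {ν : ℕ} (m : Fin ν → ℤ) : Vec ν := WithLp.toLp 2 fun j => (m j : ℝ)

/-- Pairs for which the sum of the two vectors has zero periodic component. -/
def pairSubspace (ν k : ℕ) : Submodule ℝ (Pair ν) where
  carrier := {u | ∀ j : Fin ν, k ≤ j.val → u 0 j + u 1 j = 0}
  zero_mem' := by intro j _; simp
  add_mem' := by
    intro u w hu hw j hj
    have h1 := hu j hj
    have h2 := hw j hj
    simp only [Pi.add_apply, PiLp.add_apply]
    linarith
  smul_mem' := by
    intro c u hu j hj
    have h1 := hu j hj
    simp only [Pi.smul_apply, PiLp.smul_apply, smul_eq_mul]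
    rw [← mul_add, h1, mul_zero]

/-- The configuration space `𝐐`, pulled back to the cover in which the periodic coordinates are
real numbers. The lifts are chosen with `q₁ + q₂ = 0` on the periodic axes, which determines them
up to simultaneous shifts `(q₁ + m, q₂ - m)` by periods `m`. The last condition says that the
distance of the centers in `[0,1]^k × (ℝ/ℤ)^(ν-k)` is at least `2r`. -/
def configSpace (ν k : ℕ) (r : ℝ) : Set (Pair ν) :=
  {q | (∀ (β : Fin 2) (j : Fin ν), j.val < k → 0 ≤ q β j ∧ q β j ≤ 1) ∧
    q ∈ pairSubspace ν k ∧
    ∀ m : Fin ν → ℤ, IsPeriod k m → 2 * r ≤ ‖q 0 - q 1 + intVec m‖}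

/-- The phase space `𝐌` (on the same cover): the unit tangent bundle of `𝐐`. A boundary point of
the glued phase space is represented by its outgoing velocity, see `Motion.phase`. -/
def phaseSpace (ν k : ℕ) (r : ℝ) : Set (State ν) :=
  {x | x.1 ∈ configSpace ν k r ∧ x.2 ∈ pairSubspace ν k ∧ ‖x.2 0‖ ^ 2 + ‖x.2 1‖ ^ 2 = 1}

/-- The dimension of `𝐌`: the configuration space has dimension `2k + (ν - k) = ν + k`. -/
def phaseDim (ν k : ℕ) : ℕ := 2 * (ν + k) - 1

/-- The tangent space of `𝐌` at `x = (q, v)`: all `(δq, δv)` such that `δq₁ + δq₂` and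
`δv₁ + δv₂` vanish on the periodic axes and `δv` is orthogonal to `v`. -/
noncomputable def tangentSpace (ν k : ℕ) (x : State ν) : Submodule ℝ (State ν) where
  carrier := {w | w.1 ∈ pairSubspace ν k ∧ w.2 ∈ pairSubspace ν k ∧
    inner ℝ (x.2 0) (w.2 0) + inner ℝ (x.2 1) (w.2 1) = 0}
  zero_mem' := ⟨Submodule.zero_mem _, Submodule.zero_mem _, by simp⟩
  add_mem' := by
    rintro u w ⟨h1, h2, h3⟩ ⟨h4, h5, h6⟩
    refine ⟨Submodule.add_mem _ h1 h4, Submodule.add_mem _ h2 h5, ?_⟩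
    simp only [Prod.snd_add, Pi.add_apply, inner_add_right]
    linarith
  smul_mem' := by
    rintro c u ⟨h1, h2, h3⟩
    refine ⟨Submodule.smul_mem _ c h1, Submodule.smul_mem _ c h2, ?_⟩
    simp only [Prod.smul_snd, Pi.smul_apply, inner_smul_right]
    rw [← mul_add, h3, mul_zero]

/-- Possible collisions: the two balls with each other (with relative position lifted by the
period `m`), or ball `β` with the flat wall `(q)_j = 0` (`top = false`) or `(q)_j = 1`
(`top = true`). -/
inductive Collision (ν : ℕ) where
  | ball (m : Fin ν → ℤ)
  | wall (β : Fin 2) (j : Fin ν) (top : Bool)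

/-- The configuration `q` lies on the boundary component belonging to the collision. -/
def Touches {ν : ℕ} (k : ℕ) (r : ℝ) (q : Pair ν) : Collision ν → Prop
  | .ball m => IsPeriod k m ∧ ‖q 0 - q 1 + intVec m‖ = 2 * r
  | .wall β j top => j.val < k ∧ q β j = if top then 1 else 0

/-- The component of the velocity `v` normal to the boundary component (up to a nonzero factor). -/
noncomputable def normalVelocity {ν : ℕ} (q v : Pair ν) : Collision ν → ℝ
  | .ball m => inner ℝ (v 0 - v 1) (q 0 - q 1 + intVec m)
  | .wall β j _ => v β j

/-- The elastic reflection of the velocity `v` across the tangent hyperplane of the boundary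
component at `q`. -/
noncomputable def reflect {ν : ℕ} (q v : Pair ν) : Collision ν → Pair ν
  | .ball m =>
      let u := q 0 - q 1 + intVec m
      let c := inner ℝ (v 0 - v 1) u / ‖u‖ ^ 2
      ![v 0 - c • u, v 1 + c • u]
  | .wall β j _ => Function.update v β (v β - (2 * v β j) • EuclideanSpace.single j (1 : ℝ))

/-- A motion of the two balls: positions `q^t` and the one-sided velocities
`v^{t-0}` (`vIn`) and `v^{t+0}` (`vOut`). -/
structure Motion (ν : ℕ) where
  q : ℝ → Pair ν
  vIn : ℝ → Pair ν
  vOut : ℝ → Pair ν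

/-- The phase point at time `t`; at a collision the incoming and outgoing velocities represent the
same point of the glued phase space, and we take the outgoing one. -/
def Motion.phase {ν : ℕ} (ω : Motion ν) (t : ℝ) : State ν := (ω.q t, ω.vOut t)

/-- `t` is a moment of collision (of any kind). -/
def Motion.IsCollisionTime {ν : ℕ} (k : ℕ) (r : ℝ) (ω : Motion ν) (t : ℝ) : Prop :=
  ∃ c, Touches k r (ω.q t) c

/-- `t` is a moment of a ball-to-ball collision. -/
def Motion.IsBallCollisionTime {ν : ℕ} (k : ℕ) (r : ℝ) (ω : Motion ν) (t : ℝ) : Prop :=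
  ∃ m, Touches k r (ω.q t) (.ball m)

/-- `ω` restricted to `[a, b]` is a non-singular orbit segment of the standard `(ν, k, r)` flow:
it stays in the phase space, the motion is uniform except at collisions, a collision reflects the
velocity elastically, no collision is tangential and no two boundary components are hit
simultaneously. -/
structure IsNonsingularOrbit (ν k : ℕ) (r a b : ℝ) (ω : Motion ν) : Prop where
  mem : ∀ t ∈ Set.Icc a b, ω.phase t ∈ phaseSpace ν k r
  forward : ∀ t ∈ Set.Ico a b, ∀ᶠ s in 𝓝[>] t,
    ω.q s = ω.q t + (s - t) • ω.vOut t ∧ ω.vIn s = ω.vOut t ∧ ω.vOut s = ω.vOut t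
  backward : ∀ t ∈ Set.Ioc a b, ∀ᶠ s in 𝓝[<] t,
    ω.q s = ω.q t + (s - t) • ω.vIn t ∧ ω.vIn s = ω.vIn t ∧ ω.vOut s = ω.vIn t
  free : ∀ t ∈ Set.Icc a b, ¬ ω.IsCollisionTime k r t → ω.vOut t = ω.vIn t
  collide : ∀ t ∈ Set.Icc a b, ∀ c, Touches k r (ω.q t) c →
    ω.vOut t = reflect (ω.q t) (ω.vIn t) c
  transversal : ∀ t ∈ Set.Icc a b, ∀ c, Touches k r (ω.q t) c →
    normalVelocity (ω.q t) (ω.vIn t) c ≠ 0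
  simple : ∀ t ∈ Set.Icc a b, ∀ c c', Touches k r (ω.q t) c → Touches k r (ω.q t) c' → c = c'

/-- `S^t x = y`, along a non-singular orbit segment between the times `0` and `t` (`t` of any
sign). -/
def FlowsTo (ν k : ℕ) (r t : ℝ) (x y : State ν) : Prop :=
  ∃ ω : Motion ν, IsNonsingularOrbit ν k r (min 0 t) (max 0 t) ω ∧ ω.phase 0 = x ∧ ω.phase t = y

open Classical in
/-- The billiard flow `S^t` (with the irrelevant value `x` where the orbit is singular). -/
noncomputable def flow (ν k : ℕ) (r t : ℝ) (x : State ν) : State ν :=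
  if h : ∃ y, FlowsTo ν k r t x y then h.choose else x

/-- The linearization `DS^t` of the flow at `x`; only its values on the tangent space of `𝐌` at `x`
are meaningful. -/
noncomputable def flowDeriv (ν k : ℕ) (r t : ℝ) (x : State ν) : State ν →L[ℝ] State ν :=
  fderivWithin ℝ (flow ν k r t) (phaseSpace ν k r) x

/-- The neutral space `𝒩₀(S^{[a,b]} x)`, `x` being the phase point of `ω` at time zero: the tangent
vectors `w` at `x` such that the velocity part `δv^t` of `DS^t w` vanishes for all `t ∈ [a, b]`.
(At a moment of collision `δv^{t±0}` is the one-sided limit, so these moments can be left out.) -/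
noncomputable def neutralSpace (ν k : ℕ) (r a b : ℝ) (ω : Motion ν) : Submodule ℝ (State ν) where
  carrier := {w | w ∈ tangentSpace ν k (ω.phase 0) ∧
    ∀ t ∈ Set.Icc a b, ¬ ω.IsCollisionTime k r t → (flowDeriv ν k r t (ω.phase 0) w).2 = 0}
  zero_mem' := ⟨Submodule.zero_mem _, fun t _ _ => by simp⟩
  add_mem' := by
    rintro u w ⟨h1, h2⟩ ⟨h3, h4⟩
    refine ⟨Submodule.add_mem _ h1 h3, fun t ht hc => ?_⟩
    rw [map_add, Prod.snd_add, h2 t ht hc, h4 t ht hc, add_zero]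
  smul_mem' := by
    rintro c u ⟨h1, h2⟩
    refine ⟨Submodule.smul_mem _ c h1, fun t ht hc => ?_⟩
    rw [map_smul, Prod.smul_snd, h2 t ht hc, smul_zero]

/-- Sufficiency of the orbit segment: the neutral space is one-dimensional. -/
def IsSufficient (ν k : ℕ) (r a b : ℝ) (ω : Motion ν) : Prop :=
  Module.finrank ℝ (neutralSpace ν k r a b ω) = 1

/-- A symbolic collision sequence `(σ₀, Z₁, σ₁, …, Z_n, σ_n)`. All `σᵢ` denote the ball-to-ball
collision `{1, 2}`, so it is given by the sets `Z₁, …, Z_n` (here `Z 0, …, Z (n - 1)`). -/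
structure SymbolicSequence (ν : ℕ) where
  n : ℕ
  Z : Fin n → Set (Fin ν)

/-- Combinatorial richness. -/
def SymbolicSequence.IsRich {ν : ℕ} (k : ℕ) (S : SymbolicSequence ν) : Prop :=
  (⋃ i, S.Z i) = nonperiodicAxes ν k ∧ ∃ i, 0 < (S.Z i).ncard ∧ (S.Z i).ncard < ν

/-- The non-periodic axes `j` such that ball `β` hits the walls `(q)_j = 0`, `(q)_j = 1` an odd
number of times during the time interval `(s, t)`. -/
def Motion.oddAxes {ν : ℕ} (k : ℕ) (ω : Motion ν) (β : Fin 2) (s t : ℝ) : Set (Fin ν) :=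
  {j | j ∈ nonperiodicAxes ν k ∧
    Odd {τ : ℝ | s < τ ∧ τ < t ∧ ω.q τ β j * (1 - ω.q τ β j) = 0}.ncard}

/-- `S` is the symbolic collision sequence of the orbit segment `ω` on `[a, b]`: the ball-to-ball
collisions take place at the times `t₀ < t₁ < … < t_n`, and `Zᵢ` is the symmetric difference
of the sets of axes on which ball `0`, respectively ball `1`, has an odd number of wall collisions
between `tᵢ₋₁` and `tᵢ`. -/
def HasSymbolicSequence (ν k : ℕ) (r a b : ℝ) (ω : Motion ν) (S : SymbolicSequence ν) : Prop :=
  ∃ t : Fin (S.n + 1) → ℝ, StrictMono t ∧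
    Set.range t = {s | s ∈ Set.Icc a b ∧ ω.IsBallCollisionTime k r s} ∧
    ∀ i : Fin S.n, S.Z i =
      symmDiff (ω.oddAxes k 0 (t i.castSucc) (t i.succ)) (ω.oddAxes k 1 (t i.castSucc) (t i.succ))

/-- `A` is a (smoothly embedded) `d`-dimensional `C^∞` submanifold of `V`: locally the zero set of
`finrank V - d` smooth real functions with linearly independent differentials. -/
def IsSmoothSubmanifold {V : Type*} [NormedAddCommGroup V] [NormedSpace ℝ V]
    (d : ℕ) (A : Set V) : Prop :=
  ∀ x ∈ A, ∃ (U : Set V) (c : ℕ) (f : V → (Fin c → ℝ)), IsOpen U ∧ x ∈ U ∧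
    c + d = Module.finrank ℝ V ∧ ContDiffOn ℝ ((⊤ : ℕ∞) : WithTop ℕ∞) f U ∧
    (∀ y ∈ A ∩ U, Function.Surjective (fderiv ℝ f y)) ∧ A ∩ U = {y | y ∈ U ∧ f y = 0}

/-- `E` is a subset of the phase space `𝐌` that is a countable union of proper (that is, of
dimension less than `dim 𝐌`) smooth submanifolds of `𝐌`. The first condition, invariance under the
simultaneous shifts of the lifted positions by periods, says that `E` is the preimage of a subset
of the phase space over the torus; since there are only countably many periods and they act
discretely, the second one is the same for `E` and for that subset. -/
def IsCountableUnionOfProperSubmanifolds (ν k : ℕ) (r : ℝ) (E : Set (State ν)) : Prop :=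
  (∀ m : Fin ν → ℤ, IsPeriod k m → ∀ x ∈ E,
    ((![x.1 0 + intVec m, x.1 1 - intVec m], x.2) : State ν) ∈ E) ∧
  ∃ A : ℕ → Set (State ν), E = ⋃ i, A i ∧
    ∀ i, A i ⊆ phaseSpace ν k r ∧ ∃ d < phaseDim ν k, IsSmoothSubmanifold d (A i)

end TwoBalls

namespace TwoBalls

/-! Let `w` be a neutral vector, transported along the orbit. Its velocity part stays zero, so its
position part `δq` is constant during free flight. A collision of ball `β` with a wall normal to
axis `j` changes the sign of the coordinate `j` of `δq_β` and nothing else. At a ball-to-ball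
collision `δq_0 + δq_1` is preserved. Since the velocities before and after are both unperturbed to
first order, the contact normal cannot move either. This forces `δq_0 - δq_1 = α (v_0 - v_1)` before
and after the collision with one and the same number `α`, the advance (`BounceStep.flowDeriv_ball`).

The flow direction is itself neutral and has advance one at every collision. After subtracting a
multiple of it, the advance vanishes at the collision that precedes a segment `i₀` with `0 < |Z| <
ν`. It remains to see that such a vector is zero. Zero advance means `δq_0 = δq_1 = D`. Up to the
next ball-to-ball collision the two copies of `D` acquire signs that differ exactly on the axes in
`Z`. There the difference must be a multiple of the relative velocity, and it vanishes off `Z`. If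
no coordinate of the relative velocity is zero, the next advance vanishes too, and so do the
coordinates of `D` in `Z`. One vanishing coordinate is then enough to carry zero advance across
every other segment, forwards and backwards, with the zero set of `D` unchanged. Hence `D` vanishes
on the union of all `Z`, that is, on all non-periodic axes. On periodic axes `δq_0 + δq_1 = 0` gives
`D = 0`. This is `neutral_vector_eq_zero`.

The exceptional set must exclude vanishing coordinates of the relative velocity next to ball-to-ball
collisions. The velocity is constant between collisions, so it suffices to look at rational times,
and countably many conditions `(v_0 - v_1)_j = 0` at time `t` remain. Each cuts out a hypersurface,
because the flow is locally a diffeomorphism between free phase points. The boundary strata are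
added so that time zero is not a collision. The resulting set does not depend on the symbolic
sequence.

Most of the work is analytic: determinism of the motion (`IsNonsingularOrbit.phase_eq`), the flow as
the restriction of a smooth map near a non-singular orbit (`IsNonsingularOrbit.flowGerm`), and its
derivative through each kind of collision. The phase space is not a set of unique differentiability
in the ambient space, so derivatives are computed along curves inside it. -/

/-- The collisions that can occur: ball-to-ball collisions lifted by a period, and collisions with
walls perpendicular to a non-periodic axis. -/
def Collision.Admissible {ν : ℕ} (k : ℕ) : Collision ν → Prop
  | .ball m => IsPeriod k m
  | .wall _ j _ => j.val < k

/-- A defining function of the boundary component: positive inside, zero on the component. -/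
noncomputable def gap {ν : ℕ} (r : ℝ) (q : Pair ν) : Collision ν → ℝ
  | .ball m => (‖q 0 - q 1 + intVec m‖ ^ 2 - (2 * r) ^ 2) / 2
  | .wall β j top => if top then 1 - q β j else q β j

/-- The derivative of `gap` at `q` in the direction `v`. -/
noncomputable def gapSpeed {ν : ℕ} (q v : Pair ν) : Collision ν → ℝ
  | .ball m => inner ℝ (v 0 - v 1) (q 0 - q 1 + intVec m)
  | .wall β j top => if top then -v β j else v β j

/-- Half of the second derivative of `gap` in the direction `v`. -/
noncomputable def gapCurv {ν : ℕ} (v : Pair ν) : Collision ν → ℝ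
  | .ball _ => ‖v 0 - v 1‖ ^ 2 / 2
  | .wall _ _ _ => 0

/-! ### Defining functions of the boundary components -/

section Gap

variable {ν k : ℕ} {r : ℝ}

theorem gapCurv_nonneg (v : Pair ν) (c : Collision ν) : 0 ≤ gapCurv v c := by
  cases c with
  | ball m => exact div_nonneg (sq_nonneg _) two_pos.le
  | wall β j top => exact le_rfl

/-- Each `gap` is a polynomial of degree at most two in the configuration, so its second-order
expansion is exact. This is why balls use the halved squared distance rather than the distance. -/
theorem gap_add_smul (q v : Pair ν) (h : ℝ) (c : Collision ν) :
    gap r (q + h • v) c = gap r q c + h * gapSpeed q v c + h ^ 2 * gapCurv v c := by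
  cases c with
  | ball m =>
    simp only [gap, gapSpeed, gapCurv, Pi.add_apply, Pi.smul_apply]
    have : q 0 + h • v 0 - (q 1 + h • v 1) + intVec m
        = (q 0 - q 1 + intVec m) + h • (v 0 - v 1) := by
      rw [smul_sub]; abel
    rw [this, norm_add_sq_real, inner_smul_right, norm_smul, mul_pow, Real.norm_eq_abs, sq_abs,
      real_inner_comm]
    ring
  | wall β j top =>
    cases top <;> (simp [gap, gapSpeed, gapCurv]; try ring)

theorem gapSpeed_add_smul (q v : Pair ν) (h : ℝ) (c : Collision ν) :
    gapSpeed (q + h • v) v c = gapSpeed q v c + 2 * h * gapCurv v c := by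
  cases c with
  | ball m =>
    simp only [gapSpeed, gapCurv, Pi.add_apply, Pi.smul_apply]
    have : q 0 + h • v 0 - (q 1 + h • v 1) + intVec m
        = (q 0 - q 1 + intVec m) + h • (v 0 - v 1) := by
      rw [smul_sub]; abel
    rw [this, inner_add_right, inner_smul_right, real_inner_self_eq_norm_sq]
    ring
  | wall β j top => simp [gapSpeed, gapCurv]

theorem gapSpeed_neg (q v : Pair ν) (c : Collision ν) :
    gapSpeed q (-v) c = -gapSpeed q v c := by
  cases c with
  | ball m =>
    simp only [gapSpeed, Pi.neg_apply]
    rw [← inner_neg_left]; congr 1; abel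
  | wall β j top => cases top <;> simp [gapSpeed]

theorem gap_eq_zero_of_touches {q : Pair ν} {c : Collision ν} (h : Touches k r q c) :
    gap r q c = 0 := by
  cases c with
  | ball m => simp [gap, h.2]
  | wall β j top => cases top <;> simp_all [gap, Touches]

theorem Touches.admissible {q : Pair ν} {c : Collision ν} (h : Touches k r q c) :
    c.Admissible k := by
  cases c <;> exact h.1

theorem touches_iff (hr : 0 < r) (q : Pair ν) (c : Collision ν) :
    Touches k r q c ↔ c.Admissible k ∧ gap r q c = 0 := by
  refine ⟨fun h => ⟨h.admissible, gap_eq_zero_of_touches h⟩, ?_⟩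
  cases c with
  | ball m =>
    rintro ⟨h1, h2⟩
    refine ⟨h1, ?_⟩
    simp only [gap] at h2
    exact (sq_eq_sq₀ (norm_nonneg _) (by positivity)).1 (by linarith)
  | wall β j top =>
    rintro ⟨h1, h2⟩
    refine ⟨h1, ?_⟩
    cases top <;> simp_all [gap]
    linarith

/-- Puts balls and walls on the same footing: afterwards the domain is a system of inequalities `0 ≤
gap`, and collisions need no case distinction. -/
theorem mem_configSpace_iff (hr : 0 < r) (q : Pair ν) :
    q ∈ configSpace ν k r ↔
      q ∈ pairSubspace ν k ∧ ∀ c : Collision ν, c.Admissible k → 0 ≤ gap r q c := by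
  have hb : ∀ m : Fin ν → ℤ, 2 * r ≤ ‖q 0 - q 1 + intVec m‖ ↔ 0 ≤ gap r q (.ball m) := by
    intro m
    rw [← sq_le_sq₀ (by positivity) (norm_nonneg _)]
    simp only [gap]
    constructor <;> intro h <;> linarith
  constructor
  · rintro ⟨h1, h2, h3⟩
    refine ⟨h2, fun c hc => ?_⟩
    cases c with
    | ball m => exact (hb m).1 (h3 m hc)
    | wall β j top =>
      have := h1 β j hc
      cases top <;> simp [gap, this.1, this.2]
  · rintro ⟨h2, h3⟩
    refine ⟨fun β j hj => ⟨?_, ?_⟩, h2, fun m hm => (hb m).2 (h3 _ hm)⟩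
    · simpa [gap] using h3 (.wall β j false) hj
    · simpa [gap] using h3 (.wall β j true) hj

theorem gapSpeed_ne_zero_iff (q v : Pair ν) (c : Collision ν) :
    gapSpeed q v c ≠ 0 ↔ normalVelocity q v c ≠ 0 := by
  cases c with
  | ball m => rfl
  | wall β j top => cases top <;> simp [gapSpeed, normalVelocity]

theorem contDiff_gap (c : Collision ν) {n : WithTop ℕ∞} :
    ContDiff ℝ n fun q : Pair ν => gap r q c := by
  have h0 : ∀ β : Fin 2, ContDiff ℝ n fun q : Pair ν => q β := fun β => contDiff_apply ℝ _ β
  cases c with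
  | ball m =>
    simp only [gap]
    exact (((((h0 0).sub (h0 1)).add contDiff_const).norm_sq ℝ).sub contDiff_const).div_const _
  | wall β j top =>
    have h1 : ContDiff ℝ n fun q : Pair ν => q β j :=
      contDiff_euclidean.1 (h0 β) j
    cases top <;> simp only [gap, if_true]
    · simpa using h1
    · exact contDiff_const.sub h1

theorem contDiff_gapSpeed (c : Collision ν) {n : WithTop ℕ∞} :
    ContDiff ℝ n fun x : State ν => gapSpeed x.1 x.2 c := by
  have h0 : ∀ β : Fin 2, ContDiff ℝ n fun x : State ν => x.1 β :=
    fun β => (contDiff_apply ℝ _ β).comp contDiff_fst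
  have h0' : ∀ β : Fin 2, ContDiff ℝ n fun x : State ν => x.2 β :=
    fun β => (contDiff_apply ℝ _ β).comp contDiff_snd
  cases c with
  | ball m =>
    simp only [gapSpeed]
    exact ((h0' 0).sub (h0' 1)).inner ℝ (((h0 0).sub (h0 1)).add contDiff_const)
  | wall β j top =>
    have h1 : ContDiff ℝ n fun x : State ν => x.2 β j :=
      contDiff_euclidean.1 (h0' β) j
    cases top <;> simp only [gapSpeed, if_true]
    · simpa using h1
    · exact h1.neg

theorem contDiff_gapCurv (c : Collision ν) {n : WithTop ℕ∞} :
    ContDiff ℝ n fun v : Pair ν => gapCurv v c := by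
  have h0 : ∀ β : Fin 2, ContDiff ℝ n fun q : Pair ν => q β := fun β => contDiff_apply ℝ _ β
  cases c with
  | ball m => exact (((h0 0).sub (h0 1)).norm_sq ℝ).div_const _
  | wall β j top => exact contDiff_const

theorem finite_intVec_norm_le (R : ℝ) : {m : Fin ν → ℤ | ‖intVec m‖ ≤ R}.Finite := by
  refine (Set.finite_Icc (fun _ : Fin ν => -⌈R⌉) (fun _ => ⌈R⌉)).subset fun m hm => ?_
  have h : ∀ j, |(m j : ℝ)| ≤ ⌈R⌉ := fun j => by
    have h1 : ‖intVec m j‖ ≤ ‖intVec m‖ := PiLp.norm_apply_le _ _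
    have h2 : ‖intVec m‖ ≤ R := hm
    simpa [intVec] using h1.trans (h2.trans (Int.le_ceil R))
  constructor <;> intro j <;> have := abs_le.1 (h j)
  · exact_mod_cast this.1
  · exact_mod_cast this.2

/-- Locally only finitely many collisions matter. -/
theorem eventually_gap_pos (hr : 0 < r) (q : Pair ν) :
    ∀ᶠ q' in 𝓝 q, ∀ c : Collision ν, 0 < gap r q c → 0 < gap r q' c := by
  have key : ∀ c : Collision ν, ∀ᶠ q' in 𝓝 q, 0 < gap r q c → 0 < gap r q' c := fun c => by
    by_cases h : 0 < gap r q c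
    · filter_upwards [(contDiff_gap (r := r) (n := 0) c).continuous.continuousAt.eventually
        (lt_mem_nhds h)] with q' hq' _ using hq'
    · exact Filter.Eventually.of_forall fun _ h' => absurd h' h
  -- A period longer than `R` keeps the lifted centres more than `2 * r` apart for every `q'` whose
  -- relative position is less than `1` longer than that of `q`. Only finitely many periods remain.
  set R : ℝ := ‖q 0 - q 1‖ + 1 + 2 * r
  have hfar : ∀ᶠ q' : Pair ν in 𝓝 q, ∀ m : Fin ν → ℤ, R < ‖intVec m‖ →
      0 < gap r q' (.ball m) := by
    have hc : Continuous fun q' : Pair ν => ‖q' 0 - q' 1‖ := by fun_prop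
    filter_upwards [hc.continuousAt.eventually (gt_mem_nhds (lt_add_one _))] with q' hq' m hm
    have h1 : 2 * r < ‖q' 0 - q' 1 + intVec m‖ := by
      have := norm_sub_le (q' 0 - q' 1 + intVec m) (q' 0 - q' 1)
      rw [add_sub_cancel_left] at this
      linarith
    have h2 : (2 * r) ^ 2 < ‖q' 0 - q' 1 + intVec m‖ ^ 2 := by gcongr
    simp only [gap]
    linarith
  have hnear : ∀ᶠ q' : Pair ν in 𝓝 q, ∀ m ∈ {m : Fin ν → ℤ | ‖intVec m‖ ≤ R},
      0 < gap r q (.ball m) → 0 < gap r q' (.ball m) :=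
    (Filter.eventually_all_finite (finite_intVec_norm_le R)).2 fun m _ => key _
  have hwall : ∀ᶠ q' : Pair ν in 𝓝 q, ∀ (β : Fin 2) (j : Fin ν) (top : Bool),
      0 < gap r q (.wall β j top) → 0 < gap r q' (.wall β j top) := by
    simp only [Filter.eventually_all]
    exact fun β j top h => (key (.wall β j top)).mono fun q' hq' => hq' h
  filter_upwards [hfar, hnear, hwall] with q' h1 h2 h3 c
  cases c with
  | ball m => exact fun h => (le_or_gt ‖intVec m‖ R).elim (fun hm => h2 m hm h) (h1 m)
  | wall β j top => exact h3 β j top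

/-- The configuration touches no boundary component and lies on the positive side of all. -/
def IsFree (k : ℕ) (r : ℝ) (q : Pair ν) : Prop := ∀ c : Collision ν, c.Admissible k → 0 < gap r q c

theorem IsFree.eventually (hr : 0 < r) {q : Pair ν} (h : IsFree k r q) :
    ∀ᶠ q' in 𝓝 q, IsFree k r q' := by
  filter_upwards [eventually_gap_pos hr q] with q' hq' c hc using hq' c (h c hc)

theorem IsFree.not_touches {q : Pair ν} (h : IsFree k r q) (c : Collision ν) :
    ¬ Touches k r q c := fun hc => by
  have := h c hc.admissible
  rw [gap_eq_zero_of_touches hc] at this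
  exact lt_irrefl _ this

theorem IsFree.mem_configSpace (hr : 0 < r) {q : Pair ν} (h : IsFree k r q)
    (hq : q ∈ pairSubspace ν k) : q ∈ configSpace ν k r :=
  (mem_configSpace_iff hr q).2 ⟨hq, fun c hc => (h c hc).le⟩

theorem isFree_of_not_touches (hr : 0 < r) {q : Pair ν} (hq : q ∈ configSpace ν k r)
    (h : ∀ c, ¬ Touches k r q c) : IsFree k r q := fun c hc => by
  refine lt_of_le_of_ne (((mem_configSpace_iff hr q).1 hq).2 c hc) fun h0 => h c ?_
  exact (touches_iff hr q c).2 ⟨hc, h0.symm⟩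

theorem gap_pos_of_outgoing {q v : Pair ν} {c : Collision ν} (h0 : gap r q c = 0)
    (hv : 0 < gapSpeed q v c) {h : ℝ} (hh : 0 < h) : 0 < gap r (q + h • v) c := by
  rw [gap_add_smul, h0]
  have := mul_pos hh hv
  have := mul_nonneg (sq_nonneg h) (gapCurv_nonneg v c)
  linarith

theorem gap_pos_of_incoming {q v : Pair ν} {c : Collision ν} (h0 : gap r q c = 0)
    (hv : gapSpeed q v c < 0) {h : ℝ} (hh : h < 0) : 0 < gap r (q + h • v) c := by
  have := gap_pos_of_outgoing (r := r) (v := -v) h0 (by rw [gapSpeed_neg]; linarith)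
    (neg_pos.2 hh)
  simpa using this

/-- A negative first-order term would dominate and push the motion out of the domain at once, while
transversality rules out zero. So a motion that remains in the domain leaves the boundary with
positive speed. -/
theorem gapSpeed_pos_of_gap_nonneg {q v : Pair ν} {c : Collision ν} (h0 : gap r q c = 0)
    (hv : gapSpeed q v c ≠ 0) (hg : ∀ᶠ h in 𝓝[>] (0 : ℝ), 0 ≤ gap r (q + h • v) c) :
    0 < gapSpeed q v c := by
  by_contra hcon
  have hneg : gapSpeed q v c < 0 := lt_of_le_of_ne (not_lt.1 hcon) hv
  have hc : ContinuousAt (fun h : ℝ => gapSpeed q v c + h * gapCurv v c) 0 := by fun_prop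
  have h1 : ∀ᶠ h in 𝓝[>] (0 : ℝ), gapSpeed q v c + h * gapCurv v c < 0 :=
    nhdsWithin_le_nhds (hc.eventually (gt_mem_nhds (by simpa using hneg)))
  obtain ⟨h, h2, h3, h4⟩ := (h1.and (hg.and self_mem_nhdsWithin)).exists
  have h4 : 0 < h := h4
  rw [gap_add_smul, h0] at h3
  nlinarith

end Gap

/-! ### Elastic reflections -/

section Reflect

variable {ν k : ℕ} {r : ℝ}

theorem reflect_wall_apply (q v : Pair ν) (β : Fin 2) (j : Fin ν) (top : Bool) (β' : Fin 2)
    (i : Fin ν) : reflect q v (.wall β j top) β' i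
      = if β' = β ∧ i = j then -v β' i else v β' i := by
  simp only [reflect, Function.update_apply]
  by_cases hβ : β' = β
  · subst hβ
    by_cases hi : i = j
    · subst hi; simp; ring
    · simp [hi]
  · simp [hβ]

theorem reflect_ball_sub (q v : Pair ν) (m : Fin ν → ℤ) :
    reflect q v (.ball m) 0 - reflect q v (.ball m) 1 = v 0 - v 1 -
      (2 * (inner ℝ (v 0 - v 1) (q 0 - q 1 + intVec m) / ‖q 0 - q 1 + intVec m‖ ^ 2)) •
        (q 0 - q 1 + intVec m) := by
  simp only [reflect, Matrix.cons_val_zero, Matrix.cons_val_one, Matrix.cons_val_fin_one]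
  rw [mul_smul, two_smul]
  abel

theorem reflect_ball_add (q v : Pair ν) (m : Fin ν → ℤ) :
    reflect q v (.ball m) 0 + reflect q v (.ball m) 1 = v 0 + v 1 := by
  simp only [reflect, Matrix.cons_val_zero, Matrix.cons_val_one, Matrix.cons_val_fin_one]
  abel

theorem norm_sq_pos_of_touches (hr : 0 < r) {q : Pair ν} {m : Fin ν → ℤ}
    (h : Touches k r q (.ball m)) : 0 < ‖q 0 - q 1 + intVec m‖ ^ 2 := by
  rw [h.2]; positivity

theorem gapSpeed_reflect (hr : 0 < r) {q : Pair ν} {c : Collision ν} (h : Touches k r q c)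
    (v : Pair ν) : gapSpeed q (reflect q v c) c = -gapSpeed q v c := by
  cases c with
  | ball m =>
    have := (norm_sq_pos_of_touches hr h).ne'
    simp only [gapSpeed]
    rw [reflect_ball_sub, inner_sub_left, inner_smul_left, real_inner_self_eq_norm_sq,
      RCLike.conj_to_real, mul_assoc, div_mul_cancel₀ _ this]
    ring
  | wall β j top => cases top <;> simp [gapSpeed, reflect_wall_apply]

/-- The involution lets incoming velocities be recovered from outgoing ones, which gives determinism
backwards in time and time reversal. -/
theorem reflect_reflect (hr : 0 < r) {q : Pair ν} {c : Collision ν} (h : Touches k r q c)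
    (v : Pair ν) : reflect q (reflect q v c) c = v := by
  cases c with
  | ball m =>
    have hs := gapSpeed_reflect hr h v
    simp only [gapSpeed] at hs
    set w := reflect q v (.ball m) with hw
    have h0 : w 0 = v 0 - (inner ℝ (v 0 - v 1) (q 0 - q 1 + intVec m) /
      ‖q 0 - q 1 + intVec m‖ ^ 2) • (q 0 - q 1 + intVec m) := rfl
    have h1 : w 1 = v 1 + (inner ℝ (v 0 - v 1) (q 0 - q 1 + intVec m) /
      ‖q 0 - q 1 + intVec m‖ ^ 2) • (q 0 - q 1 + intVec m) := rfl
    funext β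
    simp only [reflect, hs, neg_div, neg_smul, sub_neg_eq_add]
    fin_cases β
    · exact (congrArg (· + _) h0).trans (sub_add_cancel _ _)
    · exact (congrArg (· + -_) h1).trans (add_neg_cancel_right _ _)
  | wall β j top =>
    funext β'
    ext i
    simp only [reflect_wall_apply]
    split_ifs <;> simp

theorem reflect_mem_pairSubspace {q v : Pair ν} {c : Collision ν} (hc : c.Admissible k)
    (hv : v ∈ pairSubspace ν k) : reflect q v c ∈ pairSubspace ν k := by
  intro j hj
  cases c with
  | ball m =>
    have := congrArg (fun w : Vec ν => w j) (reflect_ball_add q v m)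
    simp only [PiLp.add_apply] at this
    rw [this]
    exact hv j hj
  | wall β i top =>
    have : j ≠ i := by
      rintro rfl
      exact absurd hc (not_lt.2 hj)
    simp only [reflect_wall_apply, this, and_false, if_false]
    exact hv j hj

theorem energy_reflect (hr : 0 < r) {q : Pair ν} {c : Collision ν} (h : Touches k r q c)
    (v : Pair ν) : ‖reflect q v c 0‖ ^ 2 + ‖reflect q v c 1‖ ^ 2 = ‖v 0‖ ^ 2 + ‖v 1‖ ^ 2 := by
  cases c with
  | ball m =>
    have := (norm_sq_pos_of_touches hr h).ne'
    simp only [reflect, Matrix.cons_val_zero, Matrix.cons_val_one, Matrix.cons_val_fin_one]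
    generalize q 0 - q 1 + intVec m = u at *
    rw [norm_sub_sq_real, norm_add_sq_real, inner_smul_right, inner_smul_right, norm_smul, mul_pow,
      Real.norm_eq_abs, sq_abs, inner_sub_left]
    generalize ‖u‖ ^ 2 = a at *
    field_simp
    ring
  | wall β j top =>
    have : ∀ β', ‖reflect q v (.wall β j top) β'‖ ^ 2 = ‖v β'‖ ^ 2 := fun β' => by
      rw [EuclideanSpace.real_norm_sq_eq, EuclideanSpace.real_norm_sq_eq]
      refine Finset.sum_congr rfl fun i _ => ?_
      rw [reflect_wall_apply]
      split_ifs <;> simp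
    rw [this, this]

theorem contDiffAt_reflect {x : State ν} {c : Collision ν} {n : WithTop ℕ∞}
    (h : ∀ m, c = .ball m → x.1 0 - x.1 1 + intVec m ≠ 0) :
    ContDiffAt ℝ n (fun x : State ν => reflect x.1 x.2 c) x := by
  have h0 : ∀ β : Fin 2, ContDiff ℝ n fun x : State ν => x.1 β :=
    fun β => (contDiff_apply ℝ _ β).comp contDiff_fst
  have h0' : ∀ β : Fin 2, ContDiff ℝ n fun x : State ν => x.2 β :=
    fun β => (contDiff_apply ℝ _ β).comp contDiff_snd
  rw [contDiffAt_pi]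
  cases c with
  | ball m =>
    have hu : ContDiff ℝ n fun x : State ν => x.1 0 - x.1 1 + intVec m :=
      ((h0 0).sub (h0 1)).add contDiff_const
    have hc : ContDiffAt ℝ n (fun x : State ν =>
        inner ℝ (x.2 0 - x.2 1) (x.1 0 - x.1 1 + intVec m) / ‖x.1 0 - x.1 1 + intVec m‖ ^ 2) x :=
      ((((h0' 0).sub (h0' 1)).inner ℝ hu).contDiffAt).div (hu.norm_sq ℝ).contDiffAt
        (by simpa using h m rfl)
    intro β
    fin_cases β
    · exact (h0' 0).contDiffAt.sub (hc.smul hu.contDiffAt)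
    · exact (h0' 1).contDiffAt.add (hc.smul hu.contDiffAt)
  | wall β j top =>
    intro β'
    by_cases hβ : β' = β
    · subst hβ
      simp only [reflect, Function.update_self]
      have h1 : ContDiff ℝ n fun x : State ν => x.2 β' j :=
      contDiff_euclidean.1 (h0' β') j
      exact ((h0' β').sub ((contDiff_const.mul h1).smul contDiff_const)).contDiffAt
    · simp only [reflect, Function.update_of_ne hβ]
      exact (h0' β').contDiffAt

end Reflect

/-! ### The time of impact on a boundary component -/

section HitTime

variable {ν k : ℕ} {r : ℝ}

/-- The time at which the straight motion from the position `x.1` with velocity `x.2` hits the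
boundary component `c`. -/
noncomputable def hitTime (r : ℝ) (c : Collision ν) (x : State ν) : ℝ :=
  2 * gap r x.1 c /
    (√(gapSpeed x.1 x.2 c ^ 2 - 4 * gapCurv x.2 c * gap r x.1 c) - gapSpeed x.1 x.2 c)

/-- With `n`, `Q`, `g` the speed, curvature and gap, the impact time is the root `2g / (√(n² - 4Qg)
- n)` of `g + n h + Q h²`. In this rationalised form it also covers walls, where `Q = 0`. The speed
at that root is `-√(n² - 4Qg)`, hence incoming. -/
theorem gap_hitTime {c : Collision ν} {x : State ν} (hn : gapSpeed x.1 x.2 c < 0)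
    (hD : 0 < gapSpeed x.1 x.2 c ^ 2 - 4 * gapCurv x.2 c * gap r x.1 c) :
    gap r (x.1 + hitTime r c x • x.2) c = 0 ∧
      gapSpeed (x.1 + hitTime r c x • x.2) x.2 c < 0 := by
  rw [gap_add_smul, gapSpeed_add_smul, hitTime]
  set n := gapSpeed x.1 x.2 c
  set Q := gapCurv x.2 c
  set g := gap r x.1 c
  set s := √(n ^ 2 - 4 * Q * g) with hs
  have hs2 : s ^ 2 = n ^ 2 - 4 * Q * g := Real.sq_sqrt hD.le
  have hs0 : 0 < s := Real.sqrt_pos.2 hD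
  have hne : s - n ≠ 0 := by linarith
  constructor
  · field_simp
    linear_combination g * hs2
  · have : n + 2 * (2 * g / (s - n)) * Q = -s := by
      field_simp
      linear_combination hs2
    rw [this]
    linarith

/-- The discriminant is constant along a straight motion. At impact it equals the squared speed, so
it is positive at every earlier point of the approach. -/
theorem hitTime_of_touches {c : Collision ν} {q v : Pair ν} (h0 : gap r q c = 0)
    (hn : gapSpeed q v c < 0) {h : ℝ} (hh : 0 ≤ h) :
    let x : State ν := (q + (-h) • v, v)
    gapSpeed x.1 x.2 c < 0 ∧
      0 < gapSpeed x.1 x.2 c ^ 2 - 4 * gapCurv x.2 c * gap r x.1 c ∧ hitTime r c x = h := by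
  intro x
  have e1 : gapSpeed x.1 x.2 c = gapSpeed q v c - 2 * h * gapCurv v c := by
    rw [gapSpeed_add_smul]; ring
  have e2 : gap r x.1 c = -h * gapSpeed q v c + h ^ 2 * gapCurv v c := by
    rw [gap_add_smul, h0]; ring
  have hQ := gapCurv_nonneg v c
  have hD : gapSpeed x.1 x.2 c ^ 2 - 4 * gapCurv x.2 c * gap r x.1 c = (-gapSpeed q v c) ^ 2 := by
    rw [e1, e2]; ring
  have hhQ := mul_nonneg hh hQ
  refine ⟨by rw [e1]; linarith, by rw [hD]; exact pow_pos (by linarith) 2, ?_⟩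
  rw [hitTime, hD, Real.sqrt_sq (by linarith), e1, e2]
  have : -gapSpeed q v c - (gapSpeed q v c - 2 * h * gapCurv v c) ≠ 0 := by linarith
  field_simp
  ring

theorem contDiffAt_hitTime {c : Collision ν} {x : State ν} {n : WithTop ℕ∞}
    (hn : gapSpeed x.1 x.2 c < 0)
    (hD : 0 < gapSpeed x.1 x.2 c ^ 2 - 4 * gapCurv x.2 c * gap r x.1 c) :
    ContDiffAt ℝ n (hitTime r c) x := by
  have hg : ContDiff ℝ n fun x : State ν => gap r x.1 c := (contDiff_gap c).comp contDiff_fst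
  have hQ : ContDiff ℝ n fun x : State ν => gapCurv x.2 c := (contDiff_gapCurv c).comp contDiff_snd
  have hS : ContDiff ℝ n fun x : State ν => gapSpeed x.1 x.2 c := contDiff_gapSpeed c
  have hs0 := Real.sqrt_pos.2 hD
  have hroot : ContDiffAt ℝ n (fun x : State ν =>
      √(gapSpeed x.1 x.2 c ^ 2 - 4 * gapCurv x.2 c * gap r x.1 c)) x :=
    ContDiffAt.sqrt ((hS.pow 2).sub ((contDiff_const.mul hQ).mul hg)).contDiffAt hD.ne'
  exact (contDiff_const.mul hg).contDiffAt.div (hroot.sub hS.contDiffAt) (by linarith)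

end HitTime

/-! ### Determinism of the motion and the group law of the flow -/

section Orbits

variable {ν k : ℕ} {r : ℝ}

theorem eventually_nhdsWithin_Icc_diff {p : ℝ → Prop} {a b t : ℝ}
    (hl : a < t → ∀ᶠ s in 𝓝[<] t, p s) (hr : t < b → ∀ᶠ s in 𝓝[>] t, p s) :
    ∀ᶠ s in 𝓝[Set.Icc a b \ {t}] t, p s := by
  have hl' : ∀ᶠ s in 𝓝 t, a ≤ s → s < t → p s := by
    by_cases h : a < t
    · filter_upwards [eventually_nhdsWithin_iff.1 (hl h)] with s hs _ using hs
    · exact Filter.Eventually.of_forall fun s h1 h2 => absurd (h1.trans_lt h2) h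
  have hr' : ∀ᶠ s in 𝓝 t, s ≤ b → t < s → p s := by
    by_cases h : t < b
    · filter_upwards [eventually_nhdsWithin_iff.1 (hr h)] with s hs _ using hs
    · exact Filter.Eventually.of_forall fun s h1 h2 => absurd (h2.trans_le h1) h
  rw [eventually_nhdsWithin_iff]
  filter_upwards [hl', hr'] with s h1 h2 hs
  rcases lt_or_gt_of_ne hs.2 with h | h
  · exact h1 hs.1.1 h
  · exact h2 hs.1.2 h

namespace IsNonsingularOrbit

variable {a b : ℝ} {ω ω' : Motion ν}

theorem mono (h : IsNonsingularOrbit ν k r a b ω) {a' b' : ℝ} (ha : a ≤ a') (hb : b' ≤ b) :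
    IsNonsingularOrbit ν k r a' b' ω where
  mem t ht := h.mem t ⟨ha.trans ht.1, ht.2.trans hb⟩
  forward t ht := h.forward t ⟨ha.trans ht.1, ht.2.trans_le hb⟩
  backward t ht := h.backward t ⟨ha.trans_lt ht.1, ht.2.trans hb⟩
  free t ht := h.free t ⟨ha.trans ht.1, ht.2.trans hb⟩
  collide t ht := h.collide t ⟨ha.trans ht.1, ht.2.trans hb⟩
  transversal t ht := h.transversal t ⟨ha.trans ht.1, ht.2.trans hb⟩
  simple t ht := h.simple t ⟨ha.trans ht.1, ht.2.trans hb⟩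

/-- At a collision the phase stores only the outgoing velocity, and reflecting it once more returns
the incoming one. -/
theorem vIn_eq (hr : 0 < r) (h : IsNonsingularOrbit ν k r a b ω)
    (h' : IsNonsingularOrbit ν k r a b ω') {t : ℝ} (ht : t ∈ Set.Icc a b)
    (he : ω.phase t = ω'.phase t) : ω.vIn t = ω'.vIn t := by
  have hq : ω.q t = ω'.q t := congrArg Prod.fst he
  have hv : ω.vOut t = ω'.vOut t := congrArg Prod.snd he
  by_cases hc : ω.IsCollisionTime k r t
  · obtain ⟨c, hc⟩ := hc
    rw [← reflect_reflect hr hc (ω.vIn t), ← h.collide t ht c hc, hv]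
    rw [hq] at hc ⊢
    rw [h'.collide t ht c hc, reflect_reflect hr hc]
  · have hc' : ¬ ω'.IsCollisionTime k r t := by
      simpa only [Motion.IsCollisionTime, ← hq] using hc
    rw [← h.free t ht hc, ← h'.free t ht hc', hv]

theorem vOut_eq (h : IsNonsingularOrbit ν k r a b ω)
    (h' : IsNonsingularOrbit ν k r a b ω') {t : ℝ} (ht : t ∈ Set.Icc a b)
    (hq : ω.q t = ω'.q t) (hv : ω.vIn t = ω'.vIn t) : ω.phase t = ω'.phase t := by
  refine Prod.ext hq ?_
  change ω.vOut t = ω'.vOut t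
  by_cases hc : ω.IsCollisionTime k r t
  · obtain ⟨c, hc⟩ := hc
    rw [h.collide t ht c hc, hq, hv]
    rw [hq] at hc
    rw [h'.collide t ht c hc]
  · have hc' : ¬ ω'.IsCollisionTime k r t := by
      simpa only [Motion.IsCollisionTime, ← hq] using hc
    rw [h.free t ht hc, h'.free t ht hc', hv]

/-- On each side of `t` both motions are uniform, with data determined by the phase at `t`.
Conversely the uniform motion on one side determines the phase at `t`. -/
theorem eventually_phase_eq_iff (hr : 0 < r) (h : IsNonsingularOrbit ν k r a b ω)
    (h' : IsNonsingularOrbit ν k r a b ω') {t : ℝ} (ht : t ∈ Set.Icc a b) :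
    ∀ᶠ s in 𝓝[Set.Icc a b \ {t}] t, (ω.phase s = ω'.phase s ↔ ω.phase t = ω'.phase t) := by
  refine eventually_nhdsWithin_Icc_diff (fun hat => ?_) fun htb => ?_
  · filter_upwards [h.backward t ⟨hat, ht.2⟩, h'.backward t ⟨hat, ht.2⟩] with s h1 h2
    simp only [Motion.phase, Prod.mk.injEq, h1.1, h1.2.2, h2.1, h2.2.2]
    constructor
    · rintro ⟨e1, e2⟩
      rw [e2, add_left_inj] at e1
      exact Prod.ext_iff.1 (h.vOut_eq h' ht e1 e2)
    · rintro ⟨e1, e2⟩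
      have := h.vIn_eq hr h' ht (Prod.ext e1 e2)
      rw [e1, this]
      exact ⟨rfl, rfl⟩
  · filter_upwards [h.forward t ⟨ht.1, htb⟩, h'.forward t ⟨ht.1, htb⟩] with s h1 h2
    simp only [Motion.phase, Prod.mk.injEq, h1.1, h1.2.2, h2.1, h2.2.2]
    constructor
    · rintro ⟨e1, e2⟩
      rw [e2, add_left_inj] at e1
      exact ⟨e1, e2⟩
    · rintro ⟨e1, e2⟩
      rw [e1, e2]
      exact ⟨rfl, rfl⟩

/-- The motion is deterministic, in both directions of time. -/
theorem phase_eq (hr : 0 < r) (h : IsNonsingularOrbit ν k r a b ω)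
    (h' : IsNonsingularOrbit ν k r a b ω') {s t : ℝ} (hs : s ∈ Set.Icc a b)
    (ht : t ∈ Set.Icc a b) (he : ω.phase s = ω'.phase s) : ω.phase t = ω'.phase t := by
  have key : (ω.phase s = ω'.phase s ↔ ω.phase t = ω'.phase t) := by
    -- Whether the two phases agree is locally constant in time, hence constant on the interval.
    refine isPreconnected_Icc.induction₂ (s := Set.Icc a b)
      (fun s t => (ω.phase s = ω'.phase s ↔ ω.phase t = ω'.phase t)) (fun x hx => ?_)
      (fun x y z _ _ _ h1 h2 => h1.trans h2) (fun x y _ _ h1 => h1.symm) hs ht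
    rw [eventually_nhdsWithin_iff]
    filter_upwards [eventually_nhdsWithin_iff.1 (h.eventually_phase_eq_iff hr h' hx)] with y hy hy'
    by_cases hxy : y = x
    · rw [hxy]
    · exact (hy ⟨hy', hxy⟩).symm
  exact key.1 he

end IsNonsingularOrbit

/-- The motion with the origin of time moved to `d`. -/
def Motion.shift (ω : Motion ν) (d : ℝ) : Motion ν :=
  ⟨fun t => ω.q (t + d), fun t => ω.vIn (t + d), fun t => ω.vOut (t + d)⟩

theorem Motion.phase_shift (ω : Motion ν) (d t : ℝ) : (ω.shift d).phase t = ω.phase (t + d) := rfl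

theorem IsNonsingularOrbit.shift {a b : ℝ} {ω : Motion ν} (h : IsNonsingularOrbit ν k r a b ω)
    {a' b' d : ℝ} (ha : a' + d = a) (hb : b' + d = b) :
    IsNonsingularOrbit ν k r a' b' (ω.shift d) := by
  subst ha hb
  have hc : ∀ {t : ℝ}, t ∈ Set.Icc a' b' → t + d ∈ Set.Icc (a' + d) (b' + d) := fun ht =>
    ⟨add_le_add_left ht.1 d, add_le_add_left ht.2 d⟩
  refine ⟨fun t ht => h.mem _ (hc ht), fun t ht => ?_, fun t ht => ?_,
    fun t ht => h.free _ (hc ht), fun t ht => h.collide _ (hc ht),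
    fun t ht => h.transversal _ (hc ht), fun t ht => h.simple _ (hc ht)⟩
  · have ht' : Filter.Tendsto (fun s => s + d) (𝓝[>] t) (𝓝[>] (t + d)) :=
      tendsto_nhdsWithin_iff.2 ⟨(Continuous.tendsto (by fun_prop) t).mono_left nhdsWithin_le_nhds,
        by filter_upwards [self_mem_nhdsWithin] with s hs using add_lt_add_left hs d⟩
    filter_upwards [ht'.eventually (h.forward (t + d)
      ⟨add_le_add_left ht.1 d, add_lt_add_left ht.2 d⟩)] with s hs
    simpa only [Motion.shift, add_sub_add_right_eq_sub] using hs
  · have ht' : Filter.Tendsto (fun s => s + d) (𝓝[<] t) (𝓝[<] (t + d)) :=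
      tendsto_nhdsWithin_iff.2 ⟨(Continuous.tendsto (by fun_prop) t).mono_left nhdsWithin_le_nhds,
        by filter_upwards [self_mem_nhdsWithin] with s hs using add_lt_add_left hs d⟩
    filter_upwards [ht'.eventually (h.backward (t + d)
      ⟨add_lt_add_left ht.1 d, add_le_add_left ht.2 d⟩)] with s hs
    simpa only [Motion.shift, add_sub_add_right_eq_sub] using hs

open Classical in
/-- Follow `ω` up to the time `p` and `ω'` afterwards. -/
noncomputable def Motion.glue (ω ω' : Motion ν) (p : ℝ) : Motion ν :=
  ⟨fun t => if t ≤ p then ω.q t else ω'.q t, fun t => if t ≤ p then ω.vIn t else ω'.vIn t,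
    fun t => if t < p then ω.vOut t else ω'.vOut t⟩

theorem Motion.glue_phase_of_le {ω ω' : Motion ν} {p t : ℝ} (he : ω.phase p = ω'.phase p)
    (ht : t ≤ p) : (ω.glue ω' p).phase t = ω.phase t := by
  rcases ht.lt_or_eq with h | rfl
  · simp [Motion.glue, Motion.phase, h, h.le]
  · simp only [Motion.glue, Motion.phase, le_refl, if_true, lt_irrefl, if_false]
    exact Prod.ext rfl (congrArg Prod.snd he).symm

theorem Motion.glue_phase_of_ge {ω ω' : Motion ν} {p t : ℝ} (he : ω.phase p = ω'.phase p)
    (ht : p ≤ t) : (ω.glue ω' p).phase t = ω'.phase t := by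
  rcases ht.lt_or_eq with h | rfl
  · simp [Motion.glue, Motion.phase, h.not_gt, h.not_ge]
  · rw [Motion.glue_phase_of_le he le_rfl, he]

/-- The glued motion takes its incoming velocity at `p` from `ω` and its outgoing one from `ω'`.
Each one-sided condition at `p` is therefore inherited from a single piece, and only equality of
phases is needed. -/
theorem IsNonsingularOrbit.glue {a b p : ℝ} {ω ω' : Motion ν}
    (h : IsNonsingularOrbit ν k r a p ω) (h' : IsNonsingularOrbit ν k r p b ω')
    (he : ω.phase p = ω'.phase p) : IsNonsingularOrbit ν k r a b (ω.glue ω' p) := by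
  have hq : ∀ {t}, t ≤ p → (ω.glue ω' p).q t = ω.q t := fun ht => by simp [Motion.glue, ht]
  have hi : ∀ {t}, t ≤ p → (ω.glue ω' p).vIn t = ω.vIn t := fun ht => by simp [Motion.glue, ht]
  have ho : ∀ {t}, t ≤ p → (ω.glue ω' p).vOut t = ω.vOut t := fun ht =>
    congrArg Prod.snd (Motion.glue_phase_of_le he ht)
  have hq' : ∀ {t}, p ≤ t → (ω.glue ω' p).q t = ω'.q t := fun ht =>
    congrArg Prod.fst (Motion.glue_phase_of_ge he ht)
  have hi' : ∀ {t}, p < t → (ω.glue ω' p).vIn t = ω'.vIn t := fun ht => by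
    simp [Motion.glue, ht.not_ge]
  have ho' : ∀ {t}, p ≤ t → (ω.glue ω' p).vOut t = ω'.vOut t := fun ht =>
    congrArg Prod.snd (Motion.glue_phase_of_ge he ht)
  refine ⟨fun t ht => ?_, fun t ht => ?_, fun t ht => ?_, fun t ht => ?_, fun t ht => ?_,
    fun t ht => ?_, fun t ht => ?_⟩
  · rcases le_total t p with hp | hp
    · rw [Motion.glue_phase_of_le he hp]; exact h.mem t ⟨ht.1, hp⟩
    · rw [Motion.glue_phase_of_ge he hp]; exact h'.mem t ⟨hp, ht.2⟩
  · rcases lt_or_ge t p with hp | hp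
    · filter_upwards [h.forward t ⟨ht.1, hp⟩, nhdsWithin_le_nhds (gt_mem_nhds hp)] with s hs hsp
      rwa [hq hp.le, hq hsp.le, hi hsp.le, ho hsp.le, ho hp.le]
    · filter_upwards [h'.forward t ⟨hp, ht.2⟩, self_mem_nhdsWithin] with s hs hst
      have hsp : p < s := hp.trans_lt hst
      rwa [hq' hp, hq' hsp.le, hi' hsp, ho' hsp.le, ho' hp]
  · rcases lt_or_ge p t with hp | hp
    · filter_upwards [h'.backward t ⟨hp, ht.2⟩, nhdsWithin_le_nhds (lt_mem_nhds hp)] with s hs hsp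
      rwa [hq' hp.le, hq' hsp.le, hi' hsp, hi' hp, ho' hsp.le]
    · filter_upwards [h.backward t ⟨ht.1, hp⟩, self_mem_nhdsWithin] with s hs hst
      have hsp : s ≤ p := (Set.mem_Iio.1 hst).le.trans hp
      rwa [hq hp, hq hsp, hi hsp, hi hp, ho hsp]
  · rcases le_or_gt t p with hp | hp
    · simpa only [Motion.IsCollisionTime, hq hp, hi hp, ho hp] using h.free t ⟨ht.1, hp⟩
    · simpa only [Motion.IsCollisionTime, hq' hp.le, hi' hp, ho' hp.le]
        using h'.free t ⟨hp.le, ht.2⟩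
  · rcases le_or_gt t p with hp | hp
    · simpa only [hq hp, hi hp, ho hp] using h.collide t ⟨ht.1, hp⟩
    · simpa only [hq' hp.le, hi' hp, ho' hp.le] using h'.collide t ⟨hp.le, ht.2⟩
  · rcases le_or_gt t p with hp | hp
    · simpa only [hq hp, hi hp] using h.transversal t ⟨ht.1, hp⟩
    · simpa only [hq' hp.le, hi' hp] using h'.transversal t ⟨hp.le, ht.2⟩
  · rcases le_or_gt t p with hp | hp
    · simpa only [hq hp] using h.simple t ⟨ht.1, hp⟩
    · simpa only [hq' hp.le] using h'.simple t ⟨hp.le, ht.2⟩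

theorem IsNonsingularOrbit.flowsTo {a b : ℝ} {ω : Motion ν} (h : IsNonsingularOrbit ν k r a b ω)
    {s t : ℝ} (hs : s ∈ Set.Icc a b) (ht : t ∈ Set.Icc a b) :
    FlowsTo ν k r (t - s) (ω.phase s) (ω.phase t) := by
  refine ⟨ω.shift s, ?_, ?_, ?_⟩
  · refine (h.shift (a' := a - s) (b' := b - s) (by ring) (by ring)).mono ?_ ?_
    · exact le_min (by linarith [hs.1]) (by linarith [ht.1])
    · exact max_le (by linarith [hs.2]) (by linarith [ht.2])
  · rw [Motion.phase_shift, zero_add]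
  · rw [Motion.phase_shift, sub_add_cancel]

theorem zero_mem_Icc_min_max (t : ℝ) : (0 : ℝ) ∈ Set.Icc (min 0 t) (max 0 t) :=
  ⟨min_le_left _ _, le_max_left _ _⟩

theorem self_mem_Icc_min_max (t : ℝ) : t ∈ Set.Icc (min 0 t) (max 0 t) :=
  ⟨min_le_right _ _, le_max_right _ _⟩

namespace FlowsTo

theorem unique (hr : 0 < r) {t : ℝ} {x y z : State ν} (h : FlowsTo ν k r t x y)
    (h' : FlowsTo ν k r t x z) : y = z := by
  obtain ⟨ω, h1, h2, h3⟩ := h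
  obtain ⟨ω', h1', h2', h3'⟩ := h'
  rw [← h3, ← h3']
  exact h1.phase_eq hr h1' (zero_mem_Icc_min_max t) (self_mem_Icc_min_max t) (h2.trans h2'.symm)

/-- Determinism makes the choice in the definition of `flow` irrelevant. -/
theorem flow_eq (hr : 0 < r) {t : ℝ} {x y : State ν} (h : FlowsTo ν k r t x y) :
    flow ν k r t x = y := by
  have hex : ∃ y, FlowsTo ν k r t x y := ⟨y, h⟩
  rw [flow, dif_pos hex]
  exact hex.choose_spec.unique hr h

theorem symm {t : ℝ} {x y : State ν} (h : FlowsTo ν k r t x y) : FlowsTo ν k r (-t) y x := by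
  obtain ⟨ω, h1, h2, h3⟩ := h
  have := h1.flowsTo (self_mem_Icc_min_max t) (zero_mem_Icc_min_max t)
  rwa [h2, h3, zero_sub] at this

theorem mem_left {t : ℝ} {x y : State ν} (h : FlowsTo ν k r t x y) : x ∈ phaseSpace ν k r := by
  obtain ⟨ω, h1, h2, h3⟩ := h
  rw [← h2]
  exact h1.mem 0 (zero_mem_Icc_min_max t)

theorem mem_right {t : ℝ} {x y : State ν} (h : FlowsTo ν k r t x y) : y ∈ phaseSpace ν k r :=
  h.symm.mem_left

theorem trans (hr : 0 < r) {t t' : ℝ} {x y z : State ν} (h : FlowsTo ν k r t x y)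
    (h' : FlowsTo ν k r t' y z) : FlowsTo ν k r (t + t') x z := by
  obtain ⟨ω, h1, h2, h3⟩ := h
  obtain ⟨ω₁, h4, h5, h6⟩ := h'
  have h7 := h4.shift (a' := t + min 0 t') (b' := t + max 0 t') (d := -t) (by ring) (by ring)
  set ω' := ω₁.shift (-t) with hω'
  have h8 : ω'.phase t = y := by rw [hω', Motion.phase_shift, add_neg_cancel, h5]
  have h9 : ω'.phase (t + t') = z := by
    rw [hω', Motion.phase_shift, add_neg_cancel_comm, h6]
  clear_value ω'
  have he : ω.phase t = ω'.phase t := h3.trans h8.symm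
  have fin : ∀ {a b : ℝ} {ω'' : Motion ν}, IsNonsingularOrbit ν k r a b ω'' → 0 ∈ Set.Icc a b →
      t + t' ∈ Set.Icc a b → ω''.phase 0 = x → ω''.phase (t + t') = z →
      FlowsTo ν k r (t + t') x z := fun ho m1 m2 e1 e2 => by
    have := ho.flowsTo m1 m2
    rwa [e1, e2, sub_zero] at this
  -- For `t` and `t'` of equal sign the two segments are glued. For opposite signs the shorter
  -- segment retraces part of the longer one by determinism, and the longer one alone supplies the
  -- orbit.
  rcases le_total 0 t with ht | ht <;> rcases le_total 0 t' with ht' | ht' <;>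
    simp only [min_eq_left, min_eq_right, max_eq_left, max_eq_right, ht, ht', add_zero] at h1 h7
  · exact fin (h1.glue h7 he) ⟨le_rfl, by linarith⟩ ⟨by linarith, le_rfl⟩
      ((Motion.glue_phase_of_le he ht).trans h2)
      ((Motion.glue_phase_of_ge he (by linarith)).trans h9)
  · rcases le_total 0 (t + t') with hs | hs
    · have e := (h1.mono hs le_rfl).phase_eq hr h7 (s := t) (t := t + t') ⟨by linarith, le_rfl⟩
        ⟨le_rfl, by linarith⟩ he
      exact fin h1 ⟨le_rfl, ht⟩ ⟨hs, by linarith⟩ h2 (e.trans h9)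
    · have e := h1.phase_eq hr (h7.mono hs le_rfl) (s := t) (t := 0) ⟨ht, le_rfl⟩
        ⟨le_rfl, ht⟩ he
      exact fin h7 ⟨hs, ht⟩ ⟨le_rfl, by linarith⟩ (e.symm.trans h2) h9
  · rcases le_total 0 (t + t') with hs | hs
    · have e := h1.phase_eq hr (h7.mono le_rfl hs) (s := t) (t := 0) ⟨le_rfl, ht⟩
        ⟨ht, le_rfl⟩ he
      exact fin h7 ⟨ht, hs⟩ ⟨by linarith, le_rfl⟩ (e.symm.trans h2) h9
    · have e := (h1.mono le_rfl hs).phase_eq hr h7 (s := t) (t := t + t') ⟨le_rfl, by linarith⟩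
        ⟨by linarith, le_rfl⟩ he
      exact fin h1 ⟨ht, le_rfl⟩ ⟨by linarith, hs⟩ h2 (e.trans h9)
  · exact fin (h7.glue h1 he.symm) ⟨by linarith, le_rfl⟩ ⟨le_rfl, by linarith⟩
      ((Motion.glue_phase_of_ge he.symm ht).trans h2)
      ((Motion.glue_phase_of_le he.symm (by linarith)).trans h9)

end FlowsTo

end Orbits

/-! ### Explicit local flows: free flight and a single collision -/

section LocalFlow

variable {ν k : ℕ} {r : ℝ}

/-- Uniform motion for the time `T`. -/
noncomputable def freeFlight (T : ℝ) (x : State ν) : State ν := (x.1 + T • x.2, x.2)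

/-- Motion for the time `T` during which exactly the collision `c` takes place. -/
noncomputable def bounce (r : ℝ) (c : Collision ν) (T : ℝ) (x : State ν) : State ν :=
  (x.1 + hitTime r c x • x.2 +
      (T - hitTime r c x) • reflect (x.1 + hitTime r c x • x.2) x.2 c,
    reflect (x.1 + hitTime r c x • x.2) x.2 c)

/-- Reversal of the velocities. -/
def timeReverse (x : State ν) : State ν := (x.1, -x.2)

theorem contDiff_freeFlight (T : ℝ) {n : WithTop ℕ∞} :
    ContDiff ℝ n (freeFlight T : State ν → State ν) :=
  (contDiff_fst.add (contDiff_snd.const_smul T)).prodMk contDiff_snd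

theorem contDiff_timeReverse {n : WithTop ℕ∞} :
    ContDiff ℝ n (timeReverse : State ν → State ν) :=
  contDiff_fst.prodMk contDiff_snd.neg

theorem flowsTo_freeFlight (hr : 0 < r) {y : State ν} (hy : y ∈ phaseSpace ν k r) {T : ℝ}
    (h : ∀ s ∈ Set.Icc (min 0 T) (max 0 T), IsFree k r (y.1 + s • y.2)) :
    FlowsTo ν k r T y (freeFlight T y) := by
  have hrel : ∀ s t : ℝ, y.1 + s • y.2 = y.1 + t • y.2 + (s - t) • y.2 := fun s t => by
    rw [sub_smul]; abel
  refine ⟨⟨fun t => y.1 + t • y.2, fun _ => y.2, fun _ => y.2⟩,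
    ⟨fun t ht => ⟨?_, hy.2⟩, fun t _ => ?_, fun t _ => ?_, fun _ _ _ => rfl,
      fun t ht c hc => absurd hc ((h t ht).not_touches c),
      fun t ht c hc => absurd hc ((h t ht).not_touches c),
      fun t ht c c' hc => absurd hc ((h t ht).not_touches c)⟩, ?_, rfl⟩
  · exact (h t ht).mem_configSpace hr
      (Submodule.add_mem _ hy.1.2.1 (Submodule.smul_mem _ _ hy.2.1))
  · exact Filter.Eventually.of_forall fun s => ⟨hrel s t, rfl, rfl⟩
  · exact Filter.Eventually.of_forall fun s => ⟨hrel s t, rfl, rfl⟩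
  · simp [Motion.phase]

/-- Being free is an open condition, and compactness of the time interval makes it uniform in time
for nearby initial points. -/
theorem eventually_flowsTo_freeFlight (hr : 0 < r) {x : State ν} {T : ℝ}
    (h : ∀ s ∈ Set.Icc (min 0 T) (max 0 T), IsFree k r (x.1 + s • x.2)) :
    ∀ᶠ y in 𝓝[phaseSpace ν k r] x, FlowsTo ν k r T y (freeFlight T y) := by
  have h1 : ∀ᶠ y in 𝓝 x, ∀ s ∈ Set.Icc (min 0 T) (max 0 T), IsFree k r (y.1 + s • y.2) := by
    refine isCompact_Icc.eventually_forall_of_forall_eventually fun s hs => ?_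
    have hc : Continuous fun z : State ν × ℝ => z.1.1 + z.2 • z.1.2 := by fun_prop
    exact hc.continuousAt.eventually ((h s hs).eventually hr)
  filter_upwards [nhdsWithin_le_nhds h1, self_mem_nhdsWithin] with y hy hyM
  exact flowsTo_freeFlight hr hyM hy

theorem reflect_neg (q v : Pair ν) (c : Collision ν) : reflect q (-v) c = -reflect q v c := by
  cases c with
  | ball m =>
    have h : inner ℝ ((-v) 0 - (-v) 1) (q 0 - q 1 + intVec m) =
        -inner ℝ (v 0 - v 1) (q 0 - q 1 + intVec m) := by
      rw [← inner_neg_left]; congr 1; simp only [Pi.neg_apply]; abel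
    funext β
    simp only [reflect, h, neg_div, neg_smul]
    generalize inner ℝ (v 0 - v 1) (q 0 - q 1 + intVec m) / ‖q 0 - q 1 + intVec m‖ ^ 2 = a
    generalize a • (q 0 - q 1 + intVec m) = u
    fin_cases β
    · change -v 0 - -u = -(v 0 - u)
      abel
    · change -v 1 + -u = -(v 1 + u)
      abel
  | wall β j top =>
    funext β'
    ext i
    simp only [Pi.neg_apply, PiLp.neg_apply, reflect_wall_apply]
    split_ifs <;> rfl

/-- All collisions except `c` stay away from `B`. -/
def OnlyTouches (k : ℕ) (r : ℝ) (c : Collision ν) (B : Set (Pair ν)) : Prop :=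
  ∀ q ∈ B, ∀ c' : Collision ν, c'.Admissible k → c' ≠ c → 0 < gap r q c'

/-- Convexity keeps both straight legs inside `B`, where only `c` can be touched. On the legs the
gap of `c` is positive because the motion approaches before the impact and recedes after it. The
impact is placed at time zero. -/
theorem flowsTo_bounce (hr : 0 < r) {c : Collision ν} {B : Set (Pair ν)} (hB : Convex ℝ B)
    (hBc : OnlyTouches k r c B) {q v : Pair ν} (hq : q ∈ pairSubspace ν k)
    (hv : v ∈ pairSubspace ν k) (hv1 : ‖v 0‖ ^ 2 + ‖v 1‖ ^ 2 = 1) (hc : Touches k r q c)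
    (hn : gapSpeed q v c < 0) {a b : ℝ} (ha : a < 0) (hb : 0 < b) (h1 : q + a • v ∈ B)
    (h2 : q ∈ B) (h3 : q + b • reflect q v c ∈ B) :
    FlowsTo ν k r (b - a) (q + a • v, v) (q + b • reflect q v c, reflect q v c) := by
  set w := reflect q v c with hw
  have hwS : w ∈ pairSubspace ν k := reflect_mem_pairSubspace hc.admissible hv
  have hw1 : ‖w 0‖ ^ 2 + ‖w 1‖ ^ 2 = 1 := (energy_reflect hr hc v).trans hv1
  have hnw : 0 < gapSpeed q w c := by rw [hw, gapSpeed_reflect hr hc]; linarith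
  have h0 := gap_eq_zero_of_touches hc
  have memB : ∀ {u : Pair ν} {d s : ℝ}, q + d • u ∈ B → d ≠ 0 → s / d ∈ Set.Icc (0 : ℝ) 1 →
      q + s • u ∈ B := fun {u d s} hd hd0 hs => by
    have := hB.add_smul_mem h2 hd hs
    rwa [smul_smul, div_mul_cancel₀ _ hd0] at this
  have hBneg : ∀ {t : ℝ}, a ≤ t → t < 0 → IsFree k r (q + t • v) := fun {t} hat ht c' hc' => by
    by_cases hcc : c' = c
    · subst hcc
      exact gap_pos_of_incoming h0 hn ht
    · refine hBc _ (memB h1 ha.ne ⟨div_nonneg_of_nonpos ht.le ha.le, ?_⟩) c' hc' hcc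
      rw [div_le_one_of_neg ha]
      exact hat
  have hBpos : ∀ {t : ℝ}, 0 < t → t ≤ b → IsFree k r (q + t • w) := fun {t} ht htb c' hc' => by
    by_cases hcc : c' = c
    · subst hcc
      exact gap_pos_of_outgoing h0 hnw ht
    · refine hBc _ (memB h3 hb.ne' ⟨by positivity, ?_⟩) c' hc' hcc
      rw [div_le_one hb]
      exact htb
  have honly : ∀ c', Touches k r q c' → c' = c := fun c' hc' => by
    by_contra hne
    have := hBc q h2 c' hc'.admissible hne
    rw [gap_eq_zero_of_touches hc'] at this
    exact lt_irrefl _ this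
  have hrel : ∀ (u : Pair ν) (s t : ℝ), q + s • u = q + t • u + (s - t) • u := fun u s t => by
    rw [sub_smul]; abel
  let ω : Motion ν := ⟨fun t => q + t • if t ≤ 0 then v else w, fun t => if t ≤ 0 then v else w,
    fun t => if t < 0 then v else w⟩
  have hωn : ∀ {t}, t < 0 → ω.q t = q + t • v ∧ ω.vIn t = v ∧ ω.vOut t = v := fun ht => by
    simp [ω, ht, ht.le]
  have hωp : ∀ {t}, 0 < t → ω.q t = q + t • w ∧ ω.vIn t = w ∧ ω.vOut t = w := fun ht => by
    simp [ω, ht.not_ge, ht.not_gt]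
  have hω0 : ω.q 0 = q ∧ ω.vIn 0 = v ∧ ω.vOut 0 = w := by simp [ω]
  have hfree : ∀ t ∈ Set.Icc a b, t ≠ 0 → IsFree k r (ω.q t) := fun t ht h => by
    rcases lt_or_gt_of_ne h with h | h
    · rw [(hωn h).1]; exact hBneg ht.1 h
    · rw [(hωp h).1]; exact hBpos h ht.2
  have horb : IsNonsingularOrbit ν k r a b ω := by
    refine ⟨fun t ht => ?_, fun t ht => ?_, fun t ht => ?_, fun t ht hnc => ?_,
      fun t ht c' hc' => ?_, fun t ht c' hc' => ?_, fun t ht c₁ c₂ hc₁ hc₂ => ?_⟩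
    · rcases lt_trichotomy t 0 with h | rfl | h
      · have := hfree t ht h.ne
        obtain ⟨e1, -, e3⟩ := hωn h
        rw [e1] at this
        refine ⟨?_, ?_⟩ <;> simp only [Motion.phase, e1, e3]
        · exact this.mem_configSpace hr (Submodule.add_mem _ hq (Submodule.smul_mem _ _ hv))
        · exact ⟨hv, hv1⟩
      · obtain ⟨e1, -, e3⟩ := hω0
        refine ⟨?_, ?_⟩ <;> simp only [Motion.phase, e1, e3]
        · refine (mem_configSpace_iff hr q).2 ⟨hq, fun c' hc' => ?_⟩
          by_cases hcc : c' = c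
          · rw [hcc, h0]
          · exact (hBc q h2 c' hc' hcc).le
        · exact ⟨hwS, hw1⟩
      · have := hfree t ht h.ne'
        obtain ⟨e1, -, e3⟩ := hωp h
        rw [e1] at this
        refine ⟨?_, ?_⟩ <;> simp only [Motion.phase, e1, e3]
        · exact this.mem_configSpace hr (Submodule.add_mem _ hq (Submodule.smul_mem _ _ hwS))
        · exact ⟨hwS, hw1⟩
    · rcases lt_trichotomy t 0 with h | rfl | h
      · filter_upwards [nhdsWithin_le_nhds (gt_mem_nhds h)] with s hs
        rw [(hωn hs).1, (hωn hs).2.1, (hωn hs).2.2, (hωn h).1, (hωn h).2.2]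
        exact ⟨hrel v s t, rfl, rfl⟩
      · filter_upwards [self_mem_nhdsWithin] with s hs
        rw [(hωp hs).1, (hωp hs).2.1, (hωp hs).2.2, hω0.1, hω0.2.2, sub_zero]
        exact ⟨rfl, rfl, rfl⟩
      · filter_upwards [nhdsWithin_le_nhds (lt_mem_nhds h)] with s hs
        rw [(hωp hs).1, (hωp hs).2.1, (hωp hs).2.2, (hωp h).1, (hωp h).2.2]
        exact ⟨hrel w s t, rfl, rfl⟩
    · rcases lt_trichotomy t 0 with h | rfl | h
      · filter_upwards [nhdsWithin_le_nhds (gt_mem_nhds h)] with s hs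
        rw [(hωn hs).1, (hωn hs).2.1, (hωn hs).2.2, (hωn h).1, (hωn h).2.1]
        exact ⟨hrel v s t, rfl, rfl⟩
      · filter_upwards [self_mem_nhdsWithin] with s hs
        rw [(hωn hs).1, (hωn hs).2.1, (hωn hs).2.2, hω0.1, hω0.2.1, sub_zero]
        exact ⟨rfl, rfl, rfl⟩
      · filter_upwards [nhdsWithin_le_nhds (lt_mem_nhds h)] with s hs
        rw [(hωp hs).1, (hωp hs).2.1, (hωp hs).2.2, (hωp h).1, (hωp h).2.1]
        exact ⟨hrel w s t, rfl, rfl⟩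
    · rcases lt_trichotomy t 0 with h | rfl | h
      · rw [(hωn h).2.1, (hωn h).2.2]
      · exact absurd ⟨c, hω0.1.symm ▸ hc⟩ hnc
      · rw [(hωp h).2.1, (hωp h).2.2]
    · by_cases h : t = 0
      · subst h
        rw [hω0.1] at hc' ⊢
        rw [hω0.2.1, hω0.2.2, honly c' hc']
      · exact absurd hc' ((hfree t ht h).not_touches c')
    · by_cases h : t = 0
      · subst h
        rw [hω0.1] at hc' ⊢
        rw [hω0.2.1, honly c' hc']
        exact (gapSpeed_ne_zero_iff _ _ _).1 hn.ne
      · exact absurd hc' ((hfree t ht h).not_touches c')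
    · by_cases h : t = 0
      · subst h
        rw [hω0.1] at hc₁ hc₂
        rw [honly c₁ hc₁, honly c₂ hc₂]
      · exact absurd hc₁ ((hfree t ht h).not_touches c₁)
  have hfin := horb.flowsTo (s := a) (t := b) ⟨le_rfl, (ha.trans hb).le⟩ ⟨(ha.trans hb).le, le_rfl⟩
  simpa only [Motion.phase, (hωn ha).1, (hωn ha).2.2, (hωp hb).1, (hωp hb).2.2] using hfin

/-- All the listed properties are strict inequalities, membership in an open set, or consequences of
the root formula, so they persist near the base point once the impact time is continuous there. -/
theorem eventually_bounce (hr : 0 < r) {c : Collision ν} {B : Set (Pair ν)} (hB : IsOpen B)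
    {q v : Pair ν} (hc : Touches k r q c) (hn : gapSpeed q v c < 0) {h₁ h₂ : ℝ} (hh₁ : 0 < h₁)
    (hh₂ : 0 < h₂) (m1 : q + (-h₁) • v ∈ B) (m2 : q ∈ B) (m3 : q + h₂ • reflect q v c ∈ B) :
    (ContDiffAt ℝ ⊤ (bounce r c (h₁ + h₂)) (q + (-h₁) • v, v) ∧
      ContDiffAt ℝ ⊤ (hitTime r c) (q + (-h₁) • v, v) ∧
      hitTime r c (q + (-h₁) • v, v) = h₁) ∧
    ∀ᶠ y : State ν in 𝓝 (q + (-h₁) • v, v), 0 < hitTime r c y ∧ hitTime r c y < h₁ + h₂ ∧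
      gap r (y.1 + hitTime r c y • y.2) c = 0 ∧
      gapSpeed (y.1 + hitTime r c y • y.2) y.2 c < 0 ∧ y.1 ∈ B ∧
      y.1 + hitTime r c y • y.2 ∈ B ∧ (bounce r c (h₁ + h₂) y).1 ∈ B := by
  set x : State ν := (q + (-h₁) • v, v) with hx
  obtain ⟨e1, e2, e3⟩ := hitTime_of_touches (gap_eq_zero_of_touches hc) hn hh₁.le
  rw [← hx] at e1 e2 e3
  have hT : ContDiffAt ℝ ⊤ (hitTime r c) x := contDiffAt_hitTime e1 e2
  have hQ : ContDiffAt ℝ ⊤ (fun y : State ν => y.1 + hitTime r c y • y.2) x :=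
    contDiffAt_fst.add (hT.smul contDiffAt_snd)
  have hq : x.1 + hitTime r c x • x.2 = q := by rw [e3]; simp [hx]
  have hR : ContDiffAt ℝ ⊤
      (fun y : State ν => reflect (y.1 + hitTime r c y • y.2) y.2 c) x := by
    refine ContDiffAt.comp (g := fun y : State ν => reflect y.1 y.2 c) x
      (contDiffAt_reflect ?_) (hQ.prodMk contDiffAt_snd)
    rintro m rfl
    simp only [hq]
    have := norm_sq_pos_of_touches hr hc
    exact fun h0 => by simp [h0] at this
  have hb : ContDiffAt ℝ ⊤ (bounce r c (h₁ + h₂)) x :=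
    (hQ.add ((contDiffAt_const.sub hT).smul hR)).prodMk hR
  have hbx : (bounce r c (h₁ + h₂) x).1 ∈ B := by
    simp only [bounce]
    rwa [hq, e3, add_sub_cancel_left]
  refine ⟨⟨hb, hT, e3⟩, ?_⟩
  have cS : ContinuousAt (fun y : State ν => gapSpeed y.1 y.2 c) x :=
    (contDiff_gapSpeed (n := 0) c).continuous.continuousAt
  have cG : ContinuousAt (fun y : State ν => gap r y.1 c) x :=
    ((contDiff_gap (n := 0) c).continuous.comp continuous_fst).continuousAt
  have cC : ContinuousAt (fun y : State ν => gapCurv y.2 c) x :=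
    ((contDiff_gapCurv (n := 0) c).continuous.comp continuous_snd).continuousAt
  have cD : ContinuousAt (fun y : State ν =>
      gapSpeed y.1 y.2 c ^ 2 - 4 * gapCurv y.2 c * gap r y.1 c) x :=
    (cS.pow 2).sub ((continuousAt_const.mul cC).mul cG)
  filter_upwards [hT.continuousAt.eventually (lt_mem_nhds (show 0 < hitTime r c x by rwa [e3])),
    hT.continuousAt.eventually (gt_mem_nhds (show hitTime r c x < h₁ + h₂ by linarith)),
    cS.eventually (gt_mem_nhds e1), cD.eventually (lt_mem_nhds e2),
    continuousAt_fst.eventually (hB.mem_nhds (show x.1 ∈ B from m1)),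
    hQ.continuousAt.eventually (hB.mem_nhds
      (show x.1 + hitTime r c x • x.2 ∈ B by rwa [hq])),
    (continuousAt_fst.comp hb.continuousAt).eventually (hB.mem_nhds hbx)]
    with y y1 y2 y3 y4 y5 y6 y7
  exact ⟨y1, y2, (gap_hitTime y3 y4).1, (gap_hitTime y3 y4).2, y5, y6, y7⟩

theorem eventually_flowsTo_bounce (hr : 0 < r) {c : Collision ν} {B : Set (Pair ν)}
    (hB : IsOpen B) (hBc : Convex ℝ B) (hBt : OnlyTouches k r c B)
    {q v : Pair ν} (hc : Touches k r q c) (hn : gapSpeed q v c < 0) {h₁ h₂ : ℝ} (hh₁ : 0 < h₁)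
    (hh₂ : 0 < h₂) (m1 : q + (-h₁) • v ∈ B) (m2 : q ∈ B) (m3 : q + h₂ • reflect q v c ∈ B) :
    ∀ᶠ y : State ν in 𝓝[phaseSpace ν k r] (q + (-h₁) • v, v),
      FlowsTo ν k r (h₁ + h₂) y (bounce r c (h₁ + h₂) y) := by
  filter_upwards [nhdsWithin_le_nhds (eventually_bounce hr hB hc hn hh₁ hh₂ m1 m2 m3).2,
    self_mem_nhdsWithin] with y ⟨y1, y2, y3, y4, y5, y6, y7⟩ hy
  have := flowsTo_bounce hr hBc hBt
    (Submodule.add_mem _ hy.1.2.1 (Submodule.smul_mem _ (hitTime r c y) hy.2.1)) hy.2.1 hy.2.2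
    ((touches_iff hr _ _).2 ⟨hc.admissible, y3⟩) y4 (neg_neg_of_pos y1) (sub_pos.2 y2)
    (by simpa using y5) y6 y7
  simpa [bounce] using this

theorem timeReverse_mem {y : State ν} (h : y ∈ phaseSpace ν k r) :
    timeReverse y ∈ phaseSpace ν k r :=
  ⟨h.1, Submodule.neg_mem _ h.2.1, by simpa [timeReverse] using h.2.2⟩

/-- Reversing velocities turns the outgoing leg into an incoming one on the same component, so the
backward flow is the forward bounce conjugated by time reversal. It is needed because segments
extend to negative times. -/
theorem eventually_flowsTo_bounce_reverse (hr : 0 < r) {c : Collision ν} {B : Set (Pair ν)}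
    (hB : IsOpen B) (hBc : Convex ℝ B) (hBt : OnlyTouches k r c B)
    {q v : Pair ν} (hc : Touches k r q c) (hn : gapSpeed q v c < 0) {h₁ h₂ : ℝ} (hh₁ : 0 < h₁)
    (hh₂ : 0 < h₂) (m1 : q + (-h₁) • v ∈ B) (m2 : q ∈ B) (m3 : q + h₂ • reflect q v c ∈ B) :
    ContDiffAt ℝ ⊤ (timeReverse ∘ bounce r c (h₁ + h₂) ∘ timeReverse)
      (q + h₂ • reflect q v c, reflect q v c) ∧
    ∀ᶠ y : State ν in 𝓝[phaseSpace ν k r] (q + h₂ • reflect q v c, reflect q v c),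
      FlowsTo ν k r (-(h₁ + h₂)) y ((timeReverse ∘ bounce r c (h₁ + h₂) ∘ timeReverse) y) := by
  set w := reflect q v c with hw
  have hrw : reflect q (-w) c = -v := by rw [reflect_neg, hw, reflect_reflect hr hc]
  have hnw : gapSpeed q (-w) c < 0 := by rw [gapSpeed_neg, hw, gapSpeed_reflect hr hc]; linarith
  have hpt : timeReverse (q + h₂ • w, w) = (q + (-h₂) • (-w), -w) := by simp [timeReverse]
  obtain ⟨⟨d1, -, -⟩, d2⟩ := eventually_bounce hr hB hc hnw hh₂ hh₁
    (by simpa using m3) m2 (by rw [hrw]; simpa using m1)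
  rw [← hpt, add_comm h₂ h₁] at d1 d2
  refine ⟨contDiff_timeReverse.contDiffAt.comp _ (d1.comp _ contDiff_timeReverse.contDiffAt), ?_⟩
  have hc' := (contDiff_timeReverse (ν := ν) (n := 0)).continuous.continuousAt
    (x := (q + h₂ • w, w))
  filter_upwards [nhdsWithin_le_nhds (hc'.eventually d2), self_mem_nhdsWithin]
    with y ⟨y1, y2, y3, y4, y5, y6, y7⟩ hy
  have hy' := timeReverse_mem hy
  set z := timeReverse y with hz
  have hyz : y = timeReverse z := by simp [hz, timeReverse]
  set p := z.1 + hitTime r c z • z.2 with hp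
  have ht : Touches k r p c := (touches_iff hr _ _).2 ⟨hc.admissible, y3⟩
  set z' := reflect p z.2 c with hz'
  have e1 : reflect p (-z') c = -z.2 := by rw [reflect_neg, hz', reflect_reflect hr ht]
  have hb : bounce r c (h₁ + h₂) z = (p + (h₁ + h₂ - hitTime r c z) • z', z') := rfl
  have := flowsTo_bounce hr hBc hBt (q := p) (v := -z') (a := -(h₁ + h₂ - hitTime r c z))
    (b := hitTime r c z)
    (Submodule.add_mem _ hy'.1.2.1 (Submodule.smul_mem _ _ hy'.2.1))
    (Submodule.neg_mem _ (reflect_mem_pairSubspace hc.admissible hy'.2.1))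
    (by
      have := energy_reflect hr ht z.2
      rw [hy'.2.2, ← hz'] at this
      simpa using this) ht
    (by rw [gapSpeed_neg, hz', gapSpeed_reflect hr ht]; linarith) (by linarith) y1
    (by rw [hb] at y7; rwa [neg_smul_neg]) y6 (by rw [e1]; simpa [hp] using y5)
  have := this.symm
  rw [e1] at this
  have e2 : (p + hitTime r c z • -z.2, -z.2) = y := by
    rw [hyz]; simp [hp, timeReverse]
  have e3 : (p + (-(h₁ + h₂ - hitTime r c z)) • -z', -z') =
      timeReverse (bounce r c (h₁ + h₂) z) := by
    rw [hb, neg_smul_neg]; rfl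
  have e4 : -(hitTime r c z - -(h₁ + h₂ - hitTime r c z)) = -(h₁ + h₂) := by ring
  rwa [e2, e3, e4] at this

end LocalFlow

/-! ### Decomposition of an orbit into local steps -/

section LocalSteps

variable {ν k : ℕ} {r : ℝ}

/-- Near `x`, the flow at time `t` is the restriction to `𝐌` of an analytic map taking `x` to
`y`. -/
def FlowGerm (ν k : ℕ) (r t : ℝ) (x y : State ν) : Prop :=
  ∃ Φ : State ν → State ν, ContDiffAt ℝ ⊤ Φ x ∧ Φ x = y ∧
    ∀ᶠ z in 𝓝[phaseSpace ν k r] x, FlowsTo ν k r t z (Φ z)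

theorem tendsto_nhdsWithin_phaseSpace {t : ℝ} {x : State ν} {Φ : State ν → State ν}
    (hc : ContinuousAt Φ x) (h : ∀ᶠ z in 𝓝[phaseSpace ν k r] x, FlowsTo ν k r t z (Φ z)) :
    Filter.Tendsto Φ (𝓝[phaseSpace ν k r] x) (𝓝[phaseSpace ν k r] (Φ x)) :=
  tendsto_nhdsWithin_iff.2 ⟨hc.tendsto.mono_left nhdsWithin_le_nhds, h.mono fun _ hz => hz.mem_right⟩

theorem FlowGerm.trans (hr : 0 < r) {t t' : ℝ} {x y z : State ν} (h : FlowGerm ν k r t x y)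
    (h' : FlowGerm ν k r t' y z) : FlowGerm ν k r (t + t') x z := by
  obtain ⟨Φ, h1, rfl, h3⟩ := h
  obtain ⟨Ψ, h1', rfl, h3'⟩ := h'
  refine ⟨Ψ ∘ Φ, h1'.comp x h1, rfl, ?_⟩
  filter_upwards [h3, (tendsto_nhdsWithin_phaseSpace h1.continuousAt h3).eventually h3']
    with w hw hw' using hw.trans hr hw'

theorem flowGerm_zero (hr : 0 < r) {x : State ν} (hx : IsFree k r x.1) :
    FlowGerm ν k r 0 x x := by
  have h0 : ∀ y : State ν, freeFlight 0 y = y := fun y => by simp [freeFlight]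
  refine ⟨freeFlight 0, (contDiff_freeFlight 0).contDiffAt, h0 x, ?_⟩
  exact eventually_flowsTo_freeFlight hr fun s hs => by
    have : s = 0 := by simpa using hs
    simpa [this] using hx

/-- Near `x`, the flow at time `t` is uniform motion. -/
def FreeStep (ν k : ℕ) (r t : ℝ) (x y : State ν) : Prop :=
  freeFlight t x = y ∧ ∀ᶠ z in 𝓝[phaseSpace ν k r] x, FlowsTo ν k r t z (freeFlight t z)

/-- Near `x`, the flow at time `t` consists of exactly one collision `c`. -/
structure BounceStep (ν k : ℕ) (r : ℝ) (c : Collision ν) (t : ℝ) (x y : State ν) : Prop where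
  bounce_eq : bounce r c t x = y
  contDiffAt_bounce : ContDiffAt ℝ ⊤ (bounce r c t) x
  contDiffAt_hitTime : ContDiffAt ℝ ⊤ (hitTime r c) x
  flowsTo : ∀ᶠ z in 𝓝[phaseSpace ν k r] x, FlowsTo ν k r t z (bounce r c t z)
  gap_hit : ∀ᶠ z : State ν in 𝓝 x, gap r (z.1 + hitTime r c z • z.2) c = 0
  touches : Touches k r (x.1 + hitTime r c x • x.2) c
  gapSpeed_neg : gapSpeed (x.1 + hitTime r c x • x.2) x.2 c < 0

theorem FreeStep.flowGerm {t : ℝ} {x y : State ν} (h : FreeStep ν k r t x y) :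
    FlowGerm ν k r t x y :=
  ⟨freeFlight t, (contDiff_freeFlight t).contDiffAt, h.1, h.2⟩

theorem BounceStep.flowGerm {c : Collision ν} {t : ℝ} {x y : State ν}
    (h : BounceStep ν k r c t x y) : FlowGerm ν k r t x y :=
  ⟨bounce r c t, h.contDiffAt_bounce, h.bounce_eq, h.flowsTo⟩

namespace IsNonsingularOrbit

variable {a b : ℝ} {ω : Motion ν}

theorem gapSpeed_vIn_ne_zero (h : IsNonsingularOrbit ν k r a b ω) {τ : ℝ} (hτ : τ ∈ Set.Icc a b)
    {c : Collision ν} (hc : Touches k r (ω.q τ) c) : gapSpeed (ω.q τ) (ω.vIn τ) c ≠ 0 :=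
  (gapSpeed_ne_zero_iff _ _ _).2 (h.transversal τ hτ c hc)

/-- Components not touched at `τ` stay at positive distance by continuity. Touched ones are left
with positive speed, since the orbit remains in the configuration space. -/
theorem eventually_right (hr : 0 < r) (h : IsNonsingularOrbit ν k r a b ω) {τ : ℝ}
    (hτ : τ ∈ Set.Ico a b) :
    ∀ᶠ s in 𝓝[>] τ, ω.phase s = (ω.q τ + (s - τ) • ω.vOut τ, ω.vOut τ) ∧
      IsFree k r (ω.q τ + (s - τ) • ω.vOut τ) := by
  have hτ' : τ ∈ Set.Icc a b := ⟨hτ.1, hτ.2.le⟩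
  have hq : ∀ᶠ s in 𝓝[>] τ, ω.phase s = (ω.q τ + (s - τ) • ω.vOut τ, ω.vOut τ) := by
    filter_upwards [h.forward τ hτ] with s hs
    simp only [Motion.phase, hs.1, hs.2.2]
  have hcfg : ∀ᶠ s in 𝓝[>] τ, ω.q τ + (s - τ) • ω.vOut τ ∈ configSpace ν k r := by
    filter_upwards [hq, Ioo_mem_nhdsGT hτ.2] with s hs hs'
    have := (h.mem s ⟨hτ.1.trans hs'.1.le, hs'.2.le⟩).1
    rwa [hs] at this
  have hshift : Filter.Tendsto (fun x : ℝ => τ + x) (𝓝[>] 0) (𝓝[>] τ) := by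
    refine tendsto_nhdsWithin_iff.2 ⟨?_, ?_⟩
    · exact (Continuous.tendsto' (by fun_prop) _ _ (add_zero τ)).mono_left nhdsWithin_le_nhds
    · filter_upwards [self_mem_nhdsWithin] with x hx using lt_add_of_pos_right τ hx
  have hspeed : ∀ c, Touches k r (ω.q τ) c → 0 < gapSpeed (ω.q τ) (ω.vOut τ) c := fun c hc => by
    refine gapSpeed_pos_of_gap_nonneg (gap_eq_zero_of_touches hc) ?_ ?_
    · rw [h.collide τ hτ' c hc, gapSpeed_reflect hr hc]
      exact neg_ne_zero.2 (h.gapSpeed_vIn_ne_zero hτ' hc)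
    · filter_upwards [hshift.eventually hcfg] with x hx
      rw [add_sub_cancel_left] at hx
      exact ((mem_configSpace_iff hr _).1 hx).2 c hc.admissible
  have hcont : Filter.Tendsto (fun s : ℝ => ω.q τ + (s - τ) • ω.vOut τ) (𝓝[>] τ) (𝓝 (ω.q τ)) :=
    (Continuous.tendsto' (by fun_prop) _ _ (by simp)).mono_left nhdsWithin_le_nhds
  filter_upwards [hq, hcont.eventually (eventually_gap_pos hr (ω.q τ)), self_mem_nhdsWithin]
    with s h1 h2 h3
  refine ⟨h1, fun c hc => ?_⟩
  rcases (((mem_configSpace_iff hr _).1 (h.mem τ hτ').1).2 c hc).lt_or_eq with h4 | h4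
  · exact h2 c h4
  · exact gap_pos_of_outgoing h4.symm (hspeed c ((touches_iff hr _ _).2 ⟨hc, h4.symm⟩))
      (sub_pos.2 h3)

theorem eventually_left (hr : 0 < r) (h : IsNonsingularOrbit ν k r a b ω) {τ : ℝ}
    (hτ : τ ∈ Set.Ioc a b) :
    (∀ᶠ s in 𝓝[<] τ, ω.phase s = (ω.q τ + (s - τ) • ω.vIn τ, ω.vIn τ) ∧
      IsFree k r (ω.q τ + (s - τ) • ω.vIn τ)) ∧
    ∀ c, Touches k r (ω.q τ) c → gapSpeed (ω.q τ) (ω.vIn τ) c < 0 := by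
  have hτ' : τ ∈ Set.Icc a b := ⟨hτ.1.le, hτ.2⟩
  have hq : ∀ᶠ s in 𝓝[<] τ, ω.phase s = (ω.q τ + (s - τ) • ω.vIn τ, ω.vIn τ) := by
    filter_upwards [h.backward τ hτ] with s hs
    simp only [Motion.phase, hs.1, hs.2.2]
  have hcfg : ∀ᶠ s in 𝓝[<] τ, ω.q τ + (s - τ) • ω.vIn τ ∈ configSpace ν k r := by
    filter_upwards [hq, Ioo_mem_nhdsLT hτ.1] with s hs hs'
    have := (h.mem s ⟨hs'.1.le, hs'.2.le.trans hτ.2⟩).1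
    rwa [hs] at this
  have hshift : Filter.Tendsto (fun x : ℝ => τ - x) (𝓝[>] 0) (𝓝[<] τ) := by
    refine tendsto_nhdsWithin_iff.2 ⟨?_, ?_⟩
    · exact (Continuous.tendsto' (by fun_prop) _ _ (sub_zero τ)).mono_left nhdsWithin_le_nhds
    · filter_upwards [self_mem_nhdsWithin] with x hx using sub_lt_self τ hx
  have hspeed : ∀ c, Touches k r (ω.q τ) c → gapSpeed (ω.q τ) (ω.vIn τ) c < 0 := fun c hc => by
    -- Backwards in time the motion has velocity `-vIn`, and the forward argument applies to it.
    rw [← neg_pos, ← TwoBalls.gapSpeed_neg]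
    refine gapSpeed_pos_of_gap_nonneg (r := r) (gap_eq_zero_of_touches hc) ?_ ?_
    · rw [TwoBalls.gapSpeed_neg]
      exact neg_ne_zero.2 (h.gapSpeed_vIn_ne_zero hτ' hc)
    · filter_upwards [hshift.eventually hcfg] with x hx
      rw [sub_sub_cancel_left, neg_smul, ← smul_neg] at hx
      exact ((mem_configSpace_iff hr _).1 hx).2 c hc.admissible
  have hcont : Filter.Tendsto (fun s : ℝ => ω.q τ + (s - τ) • ω.vIn τ) (𝓝[<] τ) (𝓝 (ω.q τ)) :=
    (Continuous.tendsto' (by fun_prop) _ _ (by simp)).mono_left nhdsWithin_le_nhds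
  refine ⟨?_, hspeed⟩
  filter_upwards [hq, hcont.eventually (eventually_gap_pos hr (ω.q τ)), self_mem_nhdsWithin]
    with s h1 h2 h3
  refine ⟨h1, fun c hc => ?_⟩
  rcases (((mem_configSpace_iff hr _).1 (h.mem τ hτ').1).2 c hc).lt_or_eq with h4 | h4
  · exact h2 c h4
  · exact gap_pos_of_incoming h4.symm (hspeed c ((touches_iff hr _ _).2 ⟨hc, h4.symm⟩))
      (sub_neg.2 h3)

theorem isFree_of_not_collisionTime (hr : 0 < r) (h : IsNonsingularOrbit ν k r a b ω) {τ : ℝ}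
    (hτ : τ ∈ Set.Icc a b) (hc : ¬ ω.IsCollisionTime k r τ) : IsFree k r (ω.q τ) :=
  isFree_of_not_touches hr (h.mem τ hτ).1 fun c hc' => hc ⟨c, hc'⟩

/-- Two phase points on a straight stretch of an orbit are related by uniform motion. -/
theorem freeStep_of_straight (hr : 0 < r) {q v : Pair ν} {τ u₁ u₂ : ℝ}
    (h : ∀ σ ∈ Set.Ioo u₁ u₂, IsFree k r (q + (σ - τ) • v)) {s t : ℝ} (hs : s ∈ Set.Ioo u₁ u₂)
    (ht : t ∈ Set.Ioo u₁ u₂) :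
    FreeStep ν k r (t - s) (q + (s - τ) • v, v) (q + (t - τ) • v, v) := by
  have hrel : ∀ x : ℝ, q + (s - τ) • v + x • v = q + (s + x - τ) • v := fun x => by
    rw [add_assoc, ← add_smul]; ring_nf
  refine ⟨?_, eventually_flowsTo_freeFlight hr fun x hx => ?_⟩
  · simp only [freeFlight, hrel]
    rw [add_sub_cancel]
  · simp only [hrel]
    refine h _ ⟨?_, ?_⟩
    · rcases le_total 0 (t - s) with h0 | h0
      · rw [min_eq_left h0] at hx
        linarith [hs.1, hx.1]
      · rw [min_eq_right h0] at hx
        linarith [ht.1, hx.1]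
    · rcases le_total 0 (t - s) with h0 | h0
      · rw [max_eq_right h0] at hx
        linarith [ht.2, hx.2]
      · rw [max_eq_left h0] at hx
        linarith [hs.2, hx.2]

theorem freeStep_near (hr : 0 < r) (h : IsNonsingularOrbit ν k r a b ω) {τ : ℝ}
    (hτ : τ ∈ Set.Icc a b) (hc : ¬ ω.IsCollisionTime k r τ) :
    ∃ ε > 0, ∀ s ∈ Set.Icc a b, ∀ t ∈ Set.Icc a b, |s - τ| < ε → |t - τ| < ε →
      IsFree k r (ω.q s) ∧ FreeStep ν k r (t - s) (ω.phase s) (ω.phase t) := by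
  have hv := h.free τ hτ hc
  have hfree : ∀ᶠ s in 𝓝 τ, IsFree k r (ω.q τ + (s - τ) • ω.vOut τ) := by
    have hcont : Filter.Tendsto (fun s : ℝ => ω.q τ + (s - τ) • ω.vOut τ) (𝓝 τ) (𝓝 (ω.q τ)) :=
      Continuous.tendsto' (by fun_prop) _ _ (by simp)
    exact hcont.eventually ((h.isFree_of_not_collisionTime hr hτ hc).eventually hr)
  have hph : ∀ᶠ s in 𝓝 τ, s ∈ Set.Icc a b →
      ω.phase s = (ω.q τ + (s - τ) • ω.vOut τ, ω.vOut τ) := by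
    have := eventually_nhdsWithin_Icc_diff (a := a) (b := b) (t := τ)
      (p := fun s => ω.phase s = (ω.q τ + (s - τ) • ω.vOut τ, ω.vOut τ))
      (fun h1 => by
        rw [hv]
        exact (h.eventually_left hr ⟨h1, hτ.2⟩).1.mono fun s hs => hs.1)
      (fun h1 => (h.eventually_right hr ⟨hτ.1, h1⟩).mono fun s hs => hs.1)
    filter_upwards [eventually_nhdsWithin_iff.1 this] with s hs hs'
    by_cases hst : s = τ
    · subst hst; simp [Motion.phase]
    · exact hs ⟨hs', hst⟩
  obtain ⟨ε, hε, hball⟩ := Metric.eventually_nhds_iff.1 (hfree.and hph)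
  refine ⟨ε, hε, fun s hs t ht hsε htε => ?_⟩
  have e1 := (hball (y := s) (by rwa [Real.dist_eq])).2 hs
  have e2 := (hball (y := t) (by rwa [Real.dist_eq])).2 ht
  have hmem : ∀ {x : ℝ}, |x - τ| < ε → x ∈ Set.Ioo (τ - ε) (τ + ε) := fun hx => by
    rw [abs_lt] at hx
    constructor <;> linarith
  refine ⟨?_, ?_⟩
  · rw [show ω.q s = _ from congrArg Prod.fst e1]
    exact (hball (y := s) (by rwa [Real.dist_eq])).1
  · rw [e1, e2]
    refine freeStep_of_straight hr (u₁ := τ - ε) (u₂ := τ + ε) (fun σ hσ => ?_) (hmem hsε) (hmem htε)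
    refine (hball (y := σ) ?_).1
    rw [Real.dist_eq, abs_lt]
    constructor <;> linarith [hσ.1, hσ.2]

/-- Since no second component is touched at `τ`, a small ball around the configuration meets only
`c`. All times close to `τ` keep both legs in it, so the explicit bounce describes the flow of all
nearby phase points. Backwards only a germ is recorded, as derivatives through collisions are
computed forwards. -/
theorem steps_near_collision (hr : 0 < r) (h : IsNonsingularOrbit ν k r a b ω) {τ : ℝ}
    (hτ : τ ∈ Set.Ioo a b) {c : Collision ν} (hc : Touches k r (ω.q τ) c) :
    ∃ ε > 0, (∀ s, |s - τ| < ε → s ∈ Set.Icc a b ∧ (s ≠ τ → IsFree k r (ω.q s))) ∧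
      (∀ s ∈ Set.Ioo (τ - ε) τ, ∀ t ∈ Set.Ioo (τ - ε) τ,
        FreeStep ν k r (t - s) (ω.phase s) (ω.phase t)) ∧
      (∀ s ∈ Set.Ioo τ (τ + ε), ∀ t ∈ Set.Ioo τ (τ + ε),
        FreeStep ν k r (t - s) (ω.phase s) (ω.phase t)) ∧
      ∀ s ∈ Set.Ioo (τ - ε) τ, ∀ t ∈ Set.Ioo τ (τ + ε),
        BounceStep ν k r c (t - s) (ω.phase s) (ω.phase t) ∧
        FlowGerm ν k r (s - t) (ω.phase t) (ω.phase s) := by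
  have hτ' : τ ∈ Set.Icc a b := ⟨hτ.1.le, hτ.2.le⟩
  obtain ⟨hl, hn⟩ := h.eventually_left hr ⟨hτ.1, hτ.2.le⟩
  have hn := hn c hc
  have hR := h.eventually_right hr ⟨hτ.1.le, hτ.2⟩
  have hv : ω.vOut τ = reflect (ω.q τ) (ω.vIn τ) c := h.collide τ hτ' c hc
  set q := ω.q τ
  set v := ω.vIn τ
  set w := ω.vOut τ
  obtain ⟨ρ, hρ, hball⟩ := Metric.eventually_nhds_iff_ball.1 (eventually_gap_pos hr q)
  set B := Metric.ball q ρ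
  have hBt : OnlyTouches k r c B := fun q' hq' c' hc' hne => by
    refine hball q' hq' c' (lt_of_le_of_ne
      (((mem_configSpace_iff hr _).1 (h.mem τ hτ').1).2 c' hc') fun h0 => hne ?_)
    exact h.simple τ hτ' c' c ((touches_iff hr _ _).2 ⟨hc', h0.symm⟩) hc
  have hmB : ∀ u : Pair ν, ∀ᶠ s in 𝓝 τ, q + (s - τ) • u ∈ B := fun u => by
    have hcont : Filter.Tendsto (fun s : ℝ => q + (s - τ) • u) (𝓝 τ) (𝓝 q) :=
      Continuous.tendsto' (by fun_prop) _ _ (by simp)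
    exact hcont.eventually (Metric.ball_mem_nhds q hρ)
  obtain ⟨ε, hε, hE⟩ := Metric.eventually_nhds_iff.1 ((hmB v).and ((hmB w).and
    ((eventually_nhdsWithin_iff.1 hl).and ((eventually_nhdsWithin_iff.1 hR).and
      (Icc_mem_nhds hτ.1 hτ.2)))))
  have hd : ∀ {s : ℝ}, s ∈ Set.Ioo (τ - ε) (τ + ε) → dist s τ < ε := fun hs => by
    rw [Real.dist_eq, abs_lt]
    constructor <;> linarith [hs.1, hs.2]
  have hL' : ∀ {s : ℝ}, s ∈ Set.Ioo (τ - ε) τ → s ∈ Set.Ioo (τ - ε) (τ + ε) := fun hs =>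
    ⟨hs.1, by linarith [hs.2]⟩
  have hR' : ∀ {s : ℝ}, s ∈ Set.Ioo τ (τ + ε) → s ∈ Set.Ioo (τ - ε) (τ + ε) := fun hs =>
    ⟨by linarith [hs.1], hs.2⟩
  refine ⟨ε, hε, fun s hs => ⟨?_, fun hne => ?_⟩, fun s hs t ht => ?_, fun s hs t ht => ?_,
    fun s hs t ht => ?_⟩
  · exact (hE (y := s) (by rwa [Real.dist_eq])).2.2.2.2
  · obtain ⟨-, -, h1, h2, -⟩ := hE (y := s) (by rwa [Real.dist_eq])
    rcases lt_or_gt_of_ne hne with h3 | h3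
    · rw [show ω.q s = _ from congrArg Prod.fst (h1 h3).1]
      exact (h1 h3).2
    · rw [show ω.q s = _ from congrArg Prod.fst (h2 h3).1]
      exact (h2 h3).2
  · rw [((hE (hd (hL' hs))).2.2.1 hs.2).1, ((hE (hd (hL' ht))).2.2.1 ht.2).1]
    exact freeStep_of_straight hr (fun σ hσ => ((hE (hd (hL' hσ))).2.2.1 hσ.2).2) hs ht
  · rw [((hE (hd (hR' hs))).2.2.2.1 hs.1).1, ((hE (hd (hR' ht))).2.2.2.1 ht.1).1]
    exact freeStep_of_straight hr (fun σ hσ => ((hE (hd (hR' hσ))).2.2.2.1 hσ.1).2) hs ht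
  · obtain ⟨m1, -, e1, -, hsab⟩ := hE (hd (hL' hs))
    obtain ⟨-, m3, -, e2, -⟩ := hE (hd (hR' ht))
    have e1 := (e1 hs.2).1
    have e2 := (e2 ht.1).1
    have hs0 : s - τ = -(τ - s) := by ring
    have hts : t - s = (τ - s) + (t - τ) := by ring
    have hts' : s - t = -((τ - s) + (t - τ)) := by ring
    rw [e1, e2, hts', hts]
    rw [hs0] at m1 ⊢
    rw [hv] at m3 ⊢
    have p1 : 0 < τ - s := sub_pos.2 hs.2
    have p2 : 0 < t - τ := sub_pos.2 ht.1
    have m2 : q ∈ B := Metric.mem_ball_self hρ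
    obtain ⟨⟨d1, d2, d3⟩, d4⟩ := eventually_bounce hr Metric.isOpen_ball hc hn p1 p2 m1 m2 m3
    have hq : q + (-(τ - s)) • v + (τ - s) • v = q := by rw [neg_smul, neg_add_cancel_right]
    have hb : bounce r c (τ - s + (t - τ)) (q + (-(τ - s)) • v, v)
        = (q + (t - τ) • reflect q v c, reflect q v c) := by
      simp only [bounce, d3, hq, add_sub_cancel_left]
    refine ⟨⟨hb, d1, d2, eventually_flowsTo_bounce hr Metric.isOpen_ball (convex_ball _ _) hBt hc hn
      p1 p2 m1 m2 m3, d4.mono fun z hz => hz.2.2.1, ?_, ?_⟩, ?_⟩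
    · simp only [d3, hq]; exact hc
    · simp only [d3, hq]; exact hn
    · obtain ⟨f1, f2⟩ := eventually_flowsTo_bounce_reverse hr Metric.isOpen_ball (convex_ball _ _)
        hBt hc hn p1 p2 m1 m2 m3
      refine ⟨_, f1, ?_, f2⟩
      -- The value of the backward map at the base point is identified by uniqueness: reversing the
      -- forward bounce gives another flow from that point.
      have hfl := (eventually_flowsTo_bounce hr Metric.isOpen_ball (convex_ball _ _) hBt hc hn
        p1 p2 m1 m2 m3).self_of_nhdsWithin (by
          rw [← hs0, ← e1]
          exact h.mem s hsab)
      rw [hb] at hfl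
      exact (f2.self_of_nhdsWithin hfl.mem_right).unique hr hfl.symm

end IsNonsingularOrbit

end LocalSteps

/-! ### Continuation along an interval; the flow near an orbit and its derivative -/

/-- A function on an interval that is constant on punctured neighbourhoods of all points takes the
same value on all of them. -/
theorem exists_eventually_eq_of_locally {α : Type*} {I : Set ℝ} (hI : IsPreconnected I)
    (hI' : I.Nontrivial) (g : ℝ → α)
    (h : ∀ τ ∈ I, ∃ ε > 0, ∀ s ∈ I, ∀ t ∈ I, s ≠ τ → t ≠ τ → |s - τ| < ε → |t - τ| < ε →
      g s = g t) :
    ∃ c, ∀ τ ∈ I, ∀ᶠ x in 𝓝[I \ {τ}] τ, g x = c := by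
  have hne : ∀ τ ∈ I, (𝓝[I \ {τ}] τ).NeBot := fun τ hτ => by
    have := hI.preperfect_of_nontrivial hI' τ hτ
    rw [accPt_principal_iff_nhdsWithin] at this
    exact this
  have hG : ∀ τ, ∃ c, τ ∈ I → ∀ᶠ x in 𝓝[I \ {τ}] τ, g x = c := fun τ => by
    by_cases hτ : τ ∈ I
    · obtain ⟨ε, hε, hE⟩ := h τ hτ
      have hev : ∀ᶠ x in 𝓝[I \ {τ}] τ, (x ∈ I ∧ x ≠ τ) ∧ |x - τ| < ε := by
        refine (eventually_mem_nhdsWithin).and (nhdsWithin_le_nhds ?_)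
        filter_upwards [Metric.ball_mem_nhds τ hε] with x hx
        rwa [Metric.mem_ball, Real.dist_eq] at hx
      have := hne τ hτ
      obtain ⟨x, ⟨h1, h2⟩, h3⟩ := hev.exists
      exact ⟨g x, fun _ => hev.mono fun y hy => hE y hy.1.1 x h1 hy.1.2 h2 hy.2 h3⟩
    · exact ⟨g τ, fun h => absurd h hτ⟩
  choose G hG using hG
  -- The punctured limits `G` agree at neighbouring points: a punctured neighbourhood of `z` inside
  -- that of `τ` sees both values.
  have hconst : ∀ x ∈ I, ∀ y ∈ I, G x = G y := fun x hx y hy => by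
    refine hI.induction₂ (s := I) (fun x y => G x = G y) (fun τ hτ => ?_)
      (fun _ _ _ _ _ _ h1 h2 => h1.trans h2) (fun _ _ _ _ h1 => h1.symm) hx hy
    have h1 := eventually_nhdsWithin_iff.1 (eventually_eventually_nhdsWithin.2 (hG τ hτ))
    rw [eventually_nhdsWithin_iff]
    filter_upwards [h1] with z hz hzI
    by_cases hzτ : z = τ
    · rw [hzτ]
    · have h2 : ∀ᶠ x in 𝓝[I \ {z}] z, g x = G τ := by
        have h3 := eventually_nhdsWithin_iff.1 (hz ⟨hzI, hzτ⟩)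
        rw [eventually_nhdsWithin_iff]
        filter_upwards [h3, isOpen_ne.mem_nhds hzτ] with x hx hx' hxI
        exact hx ⟨hxI.1, hx'⟩
      have := hne z hzI
      obtain ⟨x, h4, h5⟩ := (h2.and (hG z hzI)).exists
      rw [← h4, h5]
  obtain ⟨τ₀, hτ₀⟩ := hI'.nonempty
  refine ⟨G τ₀, fun τ hτ => ?_⟩
  rw [hconst τ₀ hτ₀ τ hτ]
  exact hG τ hτ

section Flow

variable {ν k : ℕ} {r : ℝ}

/-- Germs compose, and near every moment they exist in both directions of time between any two
non-collision times. So reachability of `x` from `s` by a germ does not depend on `x`, and it holds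
at `x = s`. -/
theorem IsNonsingularOrbit.flowGerm (hr : 0 < r) {a b : ℝ} {ω : Motion ν}
    (h : IsNonsingularOrbit ν k r a b ω) (hab : a < b) (ha : ¬ ω.IsCollisionTime k r a)
    (hb : ¬ ω.IsCollisionTime k r b) {s t : ℝ} (hs : s ∈ Set.Icc a b) (ht : t ∈ Set.Icc a b)
    (hsc : ¬ ω.IsCollisionTime k r s) (htc : ¬ ω.IsCollisionTime k r t) :
    FlowGerm ν k r (t - s) (ω.phase s) (ω.phase t) := by
  set K : ℝ → Prop := fun x => FlowGerm ν k r (x - s) (ω.phase s) (ω.phase x) with hK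
  have step : ∀ {x y : ℝ}, FlowGerm ν k r (y - x) (ω.phase x) (ω.phase y) → K x → K y :=
    fun {x y} hxy hx => by
      have := hx.trans hr hxy
      rwa [sub_add_sub_cancel'] at this
  have hI' : (Set.Icc a b).Nontrivial := ⟨a, ⟨le_rfl, hab.le⟩, b, ⟨hab.le, le_rfl⟩, hab.ne⟩
  obtain ⟨c, hc⟩ := exists_eventually_eq_of_locally (isPreconnected_Icc (a := a) (b := b))
    hI' K fun τ hτ => by
      by_cases hτc : ω.IsCollisionTime k r τ
      · obtain ⟨c, hτc'⟩ := hτc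
        have hτ' : τ ∈ Set.Ioo a b := by
          refine ⟨lt_of_le_of_ne hτ.1 ?_, lt_of_le_of_ne hτ.2 ?_⟩
          · rintro rfl; exact ha ⟨c, hτc'⟩
          · rintro rfl; exact hb ⟨c, hτc'⟩
        obtain ⟨ε, hε, -, h1, h2, h3⟩ := h.steps_near_collision hr hτ' hτc'
        have key : ∀ x y, x ≠ τ → y ≠ τ → |x - τ| < ε → |y - τ| < ε → K x → K y :=
          fun x y hx hy hx' hy' => by
            rw [abs_lt] at hx' hy'
            have hx1 : τ - ε < x := by linarith
            have hx2 : x < τ + ε := by linarith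
            have hy1 : τ - ε < y := by linarith
            have hy2 : y < τ + ε := by linarith
            rcases lt_or_gt_of_ne hx with hx | hx <;> rcases lt_or_gt_of_ne hy with hy | hy
            · exact step (h1 x ⟨hx1, hx⟩ y ⟨hy1, hy⟩).flowGerm
            · exact step (h3 x ⟨hx1, hx⟩ y ⟨hy, hy2⟩).1.flowGerm
            · exact step (h3 y ⟨hy1, hy⟩ x ⟨hx, hx2⟩).2
            · exact step (h2 x ⟨hx, hx2⟩ y ⟨hy, hy2⟩).flowGerm
        -- The continuation principle is applied to a proposition-valued function, so equality of
        -- values is an equivalence.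
        exact ⟨ε, hε, fun x _ y _ hx hy hx' hy' =>
          propext ⟨key x y hx hy hx' hy', key y x hy hx hy' hx'⟩⟩
      · obtain ⟨ε, hε, h1⟩ := h.freeStep_near hr hτ hτc
        exact ⟨ε, hε, fun x hx y hy _ _ hx' hy' => propext
          ⟨step (h1 x hx y hy hx' hy').2.flowGerm, step (h1 y hy x hx hy' hx').2.flowGerm⟩⟩
  have hnear : ∀ {τ}, τ ∈ Set.Icc a b → ¬ ω.IsCollisionTime k r τ → (K τ ↔ c) := fun {τ} hτ hτc => by
    obtain ⟨ε, hε, h1⟩ := h.freeStep_near hr hτ hτc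
    have : (𝓝[Set.Icc a b \ {τ}] τ).NeBot := by
      have := isPreconnected_Icc.preperfect_of_nontrivial hI' τ hτ
      rwa [accPt_principal_iff_nhdsWithin] at this
    obtain ⟨x, h2, h3, h4⟩ := ((hc τ hτ).and (eventually_mem_nhdsWithin.and
      (nhdsWithin_le_nhds (Metric.ball_mem_nhds τ hε)))).exists
    have h4 : |x - τ| < ε := h4
    have h5 : |τ - τ| < ε := by simpa using hε
    rw [← h2]
    exact ⟨step (h1 τ hτ x h3.1 h5 h4).2.flowGerm, step (h1 x h3.1 τ hτ h4 h5).2.flowGerm⟩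
  have h0 : K s := by
    simp only [hK, sub_self]
    exact flowGerm_zero hr (h.isFree_of_not_collisionTime hr hs hsc)
  exact (hnear ht htc).2 ((hnear hs hsc).1 h0)

theorem FlowsTo.flowGerm (hr : 0 < r) {t : ℝ} {x y : State ν} (h : FlowsTo ν k r t x y)
    (hx : IsFree k r x.1) (hy : IsFree k r y.1) : FlowGerm ν k r t x y := by
  obtain ⟨ω, h1, rfl, rfl⟩ := h
  have h0 : ¬ ω.IsCollisionTime k r 0 := fun ⟨c, hc⟩ => hx.not_touches c hc
  have ht : ¬ ω.IsCollisionTime k r t := fun ⟨c, hc⟩ => hy.not_touches c hc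
  rcases lt_trichotomy t 0 with h | rfl | h
  · have := h1.flowGerm hr (by simpa using h.ne) (by rwa [min_eq_right h.le])
      (by rwa [max_eq_left h.le]) (zero_mem_Icc_min_max t) (self_mem_Icc_min_max t) h0 ht
    rwa [sub_zero] at this
  · exact flowGerm_zero hr hx
  · have := h1.flowGerm hr (by simpa using h.ne') (by rwa [min_eq_left h.le])
      (by rwa [max_eq_right h.le]) (zero_mem_Icc_min_max t) (self_mem_Icc_min_max t) h0 ht
    rwa [sub_zero] at this

/-- `γ` is a curve in the phase space through `x` with the tangent vector `w`. -/
structure IsCurve (k : ℕ) (r : ℝ) (γ : ℝ → State ν) (x w : State ν) : Prop where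
  zero : γ 0 = x
  hasDerivAt : HasDerivAt γ w 0
  eventually_mem : ∀ᶠ h in 𝓝 (0 : ℝ), γ h ∈ phaseSpace ν k r

namespace IsCurve

variable {γ : ℝ → State ν} {x y w : State ν}

theorem mem (h : IsCurve k r γ x w) : x ∈ phaseSpace ν k r :=
  h.zero ▸ h.eventually_mem.self_of_nhds

theorem tendsto (h : IsCurve k r γ x w) :
    Filter.Tendsto γ (𝓝 0) (𝓝[phaseSpace ν k r] x) :=
  tendsto_nhdsWithin_iff.2 ⟨h.zero ▸ h.hasDerivAt.continuousAt, h.eventually_mem⟩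

theorem fst_apply (h : IsCurve k r γ x w) (β : Fin 2) :
    HasDerivAt (fun s => (γ s).1 β) (w.1 β) 0 :=
  hasDerivAt_pi.1 h.hasDerivAt.fst β

theorem snd_apply (h : IsCurve k r γ x w) (β : Fin 2) :
    HasDerivAt (fun s => (γ s).2 β) (w.2 β) 0 :=
  hasDerivAt_pi.1 h.hasDerivAt.snd β

theorem fst (h : IsCurve k r γ x w) : HasDerivAt (fun s => (γ s).1) w.1 0 :=
  hasDerivAt_pi.2 h.fst_apply

theorem snd (h : IsCurve k r γ x w) : HasDerivAt (fun s => (γ s).2) w.2 0 :=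
  hasDerivAt_pi.2 h.snd_apply

theorem coord {f : ℝ → Vec ν} {f' : Vec ν} {s : ℝ} (h : HasDerivAt f f' s) (j : Fin ν) :
    HasDerivAt (fun s => f s j) (f' j) s :=
  (EuclideanSpace.proj (𝕜 := ℝ) j : Vec ν →L[ℝ] ℝ).hasFDerivAt.comp_hasDerivAt s h

theorem mem_tangentSpace (h : IsCurve k r γ x w) : w ∈ tangentSpace ν k x := by
  have hcongr : ∀ {f : ℝ → ℝ} {f' c : ℝ}, HasDerivAt f f' 0 → (∀ᶠ s in 𝓝 0, f s = c) → f' = 0 :=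
    fun hf hc => hf.unique ((hasDerivAt_const (0 : ℝ) _).congr_of_eventuallyEq hc)
  refine ⟨fun j hj => ?_, fun j hj => ?_, ?_⟩
  · exact hcongr ((coord (h.fst_apply 0) j).add (coord (h.fst_apply 1) j))
      (h.eventually_mem.mono fun s hs => hs.1.2.1 j hj)
  · exact hcongr ((coord (h.snd_apply 0) j).add (coord (h.snd_apply 1) j))
      (h.eventually_mem.mono fun s hs => hs.2.1 j hj)
  · have := hcongr ((h.snd_apply 0).norm_sq.add (h.snd_apply 1).norm_sq)
      (h.eventually_mem.mono fun s hs => hs.2.2)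
    rw [h.zero] at this
    linarith

/-- The flow transports curves, and its derivative transports their tangent vectors. -/
theorem flow (hr : 0 < r) (h : IsCurve k r γ x w) {t : ℝ} (hg : FlowGerm ν k r t x y) :
    IsCurve k r (fun s => flow ν k r t (γ s)) y (flowDeriv ν k r t x w) := by
  obtain ⟨Φ, h1, h2, h3⟩ := hg
  -- The flow agrees with a smooth map on the phase space near `x`, hence is differentiable within
  -- it. The chosen derivative is pinned down only on velocities of curves in the phase space.
  have heq : ∀ᶠ z in 𝓝[phaseSpace ν k r] x, TwoBalls.flow ν k r t z = Φ z :=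
    h3.mono fun z hz => hz.flow_eq hr
  have hx := heq.self_of_nhdsWithin h.mem
  have hd : DifferentiableWithinAt ℝ (TwoBalls.flow ν k r t) (phaseSpace ν k r) x :=
    ((h1.differentiableAt (by simp)).differentiableWithinAt).congr_of_eventuallyEq heq hx
  refine ⟨by rw [h.zero, hx, h2], ?_, ?_⟩
  · have hd' := hd.hasFDerivWithinAt
    have h0 := h.zero
    subst h0
    exact hd'.comp_hasDerivAt (0 : ℝ) h.hasDerivAt h.eventually_mem
  · filter_upwards [h.tendsto.eventually h3] with s hs
    rw [hs.flow_eq hr]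
    exact hs.mem_right

theorem unique {γ' : ℝ → State ν} {w' : State ν} (h : IsCurve k r γ x w)
    (h' : HasDerivAt γ' w' 0) (he : ∀ᶠ s in 𝓝 (0 : ℝ), γ s = γ' s) : w = w' :=
  (h.hasDerivAt.congr_of_eventuallyEq (he.mono fun _ hs => hs.symm)).unique h'

end IsCurve

/-- Move the position linearly and rescale the linearly moved velocity to unit energy. As `δv ⊥ v`,
the energy before rescaling is exactly `1 + s² C`, so the rescaling has zero derivative at `s = 0`.
-/
theorem exists_isCurve (hr : 0 < r) {x w : State ν} (hx : x ∈ phaseSpace ν k r)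
    (hf : IsFree k r x.1) (hw : w ∈ tangentSpace ν k x) : ∃ γ, IsCurve k r γ x w := by
  set C : ℝ := ‖w.2 0‖ ^ 2 + ‖w.2 1‖ ^ 2 with hC
  have hC0 : 0 ≤ C := by positivity
  have hpos : ∀ s : ℝ, 0 < 1 + s ^ 2 * C := fun s => by positivity
  have hroot : HasDerivAt (fun s : ℝ => (√(1 + s ^ 2 * C))⁻¹) 0 0 := by
    have h1 : HasDerivAt (fun s : ℝ => 1 + s ^ 2 * C) 0 0 := by
      simpa using (((hasDerivAt_id (0 : ℝ)).pow 2).mul_const C).const_add 1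
    simpa using (h1.sqrt (hpos 0).ne').fun_inv (Real.sqrt_ne_zero'.2 (hpos 0))
  refine ⟨fun s => (x.1 + s • w.1, (√(1 + s ^ 2 * C))⁻¹ • (x.2 + s • w.2)), by simp, ?_, ?_⟩
  · have h1 : HasDerivAt (fun s : ℝ => x.1 + s • w.1) w.1 0 := by
      simpa using ((hasDerivAt_id (0 : ℝ)).smul_const w.1).const_add x.1
    have h2 : HasDerivAt (fun s : ℝ => x.2 + s • w.2) w.2 0 := by
      simpa using ((hasDerivAt_id (0 : ℝ)).smul_const w.2).const_add x.2
    have h3 := hroot.smul h2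
    simp only [zero_smul, add_zero, ne_eq, OfNat.ofNat_ne_zero, not_false_eq_true, zero_pow,
      zero_mul, Real.sqrt_one, inv_one, one_smul] at h3
    exact h1.prodMk h3
  · have hcont : ContinuousAt (fun s : ℝ => x.1 + s • w.1) 0 := by fun_prop
    have hfree : IsFree k r (x.1 + (0 : ℝ) • w.1) := by simpa using hf
    filter_upwards [hcont.eventually (hfree.eventually hr)] with s hs
    refine ⟨hs.mem_configSpace hr (Submodule.add_mem _ hx.1.2.1 (Submodule.smul_mem _ _ hw.1)),
      Submodule.smul_mem _ _ (Submodule.add_mem _ hx.2.1 (Submodule.smul_mem _ _ hw.2.1)), ?_⟩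
    have h1 : ∀ β : Fin 2, ‖((√(1 + s ^ 2 * C))⁻¹ • (x.2 + s • w.2)) β‖ ^ 2 =
        (1 + s ^ 2 * C)⁻¹ * (‖x.2 β‖ ^ 2 + 2 * s * inner ℝ (x.2 β) (w.2 β) + s ^ 2 * ‖w.2 β‖ ^ 2) := by
      intro β
      simp only [Pi.smul_apply, Pi.add_apply]
      rw [norm_smul, mul_pow, Real.norm_eq_abs, sq_abs, inv_pow, Real.sq_sqrt (hpos s).le,
        norm_add_sq_real, inner_smul_right, norm_smul, mul_pow, Real.norm_eq_abs, sq_abs]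
      ring
    have h2 := hx.2.2
    have h3 := hw.2.2
    simp only [h1]
    rw [← mul_add, inv_mul_eq_one₀ (hpos s).ne', hC]
    linear_combination -h2 - 2 * s * h3

/-- Both sides are the velocity of the image of one curve tangent to `w`. The restriction to tangent
vectors is essential, since `fderivWithin` is not determined elsewhere. -/
theorem flowDeriv_add (hr : 0 < r) {s t : ℝ} {x y z w : State ν} (hx : x ∈ phaseSpace ν k r)
    (hf : IsFree k r x.1) (hw : w ∈ tangentSpace ν k x) (h : FlowGerm ν k r s x y)
    (h' : FlowGerm ν k r t y z) :
    flowDeriv ν k r (s + t) x w = flowDeriv ν k r t y (flowDeriv ν k r s x w) := by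
  obtain ⟨γ, hγ⟩ := exists_isCurve hr hx hf hw
  refine (hγ.flow hr (h.trans hr h')).unique ((hγ.flow hr h).flow hr h').hasDerivAt ?_
  have hg := h.trans hr h'
  obtain ⟨Φ, h1, h2, h3⟩ := h
  obtain ⟨Ψ, h1', h2', h3'⟩ := h'
  subst h2
  filter_upwards [hγ.tendsto.eventually h3,
    ((tendsto_nhdsWithin_phaseSpace h1.continuousAt h3).comp hγ.tendsto).eventually h3'] with u h4 h5
  simp only [Function.comp] at h5
  rw [(h4.trans hr h5).flow_eq hr, h4.flow_eq hr, h5.flow_eq hr]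

theorem flowDeriv_zero (hr : 0 < r) {x w : State ν} (hx : x ∈ phaseSpace ν k r)
    (hf : IsFree k r x.1) (hw : w ∈ tangentSpace ν k x) : flowDeriv ν k r 0 x w = w := by
  obtain ⟨γ, hγ⟩ := exists_isCurve hr hx hf hw
  have h4 : ∀ᶠ z in 𝓝[phaseSpace ν k r] x, FlowsTo ν k r 0 z (freeFlight 0 z) :=
    eventually_flowsTo_freeFlight hr fun s hs => by
      have : s = 0 := by simpa using hs
      simpa [this] using hf
  refine (hγ.flow hr (flowGerm_zero hr hf)).unique hγ.hasDerivAt ?_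
  filter_upwards [hγ.tendsto.eventually h4] with s hs
  rw [hs.flow_eq hr]
  simp [freeFlight]

theorem eventually_flowsTo_freeFlight_time (hr : 0 < r) {x : State ν} (hx : x ∈ phaseSpace ν k r)
    (hf : IsFree k r x.1) : ∀ᶠ s in 𝓝 (0 : ℝ), FlowsTo ν k r s x (freeFlight s x) := by
  have hcont : ContinuousAt (fun s : ℝ => x.1 + s • x.2) 0 := by fun_prop
  have hfree : IsFree k r (x.1 + (0 : ℝ) • x.2) := by simpa using hf
  obtain ⟨ε, hε, hE⟩ := Metric.eventually_nhds_iff.1 (hcont.eventually (hfree.eventually hr))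
  filter_upwards [Metric.ball_mem_nhds (0 : ℝ) hε] with s hs
  refine flowsTo_freeFlight hr hx fun u hu => hE ?_
  rw [Metric.mem_ball, Real.dist_eq, sub_zero, abs_lt] at hs
  rw [Real.dist_eq, sub_zero, abs_lt]
  exact ⟨(lt_min (neg_neg_of_pos hε) hs.1).trans_le hu.1, hu.2.trans_lt (max_lt hε hs.2)⟩

theorem isCurve_freeFlight (hr : 0 < r) {x : State ν} (hx : x ∈ phaseSpace ν k r)
    (hf : IsFree k r x.1) : IsCurve k r (fun s => freeFlight s x) x (x.2, 0) := by
  refine ⟨by simp [freeFlight], ?_, ?_⟩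
  · have h1 : HasDerivAt (fun s : ℝ => x.1 + s • x.2) x.2 0 := by
      simpa using ((hasDerivAt_id (0 : ℝ)).smul_const x.2).const_add x.1
    exact h1.prodMk (hasDerivAt_const _ _)
  · filter_upwards [eventually_flowsTo_freeFlight_time hr hx hf] with s hs using hs.mem_right

/-- The derivative of the flow preserves the flow direction. -/
theorem flowDeriv_velocity (hr : 0 < r) {t : ℝ} {x y : State ν} (h : FlowsTo ν k r t x y)
    (hx : IsFree k r x.1) (hy : IsFree k r y.1) :
    flowDeriv ν k r t x (x.2, 0) = (y.2, 0) := by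
  refine ((isCurve_freeFlight hr h.mem_left hx).flow hr (h.flowGerm hr hx hy)).unique
    (isCurve_freeFlight hr h.mem_right hy).hasDerivAt ?_
  filter_upwards [eventually_flowsTo_freeFlight_time hr h.mem_left hx,
    eventually_flowsTo_freeFlight_time hr h.mem_right hy] with s h1 h2
  -- Flowing back by `s`, then by `t`, then forward by `s` is flowing by `t`, so the flow carries
  -- the orbit curve through `x` to the one through `y`.
  have := (h1.symm.trans hr h).trans hr h2
  rw [show -s + t + s = t by ring] at this
  exact this.flow_eq hr

theorem velocity_mem_tangentSpace (hr : 0 < r) {x : State ν} (hx : x ∈ phaseSpace ν k r)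
    (hf : IsFree k r x.1) : ((x.2, 0) : State ν) ∈ tangentSpace ν k x :=
  (isCurve_freeFlight hr hx hf).mem_tangentSpace

end Flow

/-! ### Neutral vectors under the derivative of a single step -/

section Tangent

variable {ν k : ℕ} {r : ℝ}

theorem FreeStep.flowDeriv_eq (hr : 0 < r) {t : ℝ} {x y w : State ν} (h : FreeStep ν k r t x y)
    (hx : x ∈ phaseSpace ν k r) (hf : IsFree k r x.1) (hw : w ∈ tangentSpace ν k x) :
    flowDeriv ν k r t x w = freeFlight t w := by
  obtain ⟨γ, hγ⟩ := exists_isCurve hr hx hf hw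
  have hd : HasDerivAt (fun s => freeFlight t (γ s)) (freeFlight t w) 0 :=
    HasDerivAt.prodMk (hγ.fst.add (hγ.snd.const_smul t)) hγ.snd
  refine (hγ.flow hr h.flowGerm).unique hd ?_
  filter_upwards [hγ.tendsto.eventually h.2] with s hs using hs.flow_eq hr

/-- Provides what both kinds of collision use: a curve tangent to `w`, a differentiable impact time
along it, and the contact equation holding identically on it. -/
theorem BounceStep.exists_curve (hr : 0 < r) {c : Collision ν} {t : ℝ} {x y w : State ν}
    (h : BounceStep ν k r c t x y)
    (hx : x ∈ phaseSpace ν k r) (hf : IsFree k r x.1) (hw : w ∈ tangentSpace ν k x) :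
    ∃ γ : ℝ → State ν, IsCurve k r γ x w ∧ ∃ T' : ℝ,
      HasDerivAt (fun s => hitTime r c (γ s)) T' 0 ∧
      HasDerivAt (fun s => bounce r c t (γ s)) (flowDeriv ν k r t x w) 0 ∧
      ∀ᶠ s in 𝓝 (0 : ℝ), gap r ((γ s).1 + hitTime r c (γ s) • (γ s).2) c = 0 := by
  obtain ⟨γ, hγ⟩ := exists_isCurve hr hx hf hw
  have h0 := hγ.zero
  refine ⟨γ, hγ, fderiv ℝ (hitTime r c) x w, ?_, ?_, ?_⟩
  · have h1 := (h.contDiffAt_hitTime.differentiableAt (by simp)).hasFDerivAt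
    subst h0
    exact h1.comp_hasDerivAt (0 : ℝ) hγ.hasDerivAt
  · refine (hγ.flow hr h.flowGerm).hasDerivAt.congr_of_eventuallyEq ?_
    filter_upwards [hγ.tendsto.eventually h.flowsTo] with s hs using (hs.flow_eq hr).symm
  · exact (hγ.tendsto.mono_right nhdsWithin_le_nhds).eventually h.gap_hit

/-- The derivative of the flow through a wall collision, on vectors without velocity part. -/
theorem BounceStep.flowDeriv_wall (hr : 0 < r) {β : Fin 2} {j : Fin ν} {top : Bool} {t : ℝ}
    {x y w : State ν} (h : BounceStep ν k r (.wall β j top) t x y)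
    (hx : x ∈ phaseSpace ν k r) (hf : IsFree k r x.1) (hw : w ∈ tangentSpace ν k x)
    (hw0 : w.2 = 0) (β' : Fin 2) (i : Fin ν) :
    (flowDeriv ν k r t x w).1 β' i = if β' = β ∧ i = j then -w.1 β' i else w.1 β' i := by
  obtain ⟨γ, hγ, T', hT, hb, hg⟩ := h.exists_curve hr hx hf hw
  have hz := hγ.zero
  have hb' := IsCurve.coord (hasDerivAt_pi.1 hb.fst β') i
  have d1 := IsCurve.coord (hγ.fst_apply β') i
  have d2 := IsCurve.coord (hγ.snd_apply β') i
  simp only [hw0, Pi.zero_apply, PiLp.zero_apply] at d2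
  have hexp : ∀ s, (bounce r (.wall β j top) t (γ s)).1 β' i =
      (γ s).1 β' i + hitTime r (.wall β j top) (γ s) * (γ s).2 β' i +
      (t - hitTime r (.wall β j top) (γ s)) *
        (if β' = β ∧ i = j then -(γ s).2 β' i else (γ s).2 β' i) := fun s => by
    simp only [bounce, Pi.add_apply, PiLp.add_apply, Pi.smul_apply, PiLp.smul_apply, smul_eq_mul,
      reflect_wall_apply]
  simp only [hexp] at hb'
  split_ifs at hb' ⊢ with hc
  · obtain ⟨rfl, rfl⟩ := hc
    -- At impact the coordinate equals the wall position, so `δq + T' v = 0` there. After the impact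
    -- it varies by `T' v`, which is therefore `-δq`.
    have e1 : ∀ᶠ s in 𝓝 (0 : ℝ), (γ s).1 β' i + hitTime r (.wall β' i top) (γ s) * (γ s).2 β' i =
        if top then 1 else 0 := hg.mono fun s hs => by
      cases top
      · simpa [gap] using hs
      · simp only [gap, if_true, Pi.add_apply, PiLp.add_apply, Pi.smul_apply, PiLp.smul_apply,
          smul_eq_mul] at hs ⊢
        linarith
    have d3 := d1.add (hT.mul d2)
    have d4 := d3.unique ((hasDerivAt_const (0 : ℝ) _).congr_of_eventuallyEq e1)
    have d5 := d3.add ((hT.const_sub t).mul d2.neg)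
    have d6 := hb'.unique d5
    simp only [mul_zero, add_zero, neg_zero, hz] at d4 d6
    rw [d6]
    simp only [Pi.neg_apply, hz]
    linarith
  · have d3 := d1.add (d2.const_mul t)
    have e : ∀ s, (γ s).1 β' i + hitTime r (.wall β j top) (γ s) * (γ s).2 β' i +
        (t - hitTime r (.wall β j top) (γ s)) * (γ s).2 β' i = (γ s).1 β' i + t * (γ s).2 β' i :=
      fun s => by ring
    simp only [e] at hb'
    have := hb'.unique d3
    simpa using this

/-- The derivative of the flow through a ball-to-ball collision, on vectors whose velocity part
vanishes before and after. -/
theorem BounceStep.flowDeriv_ball (hr : 0 < r) {m : Fin ν → ℤ} {t : ℝ}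
    {x y w : State ν} (h : BounceStep ν k r (.ball m) t x y)
    (hx : x ∈ phaseSpace ν k r) (hf : IsFree k r x.1) (hw : w ∈ tangentSpace ν k x)
    (hw0 : w.2 = 0) (hw' : (flowDeriv ν k r t x w).2 = 0) :
    (∃ α : ℝ, w.1 0 - w.1 1 = α • (x.2 0 - x.2 1) ∧
      (flowDeriv ν k r t x w).1 0 - (flowDeriv ν k r t x w).1 1 = α • (y.2 0 - y.2 1)) ∧
    (flowDeriv ν k r t x w).1 0 + (flowDeriv ν k r t x w).1 1 = w.1 0 + w.1 1 := by
  obtain ⟨γ, hγ, T', hT, hb, hg⟩ := h.exists_curve hr hx hf hw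
  have hz := hγ.zero
  set w' := flowDeriv ν k r t x w with hw'def
  set T : ℝ → ℝ := fun s => hitTime r (.ball m) (γ s) with hTdef
  set V : ℝ → Vec ν := fun s => (γ s).2 0 - (γ s).2 1 with hV
  -- `u` is the vector between the centres at impact, whose length is always `2 * r`.
  set u : ℝ → Vec ν := fun s => (γ s).1 0 - (γ s).1 1 + T s • V s + intVec m with hu
  have dV : HasDerivAt V 0 0 := by
    have := (hγ.snd_apply 0).sub (hγ.snd_apply 1)
    simp only [hw0, Pi.zero_apply, sub_zero] at this
    exact this
  have du : HasDerivAt u (w.1 0 - w.1 1 + T' • V 0) 0 := by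
    have := (((hγ.fst_apply 0).sub (hγ.fst_apply 1)).add (hT.smul dV)).add_const (intVec m)
    simp only [smul_zero, zero_add] at this
    exact this
  set u' := w.1 0 - w.1 1 + T' • V 0 with hu'
  have hueq : ∀ s, ((γ s).1 + hitTime r (.ball m) (γ s) • (γ s).2) 0 -
      ((γ s).1 + hitTime r (.ball m) (γ s) • (γ s).2) 1 + intVec m = u s := fun s => by
    simp only [hu, hV, hTdef, Pi.add_apply, Pi.smul_apply, smul_sub]
    abel
  have hnorm : ∀ᶠ s in 𝓝 (0 : ℝ), ‖u s‖ ^ 2 = (2 * r) ^ 2 := hg.mono fun s hs => by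
    simp only [gap, hueq] at hs
    linarith
  have hr2 : (2 * r) ^ 2 ≠ 0 := by positivity
  -- the relative velocity after the collision
  have hVp : ∀ᶠ s in 𝓝 (0 : ℝ), (bounce r (.ball m) t (γ s)).2 0 - (bounce r (.ball m) t (γ s)).2 1
      = V s - (2 * (inner ℝ (V s) (u s) / (2 * r) ^ 2)) • u s := hnorm.mono fun s hs => by
    simp only [bounce]
    rw [reflect_ball_sub, hueq, hs]
  have dVp := (hasDerivAt_pi.1 hb.snd 0).sub (hasDerivAt_pi.1 hb.snd 1)
  simp only [hw', Pi.zero_apply, sub_zero] at dVp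
  have dVp' := dV.sub (((((dV.inner ℝ du).div_const ((2 * r) ^ 2)).const_mul 2)).smul du)
  have key := (dVp.congr_of_eventuallyEq (hVp.mono fun s hs => hs.symm)).unique dVp'
  have horth : inner ℝ (u 0) u' = 0 := by
    have := du.norm_sq.unique ((hasDerivAt_const (0 : ℝ) _).congr_of_eventuallyEq hnorm)
    linarith
  have hVu : inner ℝ (V 0) (u 0) ≠ 0 := by
    have := h.gapSpeed_neg.ne
    rw [← hz] at this
    simp only [gapSpeed, hueq] at this
    exact this
  -- The outgoing relative velocity is `V - 2 c u` with `c = ⟪V, u⟫ / (2r)²`. Neither it nor `V`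
  -- varies, so `c u' + c' u = 0`. Pairing with `u' ⊥ u` leaves `c ‖u'‖² = 0`, and `c ≠ 0` because
  -- the collision is not tangential.
  have hu0 : u' = 0 := by
    have := congrArg (fun z : Vec ν => inner ℝ z u') key
    simp only [inner_zero_left, zero_sub, inner_neg_left, inner_add_left, inner_smul_left,
      RCLike.conj_to_real, horth, mul_zero, add_zero, real_inner_self_eq_norm_sq] at this
    have h2 : 2 * (inner ℝ (V 0) (u 0) / (2 * r) ^ 2) ≠ 0 :=
      mul_ne_zero two_ne_zero (div_ne_zero hVu hr2)
    have h3 : ‖u'‖ ^ 2 = 0 := (mul_eq_zero.1 (neg_eq_zero.1 this.symm)).resolve_left h2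
    simpa using h3
  have hV0 : V 0 = x.2 0 - x.2 1 := by simp only [hV, hz]
  -- positions after the collision
  have hby : bounce r (.ball m) t (γ 0) = y := by rw [hz, h.bounce_eq]
  have dR : ∀ β, HasDerivAt (fun s => (bounce r (.ball m) t (γ s)).2 β) 0 0 := fun β => by
    have := hasDerivAt_pi.1 hb.snd β
    rwa [hw'] at this
  have dQ : ∀ β, HasDerivAt (fun s => (bounce r (.ball m) t (γ s)).1 β)
      (w.1 β + T' • x.2 β + (-T') • y.2 β) 0 := fun β => by
    have h1 := ((hγ.fst_apply β).add (hT.smul (hγ.snd_apply β))).add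
      ((hT.const_sub t).smul (dR β))
    simp only [hw0, Pi.zero_apply, smul_zero, zero_add, hz, h.bounce_eq] at h1
    exact h1
  have hfst : ∀ β, w'.1 β = w.1 β + T' • x.2 β + (-T') • y.2 β := fun β =>
    (hasDerivAt_pi.1 hb.fst β).unique (dQ β)
  have hsum : y.2 0 + y.2 1 = x.2 0 + x.2 1 := by
    rw [← h.bounce_eq]
    exact reflect_ball_add _ _ _
  -- The advance is minus the variation of the impact time: `u' = 0` reads `δq_0 - δq_1 = -T' V`.
  refine ⟨⟨-T', ?_, ?_⟩, ?_⟩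
  · rw [hV0] at hu'
    rw [hu0] at hu'
    rw [neg_smul]
    exact eq_neg_of_add_eq_zero_left hu'.symm
  · rw [hfst, hfst]
    have h1 : w.1 0 + T' • x.2 0 + (-T') • y.2 0 - (w.1 1 + T' • x.2 1 + (-T') • y.2 1) =
        (w.1 0 - w.1 1 + T' • (x.2 0 - x.2 1)) + (-T') • (y.2 0 - y.2 1) := by
      rw [smul_sub, smul_sub]; abel
    rw [h1, ← hV0, ← hu', hu0, zero_add]
  · rw [hfst, hfst]
    have h1 : w.1 0 + T' • x.2 0 + (-T') • y.2 0 + (w.1 1 + T' • x.2 1 + (-T') • y.2 1) =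
        w.1 0 + w.1 1 + (T' • (x.2 0 + x.2 1) - T' • (y.2 0 + y.2 1)) := by
      rw [smul_add, smul_add, neg_smul, neg_smul]; abel
    rw [h1, hsum, sub_self, add_zero]

end Tangent

/-! ### Counting sign changes, and the linear algebra of neutral vectors -/

/-- A function that changes its sign at the points of `H` and is locally constant elsewhere. -/
theorem eventually_eq_neg_one_pow {s t : ℝ} (hst : s < t) {H : Set ℝ}
    (hH : (H ∩ Set.Ioo s t).Finite) (f : ℝ → ℝ) {c₁ c₂ : ℝ}
    (h : ∀ τ ∈ Set.Ioo s t, ∃ ε > 0,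
      (∀ x ∈ Set.Ioo (τ - ε) τ, ∀ y ∈ Set.Ioo (τ - ε) τ, f x = f y) ∧
      (∀ x ∈ Set.Ioo τ (τ + ε), ∀ y ∈ Set.Ioo τ (τ + ε), f x = f y) ∧
      (∀ x ∈ Set.Ioo (τ - ε) τ, ∀ y ∈ Set.Ioo τ (τ + ε), (τ ∈ H → f y = -f x) ∧
        (τ ∉ H → f y = f x)))
    (h₁ : ∀ᶠ x in 𝓝[>] s, f x = c₁) (h₂ : ∀ᶠ x in 𝓝[<] t, f x = c₂) :
    c₂ = (-1) ^ (H ∩ Set.Ioo s t).ncard * c₁ := by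
  -- Multiplying by the parity of the sign changes so far cancels every jump, so `g` is locally
  -- constant.
  set g : ℝ → ℝ := fun x => (-1) ^ (H ∩ Set.Ioo s x).ncard * f x with hg
  have hnear : ∀ τ ∈ Set.Icc s t, ∃ ε > 0, ∀ x, |x - τ| < ε → x ≠ τ → x ∉ H ∩ Set.Ioo s t := by
    intro τ hτ
    have h1 : ((H ∩ Set.Ioo s t) \ {τ})ᶜ ∈ 𝓝 τ :=
      (hH.subset Set.sdiff_subset).isClosed.isOpen_compl.mem_nhds (by simp)
    obtain ⟨ε, hε, hE⟩ := Metric.mem_nhds_iff.1 h1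
    refine ⟨ε, hε, fun x hx hne hxH => ?_⟩
    exact hE (show x ∈ Metric.ball τ ε by rwa [Metric.mem_ball, Real.dist_eq]) ⟨hxH, hne⟩
  -- the number of sign changes near a point
  have hleft : ∀ τ ∈ Set.Icc s t, ∃ ε > 0, ∀ x ∈ Set.Ioo (τ - ε) τ, x < t →
      H ∩ Set.Ioo s x = H ∩ Set.Ioo s τ := by
    intro τ hτ
    obtain ⟨ε, hε, hE⟩ := hnear τ hτ
    refine ⟨ε, hε, fun x hx hxt => ?_⟩
    ext z
    simp only [Set.mem_inter_iff, Set.mem_Ioo]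
    refine ⟨fun ⟨a1, a2, a3⟩ => ⟨a1, a2, a3.trans hx.2⟩, fun ⟨a1, a2, a3⟩ => ⟨a1, a2, ?_⟩⟩
    by_contra hcon
    refine hE z ?_ a3.ne ⟨a1, a2, a3.trans_le hτ.2⟩
    rw [abs_lt]
    constructor <;> linarith [hx.1, not_lt.1 hcon]
  have hright : ∀ τ ∈ Set.Ico s t, ∃ ε > 0, ∀ x ∈ Set.Ioo τ (τ + ε), x < t →
      H ∩ Set.Ioo s x = H ∩ Set.Ioc s τ := by
    intro τ hτ
    obtain ⟨ε, hε, hE⟩ := hnear τ ⟨hτ.1, hτ.2.le⟩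
    refine ⟨ε, hε, fun x hx hxt => ?_⟩
    ext z
    simp only [Set.mem_inter_iff, Set.mem_Ioo, Set.mem_Ioc]
    refine ⟨fun ⟨a1, a2, a3⟩ => ⟨a1, a2, ?_⟩, fun ⟨a1, a2, a3⟩ => ⟨a1, a2, a3.trans_lt hx.1⟩⟩
    by_contra hcon
    refine hE z ?_ (not_le.1 hcon).ne' ⟨a1, a2, a3.trans hxt⟩
    rw [abs_lt]
    constructor <;> linarith [hx.2, not_le.1 hcon]
  have hI : (Set.Ioo s t).Nontrivial := by
    refine ⟨(2 * s + t) / 3, ⟨by linarith, by linarith⟩, (s + 2 * t) / 3, ⟨by linarith, by linarith⟩,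
      fun h => by linarith⟩
  -- Crossing `τ ∈ H` adds one point to the count just as `f` changes sign; crossing `τ ∉ H` changes
  -- neither.
  obtain ⟨c, hc⟩ := exists_eventually_eq_of_locally isPreconnected_Ioo hI g fun τ hτ => by
    obtain ⟨ε₁, hε₁, f1, f2, f3⟩ := h τ hτ
    obtain ⟨ε₂, hε₂, f4⟩ := hleft τ ⟨hτ.1.le, hτ.2.le⟩
    obtain ⟨ε₃, hε₃, f5⟩ := hright τ ⟨hτ.1.le, hτ.2⟩
    have hcross : ∀ x ∈ Set.Ioo s t, ∀ y ∈ Set.Ioo s t, x < τ → τ < y →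
        |x - τ| < min ε₁ (min ε₂ ε₃) → |y - τ| < min ε₁ (min ε₂ ε₃) → g x = g y := by
      intro x hx y hy hxτ hyτ hx' hy'
      simp only [lt_min_iff, abs_lt] at hx' hy'
      obtain ⟨f6, f7⟩ := f3 x ⟨by linarith, hxτ⟩ y ⟨hyτ, by linarith⟩
      simp only [hg]
      rw [f4 x ⟨by linarith, hxτ⟩ hx.2, f5 y ⟨hyτ, by linarith⟩ hy.2]
      by_cases hτH : τ ∈ H
      · have : H ∩ Set.Ioc s τ = insert τ (H ∩ Set.Ioo s τ) := by
          rw [← Set.Ioo_insert_right hτ.1, Set.inter_insert_of_mem hτH]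
        rw [this, Set.ncard_insert_of_notMem (by simp) (hH.subset (Set.inter_subset_inter_right _
          (Set.Ioo_subset_Ioo_right hτ.2.le))), f6 hτH, pow_succ]
        ring
      · have : H ∩ Set.Ioc s τ = H ∩ Set.Ioo s τ := by
          rw [← Set.Ioo_insert_right hτ.1, Set.inter_insert_of_notMem hτH]
        rw [this, f7 hτH]
    refine ⟨min ε₁ (min ε₂ ε₃), by positivity, fun x hx y hy hxτ hyτ hx' hy' => ?_⟩
    have hx'' := hx'
    have hy'' := hy'
    simp only [lt_min_iff, abs_lt] at hx'' hy''
    rcases lt_or_gt_of_ne hxτ with hxτ | hxτ <;> rcases lt_or_gt_of_ne hyτ with hyτ | hyτ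
    · simp only [hg]
      rw [f4 x ⟨by linarith, hxτ⟩ hx.2, f4 y ⟨by linarith, hyτ⟩ hy.2,
        f1 x ⟨by linarith, hxτ⟩ y ⟨by linarith, hyτ⟩]
    · exact hcross x hx y hy hxτ hyτ hx' hy'
    · exact (hcross y hy x hx hyτ hxτ hy' hx').symm
    · simp only [hg]
      rw [f5 x ⟨hxτ, by linarith⟩ hx.2, f5 y ⟨hyτ, by linarith⟩ hy.2,
        f2 x ⟨hxτ, by linarith⟩ y ⟨hyτ, by linarith⟩]
  have hpt : ∀ u v : ℝ, s ≤ u → u < v → v ≤ t → ∃ x ∈ Set.Ioo u v, g x = c := by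
    intro u v hu huv hv
    have hτ : (u + v) / 2 ∈ Set.Ioo s t := ⟨by linarith, by linarith⟩
    have : (𝓝[Set.Ioo s t \ {(u + v) / 2}] ((u + v) / 2)).NeBot := by
      have := isPreconnected_Ioo.preperfect_of_nontrivial hI _ hτ
      rwa [accPt_principal_iff_nhdsWithin] at this
    obtain ⟨x, h3, h4⟩ := ((hc _ hτ).and (nhdsWithin_le_nhds
      (Ioo_mem_nhds (by linarith : u < (u + v) / 2) (by linarith : (u + v) / 2 < v)))).exists
    exact ⟨x, h4, h3⟩
  have hc₁ : c = c₁ := by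
    obtain ⟨u, hu, hu'⟩ := (mem_nhdsGT_iff_exists_Ioo_subset' hst).1 h₁
    obtain ⟨ε, hε, hE⟩ := hright s ⟨le_rfl, hst⟩
    have hu : s < u := hu
    obtain ⟨x, hx, hx'⟩ := hpt s (min t (min u (s + ε))) le_rfl (by simp [hst, hu, hε])
      (min_le_left _ _)
    simp only [Set.mem_Ioo, lt_min_iff] at hx
    have h3 : f x = c₁ := hu' ⟨hx.1, hx.2.2.1⟩
    rw [← hx', hg]
    simp only
    rw [hE x ⟨hx.1, hx.2.2.2⟩ hx.2.1, h3]
    simp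
  have hc₂ : c = (-1) ^ (H ∩ Set.Ioo s t).ncard * c₂ := by
    obtain ⟨u, hu, hu'⟩ := (mem_nhdsLT_iff_exists_Ioo_subset' hst).1 h₂
    obtain ⟨ε, hε, hE⟩ := hleft t ⟨hst.le, le_rfl⟩
    have hu : u < t := hu
    obtain ⟨x, hx, hx'⟩ := hpt (max s (max u (t - ε))) t (le_max_left _ _) (by simp [hst, hu, hε])
      le_rfl
    simp only [Set.mem_Ioo, max_lt_iff] at hx
    have h3 : f x = c₂ := hu' ⟨hx.1.2.1, hx.2⟩
    rw [← hx', hg]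
    simp only
    rw [hE x ⟨hx.1.2.2, hx.2⟩ hx.2, h3]
  rw [← hc₁, hc₂, ← mul_assoc, ← pow_add, ← two_mul, pow_mul]
  simp

/-- The linear algebra behind the key lemma: if the neutral vectors `D` are proportional to the
relative velocities `V` in each collision with advance `α`, the advance vanishes at one end of a
segment with a nontrivial flip set, and the flip sets exhaust the non-periodic axes, then `D`
vanishes. -/
theorem neutral_vector_eq_zero {n ν k : ℕ} {Z : Fin n → Set (Fin ν)}
    {Dm Dp : Fin (n + 1) → Fin 2 → Fin ν → ℝ} {Vm Vp : Fin (n + 1) → Fin ν → ℝ}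
    {α : Fin (n + 1) → ℝ} {ε : Fin n → Fin 2 → Fin ν → ℝ}
    (hVm : ∀ i j, Vm i j ≠ 0) (hVp : ∀ i j, Vp i j ≠ 0)
    (hDm : ∀ i j, Dm i 0 j - Dm i 1 j = α i * Vm i j)
    (hDp : ∀ i j, Dp i 0 j - Dp i 1 j = α i * Vp i j)
    (hsum : ∀ i j, Dp i 0 j + Dp i 1 j = Dm i 0 j + Dm i 1 j)
    (hε : ∀ i β j, Dm (Fin.succ i) β j = ε i β j * Dp (Fin.castSucc i) β j)
    (hε0 : ∀ i β j, ε i β j ≠ 0) (hZ : ∀ i j, j ∈ Z i ↔ ε i 0 j ≠ ε i 1 j)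
    (hper : ∀ i (j : Fin ν), k ≤ j.val → Dp i 0 j + Dp i 1 j = 0)
    (hU : ∀ j : Fin ν, j.val < k → ∃ i, j ∈ Z i)
    {i₀ : Fin n} (hne : ∃ j, j ∈ Z i₀) (hnt : ∃ j, j ∉ Z i₀) (hα : α i₀.castSucc = 0)
    (β : Fin 2) (j : Fin ν) : Dp i₀.castSucc β j = 0 := by
  -- Zero advance makes the two balls' vectors equal, and conservation of the sum makes them equal
  -- to the vectors before the collision.
  have hF : ∀ {i}, α i = 0 → ∀ j, Dp i 1 j = Dp i 0 j ∧ Dm i 0 j = Dp i 0 j ∧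
      Dm i 1 j = Dp i 0 j := fun {i} hi j => by
    have h1 := hDm i j
    have h2 := hDp i j
    have h3 := hsum i j
    rw [hi, zero_mul] at h1 h2
    refine ⟨?_, ?_, ?_⟩ <;> linarith
  -- Forward step. At the next collision the difference vanishes in any coordinate outside `Z i` or
  -- where `D` is already zero. One such coordinate forces zero advance, as `Vm` has no zero
  -- coordinate. Then unequal signs on `Z i` force `D` to vanish there.
  have hA : ∀ i : Fin n, α i.castSucc = 0 → (∃ j, j ∉ Z i ∨ Dp i.castSucc 0 j = 0) →
      α i.succ = 0 ∧ (∀ j, Dp i.succ 0 j = 0 ↔ Dp i.castSucc 0 j = 0) ∧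
        ∀ j ∈ Z i, Dp i.castSucc 0 j = 0 := by
    rintro i hi ⟨j, hj⟩
    have hd : ∀ j, Dm i.succ 0 j = ε i 0 j * Dp i.castSucc 0 j ∧
        Dm i.succ 1 j = ε i 1 j * Dp i.castSucc 0 j := fun j => by
      refine ⟨hε i 0 j, ?_⟩
      rw [hε i 1 j, (hF hi j).1]
    have hs : α i.succ = 0 := by
      have h1 := hDm i.succ j
      rw [(hd j).1, (hd j).2] at h1
      have h2 : ε i 0 j * Dp i.castSucc 0 j - ε i 1 j * Dp i.castSucc 0 j = 0 := by
        rcases hj with hj | hj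
        · rw [hZ, not_not] at hj
          rw [hj, sub_self]
        · simp [hj]
      rw [h2] at h1
      exact (mul_eq_zero.1 h1.symm).resolve_right (hVm _ _)
    refine ⟨hs, fun j => ?_, fun j hj => ?_⟩
    · rw [← (hF hs j).2.1, (hd j).1, mul_eq_zero, or_iff_right (hε0 i 0 j)]
    · have h1 := (hF hs j).2.1.trans (hF hs j).2.2.symm
      rw [(hd j).1, (hd j).2] at h1
      by_contra h2
      exact (hZ i j).1 hj (mul_right_cancel₀ h2 h1)
  -- Backward step. Without a priori knowledge of the earlier advance, a vanishing coordinate pulls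
  -- back for both balls, and `Vp ≠ 0` in that coordinate kills the advance.
  have hB : ∀ i : Fin n, α i.succ = 0 → (∃ j, Dp i.succ 0 j = 0) →
      α i.castSucc = 0 ∧ ∃ j, Dp i.castSucc 0 j = 0 := by
    rintro i hi ⟨j, hj⟩
    have h0 : ∀ β, Dp i.castSucc β j = 0 := fun β => by
      have h1 := hε i β j
      have h2 : Dm i.succ β j = 0 := by
        fin_cases β
        · exact (hF hi j).2.1.trans hj
        · exact (hF hi j).2.2.trans hj
      rw [h2] at h1
      exact (mul_eq_zero.1 h1.symm).resolve_left (hε0 i β j)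
    have h1 := hDp i.castSucc j
    rw [h0, h0, sub_zero] at h1
    exact ⟨(mul_eq_zero.1 h1.symm).resolve_right (hVp _ _), j, h0 0⟩
  -- An axis outside `Z i₀` starts the forward step, and an axis inside `Z i₀` then yields a
  -- vanishing coordinate. Only here is the nontriviality of the flip set used.
  have hY : ∃ j, Dp i₀.castSucc 0 j = 0 := by
    obtain ⟨j, hj⟩ := hne
    obtain ⟨j', hj'⟩ := hnt
    exact ⟨j, (hA i₀ hα ⟨j', Or.inl hj'⟩).2.2 j hj⟩
  -- The invariant: zero advance, with the same zero coordinates as at the reference collision.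
  set P : Fin (n + 1) → Prop := fun i => α i = 0 ∧ ∀ j, Dp i 0 j = 0 ↔ Dp i₀.castSucc 0 j = 0
    with hP
  have hstep : ∀ i : Fin n, P i.castSucc ↔ P i.succ := by
    obtain ⟨j₁, hj₁⟩ := hY
    refine fun i => ⟨fun ⟨h1, h2⟩ => ?_, fun ⟨h1, h2⟩ => ?_⟩
    · obtain ⟨h3, h4, -⟩ := hA i h1 ⟨j₁, Or.inr ((h2 j₁).2 hj₁)⟩
      exact ⟨h3, fun j => (h4 j).trans (h2 j)⟩
    · obtain ⟨h3, j₂, h4⟩ := hB i h1 ⟨j₁, (h2 j₁).2 hj₁⟩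
      obtain ⟨-, h5, -⟩ := hA i h3 ⟨j₂, Or.inr h4⟩
      exact ⟨h3, fun j => (h5 j).symm.trans (h2 j)⟩
  have hall0 : ∀ i, P i ↔ P 0 := fun i => by
    induction i using Fin.induction with
    | zero => exact Iff.rfl
    | succ i ih => exact (hstep i).symm.trans ih
  have hall : ∀ i, P i := fun i => (hall0 i).2 ((hall0 i₀.castSucc).1 ⟨hα, fun j => Iff.rfl⟩)
  have h0 : Dp i₀.castSucc 0 j = 0 := by
    rcases lt_or_ge j.val k with hj | hj
    · obtain ⟨i, hi⟩ := hU j hj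
      obtain ⟨j₁, hj₁⟩ := hY
      have := (hA i (hall _).1 ⟨j₁, Or.inr (((hall _).2 j₁).2 hj₁)⟩).2.2 j hi
      exact ((hall _).2 j).1 this
    · have h1 := hper i₀.castSucc j hj
      rw [(hF hα j).1] at h1
      linarith
  fin_cases β
  · exact h0
  · exact ((hF hα j).1).trans h0

/-! ### Hypersurfaces of the phase space -/

section Submanifold

variable {ν k : ℕ} {r : ℝ}

/-- The equations defining `𝐌` as a subset of the space of all positions and velocities. -/
def SatisfiesConstraints (k : ℕ) (y : State ν) : Prop :=
  y.1 ∈ pairSubspace ν k ∧ y.2 ∈ pairSubspace ν k ∧ ‖y.2 0‖ ^ 2 + ‖y.2 1‖ ^ 2 = 1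

/-- The periodic axes. -/
abbrev PeriodicAxis (ν k : ℕ) := {j : Fin ν // k ≤ j.val}

/-- The defining functions of `𝐌` together with one more function. -/
noncomputable def constraintMap (k : ℕ) (g : State ν → ℝ) (y : State ν) :
    (PeriodicAxis ν k ⊕ PeriodicAxis ν k) ⊕ Fin 2 → ℝ :=
  Sum.elim (Sum.elim (fun j => y.1 0 j + y.1 1 j) fun j => y.2 0 j + y.2 1 j)
    ![‖y.2 0‖ ^ 2 + ‖y.2 1‖ ^ 2 - 1, g y]

theorem constraintMap_eq_zero_iff {g : State ν → ℝ} {y : State ν} :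
    constraintMap k g y = 0 ↔ SatisfiesConstraints k y ∧ g y = 0 := by
  simp only [funext_iff, Sum.forall, constraintMap, Sum.elim_inl, Sum.elim_inr, Pi.zero_apply,
    Fin.forall_fin_two, Matrix.cons_val_zero, Matrix.cons_val_one, Matrix.cons_val_fin_one,
    Subtype.forall, sub_eq_zero, SatisfiesConstraints]
  constructor
  · rintro ⟨⟨h1, h2⟩, h3, h4⟩
    exact ⟨⟨h1, h2, h3⟩, h4⟩
  · rintro ⟨⟨h1, h2, h3⟩, h4⟩
    exact ⟨⟨h1, h2⟩, h3, h4⟩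

theorem contDiffAt_constraintMap {g : State ν → ℝ} {y : State ν} {n : WithTop ℕ∞}
    (hg : ContDiffAt ℝ n g y) : ContDiffAt ℝ n (constraintMap k g) y := by
  have h0 : ∀ β : Fin 2, ContDiff ℝ n fun x : State ν => x.1 β :=
    fun β => (contDiff_apply ℝ _ β).comp contDiff_fst
  have h0' : ∀ β : Fin 2, ContDiff ℝ n fun x : State ν => x.2 β :=
    fun β => (contDiff_apply ℝ _ β).comp contDiff_snd
  rw [contDiffAt_pi]
  rintro ((j | j) | i)
  · exact ((contDiff_euclidean.1 (h0 0) j).add (contDiff_euclidean.1 (h0 1) j)).contDiffAt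
  · exact ((contDiff_euclidean.1 (h0' 0) j).add (contDiff_euclidean.1 (h0' 1) j)).contDiffAt
  · fin_cases i
    · exact ((((h0' 0).norm_sq ℝ).add ((h0' 1).norm_sq ℝ)).sub contDiff_const).contDiffAt
    · exact hg

theorem fderiv_constraintMap {g : State ν → ℝ} {y : State ν} (hg : DifferentiableAt ℝ g y)
    (hf : DifferentiableAt ℝ (constraintMap k g) y) (w : State ν) :
    fderiv ℝ (constraintMap k g) y w =
      Sum.elim (Sum.elim (fun j : PeriodicAxis ν k => w.1 0 j + w.1 1 j)
          fun j : PeriodicAxis ν k => w.2 0 j + w.2 1 j)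
        ![2 * inner ℝ (y.2 0) (w.2 0) + 2 * inner ℝ (y.2 1) (w.2 1), fderiv ℝ g y w] := by
  have hy : y + (0 : ℝ) • w = y := by simp
  have hcomp : HasDerivAt (fun s : ℝ => constraintMap k g (y + s • w))
      (fderiv ℝ (constraintMap k g) y w) 0 := hf.hasFDerivAt.hasLineDerivAt w
  have hgc : HasDerivAt (fun s : ℝ => g (y + s • w)) (fderiv ℝ g y w) 0 :=
    hg.hasFDerivAt.hasLineDerivAt w
  have h1 : ∀ β, HasDerivAt (fun s : ℝ => (y + s • w).1 β) (w.1 β) 0 := fun β => by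
    simpa using ((hasDerivAt_id (0 : ℝ)).smul_const (w.1 β)).const_add (y.1 β)
  have h2 : ∀ β, HasDerivAt (fun s : ℝ => (y + s • w).2 β) (w.2 β) 0 := fun β => by
    simpa using ((hasDerivAt_id (0 : ℝ)).smul_const (w.2 β)).const_add (y.2 β)
  funext i
  refine (hasDerivAt_pi.1 hcomp i).unique ?_
  rcases i with (j | j) | i
  · exact (IsCurve.coord (h1 0) j).add (IsCurve.coord (h1 1) j)
  · exact (IsCurve.coord (h2 0) j).add (IsCurve.coord (h2 1) j)
  · fin_cases i
    · have := (((h2 0).norm_sq).add (h2 1).norm_sq).sub_const (1 : ℝ)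
      simp only [hy] at this
      exact this
    · exact hgc

/-- The position and velocity sums on periodic axes are prescribed through ball `0`. A multiple of
the velocity itself corrects the energy, and `w₀`, being tangent, adjusts `g` without disturbing the
other equations. -/
theorem fderiv_constraintMap_surjective {g : State ν → ℝ} {y : State ν}
    (hg : ContDiffAt ℝ 1 g y) (hy : SatisfiesConstraints k y) {w₀ : State ν}
    (hw₀ : w₀ ∈ tangentSpace ν k y) (hgw : fderiv ℝ g y w₀ ≠ 0) :
    Function.Surjective (fderiv ℝ (constraintMap k g) y) := by
  have hg' := hg.differentiableAt one_ne_zero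
  have hf := (contDiffAt_constraintMap (k := k) hg).differentiableAt one_ne_zero
  intro a
  set P : Vec ν := WithLp.toLp 2 fun j => if h : k ≤ j.val then a (.inl (.inl ⟨j, h⟩)) else 0
    with hP
  set V : Vec ν := WithLp.toLp 2 fun j => if h : k ≤ j.val then a (.inl (.inr ⟨j, h⟩)) else 0
    with hV
  -- At unit energy, adding `l` times the velocity changes the derivative of the energy by `2 * l`.
  -- It leaves the periodic sums alone, since the velocities of the two balls cancel there.
  set l : ℝ := a (.inr 0) / 2 - inner ℝ (y.2 0) V with hl
  set w₁ : State ν := (![P, 0], ![V + l • y.2 0, l • y.2 1]) with hw₁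
  set μ : ℝ := (a (.inr 1) - fderiv ℝ g y w₁) / fderiv ℝ g y w₀
  refine ⟨w₁ + μ • w₀, ?_⟩
  rw [fderiv_constraintMap hg' hf]
  funext i
  rcases i with (⟨j, hj⟩ | ⟨j, hj⟩) | i
  · have h1 := hw₀.1 j hj
    simp only [Sum.elim_inl, hw₁, Prod.fst_add, Prod.smul_fst, Pi.add_apply, Pi.smul_apply,
      PiLp.add_apply, PiLp.smul_apply, smul_eq_mul, Matrix.cons_val_zero, Matrix.cons_val_one,
      Matrix.cons_val_fin_one, PiLp.zero_apply, hP, hj, dif_pos]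
    linear_combination μ * h1
  · have h1 := hw₀.2.1 j hj
    have h2 := hy.2.1 j hj
    simp only [Sum.elim_inl, Sum.elim_inr, hw₁, Prod.snd_add, Prod.smul_snd, Pi.add_apply,
      Pi.smul_apply, PiLp.add_apply, PiLp.smul_apply, smul_eq_mul, Matrix.cons_val_zero,
      Matrix.cons_val_one, Matrix.cons_val_fin_one, hV, hj, dif_pos]
    linear_combination μ * h1 + l * h2
  · fin_cases i
    · have h1 := hw₀.2.2
      have h2 := hy.2.2
      simp only [Sum.elim_inr, hw₁, Prod.snd_add, Prod.smul_snd, Pi.add_apply, Pi.smul_apply,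
        Matrix.cons_val_zero, Matrix.cons_val_one, Matrix.cons_val_fin_one, inner_add_right,
        inner_smul_right, real_inner_self_eq_norm_sq, Fin.zero_eta]
      linear_combination 2 * μ * h1 + 2 * l * h2 + 2 * hl
    · simp only [Sum.elim_inr, Fin.mk_one, Matrix.cons_val_one, Matrix.cons_val_fin_one, map_add,
        map_smul, smul_eq_mul]
      rw [div_mul_cancel₀ _ hgw]
      ring

theorem finrank_state (ν : ℕ) : Module.finrank ℝ (State ν) = 4 * ν := by
  rw [Module.finrank_prod, Module.finrank_pi_fintype]
  simp
  ring

/-- A subset of `𝐌` which is locally the zero set of a function with nonvanishing derivative on the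
tangent space is a smooth submanifold of codimension one. -/
theorem isSmoothSubmanifold_of_local (hν : 2 ≤ ν) (hk : k ≤ ν) {A : Set (State ν)}
    (h : ∀ x ∈ A, ∃ (U : Set (State ν)) (g : State ν → ℝ), IsOpen U ∧ x ∈ U ∧
      (∀ y ∈ U, ContDiffAt ℝ ⊤ g y) ∧ (∀ y ∈ U, y ∈ A ↔ SatisfiesConstraints k y ∧ g y = 0) ∧
      ∀ y ∈ U, y ∈ A → ∃ w ∈ tangentSpace ν k y, fderiv ℝ g y w ≠ 0) :
    IsSmoothSubmanifold (phaseDim ν k - 1) A := by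
  intro x hx
  obtain ⟨U, g, hU, hxU, hg, hA, hw⟩ := h x hx
  set c := Fintype.card ((PeriodicAxis ν k ⊕ PeriodicAxis ν k) ⊕ Fin 2) with hc
  have hcard : Fintype.card (PeriodicAxis ν k) = ν - k := by
    rw [Fintype.card_subtype]
    have : (Finset.univ.filter fun j : Fin ν => k ≤ j.val) =
        Finset.univ \ Finset.univ.filter fun j : Fin ν => j.val < k := by
      ext j; simp
    rw [this, Finset.card_sdiff_of_subset (Finset.subset_univ _), Finset.card_univ, Fintype.card_fin,
      Fin.card_filter_val_lt, min_eq_right hk]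
  let e := Fintype.equivFin ((PeriodicAxis ν k ⊕ PeriodicAxis ν k) ⊕ Fin 2)
  let E := LinearEquiv.toContinuousLinearEquiv (LinearEquiv.funCongrLeft ℝ ℝ e.symm)
  refine ⟨U, c, fun y => E (constraintMap k g y), hU, hxU, ?_, ?_, ?_, ?_⟩
  -- Dimension count: `2 (ν - k) + 2` equations and dimension `2 (ν + k) - 2` add up to `4 ν`.
  · rw [hc, finrank_state, Fintype.card_sum, Fintype.card_sum, hcard, Fintype.card_fin, phaseDim]
    omega
  · intro y hy
    exact ((E.contDiff.contDiffAt).comp y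
      (contDiffAt_constraintMap ((hg y hy).of_le le_top))).contDiffWithinAt
  · rintro y ⟨hyA, hyU⟩
    obtain ⟨w, hw1, hw2⟩ := hw y hyU hyA
    have hs := fderiv_constraintMap_surjective ((hg y hyU).of_le le_top) ((hA y hyU).1 hyA).1
      hw1 hw2
    have hd := (contDiffAt_constraintMap (k := k) (hg y hyU)).differentiableAt (by simp)
    have : fderiv ℝ (fun y => E (constraintMap k g y)) y =
        (E : _ →L[ℝ] _).comp (fderiv ℝ (constraintMap k g) y) :=
      (E.hasFDerivAt.comp y hd.hasFDerivAt).fderiv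
    rw [this]
    exact E.surjective.comp hs
  · ext y
    simp only [Set.mem_inter_iff, Set.mem_ofPred_eq]
    rw [and_comm]
    refine and_congr_right fun hy => ?_
    rw [hA y hy, ← constraintMap_eq_zero_iff, map_eq_zero_iff E E.injective]

end Submanifold

/-! ### Invariance under deck transformations -/

section Shift

variable {ν k : ℕ} {r : ℝ}

/-- The deck transformation of the cover of `𝐌` belonging to the period `m`. -/
noncomputable def shiftPair (m : Fin ν → ℤ) (q : Pair ν) : Pair ν :=
  ![q 0 + intVec m, q 1 - intVec m]

/-- The effect of a deck transformation on the labels of the collisions. -/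
def Collision.shift (m : Fin ν → ℤ) : Collision ν → Collision ν
  | .ball m' => .ball (m' + 2 • m)
  | .wall β j top => .wall β j top

theorem intVec_add (m m' : Fin ν → ℤ) : intVec (m + m') = intVec m + intVec m' := by
  ext j; simp [intVec]

/-- The balls are displaced by opposite periods, so the relative position changes by twice the
period. This explains the `2 • m` in the relabelling of collisions. -/
theorem shiftPair_sub (m m' : Fin ν → ℤ) (q : Pair ν) :
    shiftPair m q 0 - shiftPair m q 1 + intVec m' = q 0 - q 1 + intVec (m' + 2 • m) := by
  rw [two_smul, intVec_add, intVec_add]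
  simp only [shiftPair, Matrix.cons_val_zero, Matrix.cons_val_one, Matrix.cons_val_fin_one]
  abel

theorem shiftPair_apply_of_lt {m : Fin ν → ℤ} (hm : IsPeriod k m) (q : Pair ν) (β : Fin 2)
    {j : Fin ν} (hj : j.val < k) : shiftPair m q β j = q β j := by
  have := hm j hj
  fin_cases β <;> simp [shiftPair, intVec, this]

theorem shiftPair_add (m : Fin ν → ℤ) (q v : Pair ν) :
    shiftPair m (q + v) = shiftPair m q + v := by
  funext β
  fin_cases β
  · exact add_right_comm _ _ _
  · exact add_sub_right_comm _ _ _

theorem Collision.shift_shift_neg (m : Fin ν → ℤ) (c : Collision ν) :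
    (c.shift (-m)).shift m = c := by
  cases c with
  | ball m' => simp [Collision.shift]
  | wall β j top => rfl

theorem Collision.shift_neg_shift (m : Fin ν → ℤ) (c : Collision ν) :
    (c.shift m).shift (-m) = c := by
  simpa using c.shift_shift_neg (-m)

theorem Collision.Admissible.shift {m : Fin ν → ℤ} (hm : IsPeriod k m) {c : Collision ν}
    (hc : c.Admissible k) : (c.shift m).Admissible k := by
  cases c with
  | ball m' => intro j hj; simp [hc j hj, hm j hj]
  | wall β j top => exact hc

theorem gap_shiftPair {m : Fin ν → ℤ} (hm : IsPeriod k m) (q : Pair ν) {c : Collision ν}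
    (hc : c.Admissible k) : gap r (shiftPair m q) c = gap r q (c.shift m) := by
  cases c with
  | ball m' => simp only [gap, Collision.shift, shiftPair_sub]
  | wall β j top => simp only [gap, Collision.shift, shiftPair_apply_of_lt hm q β hc]

theorem touches_shiftPair (hr : 0 < r) {m : Fin ν → ℤ} (hm : IsPeriod k m) (q : Pair ν)
    (c : Collision ν) : Touches k r (shiftPair m q) c ↔ Touches k r q (c.shift m) := by
  have hm' : IsPeriod k (-m) := fun j hj => by simp [hm j hj]
  rw [touches_iff hr, touches_iff hr]
  constructor
  · rintro ⟨h1, h2⟩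
    exact ⟨h1.shift hm, by rwa [← gap_shiftPair hm q h1]⟩
  · rintro ⟨h1, h2⟩
    have h3 : c.Admissible k := by
      have := h1.shift hm'
      rwa [Collision.shift_neg_shift] at this
    exact ⟨h3, by rwa [gap_shiftPair hm q h3]⟩

theorem reflect_shiftPair (m : Fin ν → ℤ) (q v : Pair ν) (c : Collision ν) :
    reflect (shiftPair m q) v c = reflect q v (c.shift m) := by
  cases c with
  | ball m' => simp only [reflect, Collision.shift, shiftPair_sub]
  | wall β j top => rfl

theorem normalVelocity_shiftPair (m : Fin ν → ℤ) (q v : Pair ν) (c : Collision ν) :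
    normalVelocity (shiftPair m q) v c = normalVelocity q v (c.shift m) := by
  cases c with
  | ball m' => simp only [normalVelocity, Collision.shift, shiftPair_sub]
  | wall β j top => rfl

theorem shiftPair_mem_pairSubspace (m : Fin ν → ℤ) {q : Pair ν} (hq : q ∈ pairSubspace ν k) :
    shiftPair m q ∈ pairSubspace ν k := fun j hj => by
  have := hq j hj
  simp only [shiftPair, Matrix.cons_val_zero, Matrix.cons_val_one, Matrix.cons_val_fin_one,
    PiLp.add_apply, PiLp.sub_apply]
  linarith

theorem shift_mem_phaseSpace (hr : 0 < r) {m : Fin ν → ℤ} (hm : IsPeriod k m) {x : State ν}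
    (hx : x ∈ phaseSpace ν k r) : (shiftPair m x.1, x.2) ∈ phaseSpace ν k r := by
  obtain ⟨h1, h2⟩ := (mem_configSpace_iff hr _).1 hx.1
  refine ⟨(mem_configSpace_iff hr _).2 ⟨shiftPair_mem_pairSubspace m h1, fun c hc => ?_⟩, hx.2⟩
  rw [gap_shiftPair hm _ hc]
  exact h2 _ (hc.shift hm)

theorem IsFree.shift {m : Fin ν → ℤ} (hm : IsPeriod k m) {q : Pair ν} (h : IsFree k r q) :
    IsFree k r (shiftPair m q) := fun c hc => by
  rw [gap_shiftPair hm _ hc]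
  exact h _ (hc.shift hm)

/-- A deck transformation maps orbits to orbits with the same velocities and relabelled collisions.
This makes the exceptional set a pullback from the torus. -/
theorem FlowsTo.shift (hr : 0 < r) {m : Fin ν → ℤ} (hm : IsPeriod k m) {t : ℝ} {x y : State ν}
    (h : FlowsTo ν k r t x y) :
    FlowsTo ν k r t (shiftPair m x.1, x.2) (shiftPair m y.1, y.2) := by
  obtain ⟨ω, ho, rfl, rfl⟩ := h
  refine ⟨⟨fun s => shiftPair m (ω.q s), ω.vIn, ω.vOut⟩, ⟨fun s hs => ?_, fun s hs => ?_,
    fun s hs => ?_, fun s hs hc => ?_, fun s hs c hc => ?_, fun s hs c hc => ?_,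
    fun s hs c c' hc hc' => ?_⟩, rfl, rfl⟩
  · exact shift_mem_phaseSpace hr hm (ho.mem s hs)
  · filter_upwards [ho.forward s hs] with u hu
    exact ⟨by rw [hu.1, shiftPair_add], hu.2⟩
  · filter_upwards [ho.backward s hs] with u hu
    exact ⟨by rw [hu.1, shiftPair_add], hu.2⟩
  · refine ho.free s hs fun ⟨c, h⟩ => hc ⟨c.shift (-m), ?_⟩
    rw [touches_shiftPair hr hm, Collision.shift_shift_neg]
    exact h
  · rw [touches_shiftPair hr hm] at hc
    rw [reflect_shiftPair]
    exact ho.collide s hs _ hc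
  · rw [touches_shiftPair hr hm] at hc
    rw [normalVelocity_shiftPair]
    exact ho.transversal s hs _ hc
  · rw [touches_shiftPair hr hm] at hc hc'
    have := congrArg (Collision.shift (-m)) (ho.simple s hs _ _ hc hc')
    rwa [Collision.shift_neg_shift, Collision.shift_neg_shift] at this

end Shift

/-! ### The exceptional set as a countable union of hypersurfaces -/

section ExceptionalSet

variable {ν k : ℕ} {r : ℝ}

/-- The boundary points of `𝐌` on exactly one boundary component. -/
def boundaryStratum (ν k : ℕ) (r : ℝ) (c : Collision ν) : Set (State ν) :=
  {x | x ∈ phaseSpace ν k r ∧ Touches k r x.1 c ∧ ∀ c', Touches k r x.1 c' → c' = c}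

/-- The phase points whose relative velocity at the time `t` is orthogonal to the axis `j`. -/
def degenerateSet (ν k : ℕ) (r t : ℝ) (j : Fin ν) : Set (State ν) :=
  {x | ∃ y, FlowsTo ν k r t x y ∧ IsFree k r x.1 ∧ IsFree k r y.1 ∧ y.2 0 j - y.2 1 j = 0}

/-- Pushing the balls apart along the line of centres, or one ball along the normal of its wall,
respects the periodic constraint. So `gap` has nonzero derivative on the tangent space at contact.
-/
theorem exists_gapSpeed_ne_zero (hr : 0 < r) {q : Pair ν} {c : Collision ν}
    (h : Touches k r q c) : ∃ v ∈ pairSubspace ν k, gapSpeed q v c ≠ 0 := by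
  cases c with
  | ball m =>
    refine ⟨![q 0 - q 1 + intVec m, -(q 0 - q 1 + intVec m)], fun j _ => by simp, ?_⟩
    have := norm_sq_pos_of_touches hr h
    simp only [gapSpeed, Matrix.cons_val_zero, Matrix.cons_val_one, Matrix.cons_val_fin_one]
    rw [sub_neg_eq_add, inner_add_left, real_inner_self_eq_norm_sq]
    linarith
  | wall β j top =>
    refine ⟨Pi.single β (EuclideanSpace.single j 1), fun i hi => ?_, ?_⟩
    · have : i ≠ j := fun hij => absurd h.1 (not_lt.2 (hij ▸ hi))
      fin_cases β <;> simp [this]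
    · cases top <;> simp [gapSpeed]

theorem fderiv_gap (q v : Pair ν) (w : Pair ν) (c : Collision ν) :
    fderiv ℝ (fun x : State ν => gap r x.1 c) (q, w) (v, 0) = gapSpeed q v c := by
  have hd : DifferentiableAt ℝ (fun x : State ν => gap r x.1 c) (q, w) :=
    (((contDiff_gap (n := 1) c).comp contDiff_fst).differentiable one_ne_zero).differentiableAt
  have h3 : HasDerivAt (fun s : ℝ => gap r (q + s • v) c)
      (fderiv ℝ (fun x : State ν => gap r x.1 c) (q, w) (v, 0)) 0 :=
    hd.hasFDerivAt.hasLineDerivAt ((v, 0) : State ν)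
  refine h3.unique ?_
  simp only [gap_add_smul]
  have h4 := (((hasDerivAt_id (0 : ℝ)).mul_const (gapSpeed q v c)).const_add (gap r q c)).fun_add
    (((hasDerivAt_id (0 : ℝ)).fun_pow 2).mul_const (gapCurv v c))
  simpa using h4

/-- Near a point that touches only `c`, all other gaps stay positive, and the stratum is cut out by
the constraints and the single equation `gap = 0`. -/
theorem isSmoothSubmanifold_boundaryStratum (hν : 2 ≤ ν) (hk : k ≤ ν) (hr : 0 < r)
    (c : Collision ν) :
    IsSmoothSubmanifold (phaseDim ν k - 1) (boundaryStratum ν k r c) := by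
  refine isSmoothSubmanifold_of_local hν hk fun x hx => ?_
  obtain ⟨hxM, hxc, hxo⟩ := hx
  have hev : ∀ᶠ y : State ν in 𝓝 x, ∀ c', 0 < gap r x.1 c' → 0 < gap r y.1 c' :=
    continuousAt_fst.eventually (eventually_gap_pos hr x.1)
  obtain ⟨U, hU, hUo, hxU⟩ := eventually_nhds_iff.1 hev
  have hpos : ∀ y ∈ U, ∀ c' : Collision ν, c'.Admissible k → c' ≠ c → 0 < gap r y.1 c' :=
    fun y hy c' hc' hne => by
      refine hU y hy c' (lt_of_le_of_ne (((mem_configSpace_iff hr _).1 hxM.1).2 c' hc') fun h0 => ?_)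
      exact hne (hxo c' ((touches_iff hr _ _).2 ⟨hc', h0.symm⟩))
  refine ⟨U, fun y => gap r y.1 c, hUo, hxU,
    fun y _ => ((contDiff_gap c).comp contDiff_fst).contDiffAt, fun y hy => ?_, fun y hy hyA => ?_⟩
  · constructor
    · rintro ⟨h1, h2, h3⟩
      exact ⟨⟨h1.1.2.1, h1.2⟩, gap_eq_zero_of_touches h2⟩
    · rintro ⟨⟨h1, h2, h3⟩, h4⟩
      refine ⟨⟨(mem_configSpace_iff hr _).2 ⟨h1, fun c' hc' => ?_⟩, h2, h3⟩,
        (touches_iff hr _ _).2 ⟨hxc.admissible, h4⟩, fun c' hc' => ?_⟩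
      · by_cases hne : c' = c
        · rw [hne]; exact h4.ge
        · exact (hpos y hy c' hc' hne).le
      · by_contra hne
        exact (hpos y hy c' hc'.admissible hne).ne' (gap_eq_zero_of_touches hc')
  · obtain ⟨v, hv, hv'⟩ := exists_gapSpeed_ne_zero hr hyA.2.1
    refine ⟨(v, 0), ⟨hv, Submodule.zero_mem _, by simp⟩, ?_⟩
    rwa [fderiv_gap (w := y.2)]

/-- The set is locally the preimage, under the smooth flow map, of the hypersurface where the `j`-th
relative velocity vanishes. The flow is invertible, so a transversal tangent vector at the image
point can be brought back by the flow at time `-t`. -/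
theorem isSmoothSubmanifold_degenerateSet (hν : 2 ≤ ν) (hk : k ≤ ν) (hr : 0 < r) (t : ℝ)
    (j : Fin ν) : IsSmoothSubmanifold (phaseDim ν k - 1) (degenerateSet ν k r t j) := by
  refine isSmoothSubmanifold_of_local hν hk fun x hx => ?_
  obtain ⟨y, hxy, hxf, hyf, hyj⟩ := hx
  obtain ⟨Φ, h1, rfl, h3⟩ := hxy.flowGerm hr hxf hyf
  have hev : ∀ᶠ z : State ν in 𝓝 x, IsFree k r z.1 ∧ IsFree k r (Φ z).1 ∧ ContDiffAt ℝ ⊤ Φ z ∧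
      (z ∈ phaseSpace ν k r → FlowsTo ν k r t z (Φ z)) :=
    (continuousAt_fst.eventually (hxf.eventually hr)).and
      (((continuousAt_fst.comp h1.continuousAt).eventually (hyf.eventually hr)).and
        ((h1.eventually (by simp)).and (eventually_nhdsWithin_iff.1 h3)))
  obtain ⟨U, hU, hUo, hxU⟩ := eventually_nhds_iff.1 hev
  have hcoord : ∀ β : Fin 2, ContDiff ℝ ⊤ fun z : State ν => z.2 β j := fun β =>
    contDiff_euclidean.1 ((contDiff_apply ℝ _ β).comp contDiff_snd) j
  have hg : ∀ z ∈ U, ContDiffAt ℝ ⊤ (fun z => (Φ z).2 0 j - (Φ z).2 1 j) z := fun z hz =>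
    ((hcoord 0).sub (hcoord 1)).contDiffAt.comp z (hU z hz).2.2.1
  refine ⟨U, fun z => (Φ z).2 0 j - (Φ z).2 1 j, hUo, hxU, hg, fun z hz => ?_, fun z hz hzA => ?_⟩
  · obtain ⟨e1, e2, e3, e4⟩ := hU z hz
    constructor
    · rintro ⟨y, f1, f2, f3, f4⟩
      have hzM := f1.mem_left
      refine ⟨⟨hzM.1.2.1, hzM.2⟩, ?_⟩
      simp only [(e4 hzM).unique hr f1]
      exact f4
    · rintro ⟨⟨f1, f2, f3⟩, f4⟩
      exact ⟨Φ z, e4 ⟨e1.mem_configSpace hr f1, f2, f3⟩, e1, e2, f4⟩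
  · obtain ⟨e1, e2, e3, e4⟩ := hU z hz
    obtain ⟨y, f1, -, f3, f4⟩ := hzA
    have hzM := f1.mem_left
    have f1' := e4 hzM
    have hyz : y = Φ z := f1.unique hr f1'
    -- transport a tangent vector at `y` which changes the `j`-th relative velocity back to `z`
    set e : Vec ν := EuclideanSpace.single j 1 with he
    -- Orthogonality of `(e, -e)` to the velocity is exactly the vanishing of the `j`-th relative
    -- velocity, so the vector is tangent precisely on the degenerate set.
    have hw' : ((0, ![e, -e]) : State ν) ∈ tangentSpace ν k y := by
      refine ⟨Submodule.zero_mem _, fun i _ => by simp, ?_⟩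
      simp only [he, Matrix.cons_val_zero, Matrix.cons_val_one, Matrix.cons_val_fin_one,
        inner_neg_right, EuclideanSpace.inner_single_right]
      simpa [sub_eq_add_neg] using f4
    obtain ⟨γ, hγ⟩ := exists_isCurve hr f1.mem_right f3 hw'
    have hgerm := f1.symm.flowGerm hr f3 e1
    have hback := hγ.flow hr hgerm
    refine ⟨_, hback.mem_tangentSpace, ?_⟩
    set w := flowDeriv ν k r (-t) y (0, ![e, -e])
    have hd := ((hg z hz).differentiableAt (by simp)).hasFDerivAt
    have hd1 : HasDerivAt (fun s => (Φ (flow ν k r (-t) (γ s))).2 0 j -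
        (Φ (flow ν k r (-t) (γ s))).2 1 j)
        (fderiv ℝ (fun z => (Φ z).2 0 j - (Φ z).2 1 j) z w) 0 := by
      have hd2 := hback.hasDerivAt
      rw [← hback.zero] at hd
      have := hd.comp_hasDerivAt (0 : ℝ) hd2
      rwa [hback.zero] at this
    -- Along `(e, -e)` the relative velocity changes at rate `1 - (-1) = 2`.
    have hd3 : HasDerivAt (fun s => (γ s).2 0 j - (γ s).2 1 j) 2 0 := by
      have := (IsCurve.coord (hγ.snd_apply 0) j).sub (IsCurve.coord (hγ.snd_apply 1) j)
      simp only [he, Matrix.cons_val_zero, Matrix.cons_val_one, Matrix.cons_val_fin_one,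
        PiLp.neg_apply, PiLp.single_apply, if_true] at this
      norm_num at this
      exact this
    have heq : ∀ᶠ s in 𝓝 (0 : ℝ), Φ (flow ν k r (-t) (γ s)) = γ s := by
      obtain ⟨Ψ, g1, g2, g3⟩ := hgerm
      have hz' : ∀ᶠ s in 𝓝 (0 : ℝ), flow ν k r (-t) (γ s) ∈ U := by
        have := hback.hasDerivAt.continuousAt
        refine this.eventually (hUo.mem_nhds ?_)
        have h0 : flow ν k r (-t) (γ 0) = z := hback.zero
        simpa only [h0] using hz
      filter_upwards [hγ.tendsto.eventually g3, hz'] with s hs hs'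
      have g4 := (hU _ hs').2.2.2 (by rw [hs.flow_eq hr]; exact hs.mem_right)
      rw [hs.flow_eq hr] at g4 ⊢
      refine g4.unique hr ?_
      simpa using hs.symm
    have := hd1.unique (hd3.congr_of_eventuallyEq (heq.mono fun s hs => by simp only [hs]))
    rw [this]
    norm_num

/-- The exceptional set. -/
def exceptionalSet (ν k : ℕ) (r : ℝ) : Set (State ν) :=
  (⋃ c, boundaryStratum ν k r c) ∪ ⋃ (p : ℚ × Fin ν), degenerateSet ν k r p.1 p.2

theorem countable_collision (ν : ℕ) : Countable (Collision ν) := by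
  let f : Collision ν → (Fin ν → ℤ) ⊕ (Fin 2 × Fin ν × Bool) := fun c => match c with
    | .ball m => .inl m
    | .wall β j top => .inr (β, j, top)
  refine Function.Injective.countable (f := f) fun c c' h => ?_
  cases c <;> cases c' <;> simp_all [f]

theorem isCountableUnion_exceptionalSet (hν : 2 ≤ ν) (hk : k ≤ ν) (hr : 0 < r) :
    IsCountableUnionOfProperSubmanifolds ν k r (exceptionalSet ν k r) := by
  refine ⟨fun m hm x hx => ?_, ?_⟩
  · change (shiftPair m x.1, x.2) ∈ exceptionalSet ν k r
    rcases hx with hx | hx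
    · obtain ⟨c, h1, h2, h3⟩ := Set.mem_iUnion.1 hx
      refine Or.inl (Set.mem_iUnion.2 ⟨c.shift (-m), shift_mem_phaseSpace hr hm h1, ?_, ?_⟩)
      · rw [touches_shiftPair hr hm, Collision.shift_shift_neg]
        exact h2
      · intro c' hc'
        rw [touches_shiftPair hr hm] at hc'
        rw [← h3 _ hc', Collision.shift_neg_shift]
    · obtain ⟨p, y, h1, h2, h3, h4⟩ := Set.mem_iUnion.1 hx
      exact Or.inr (Set.mem_iUnion.2 ⟨p, (shiftPair m y.1, y.2), h1.shift hr hm, h2.shift hm,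
        h3.shift hm, h4⟩)
  · have := countable_collision ν
    have hne : Nonempty (Collision ν ⊕ ℚ × Fin ν) := ⟨.inl (.ball 0)⟩
    obtain ⟨f, hf⟩ := exists_surjective_nat (Collision ν ⊕ ℚ × Fin ν)
    set A : Collision ν ⊕ ℚ × Fin ν → Set (State ν) :=
      Sum.elim (boundaryStratum ν k r) fun p => degenerateSet ν k r p.1 p.2 with hA
    refine ⟨fun i => A (f i), ?_, fun i => ?_⟩
    · rw [hf.iUnion_comp A, Set.iUnion_sum]
      rfl
    · have hd : phaseDim ν k - 1 < phaseDim ν k := by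
        rw [phaseDim]; omega
      change A (f i) ⊆ _ ∧ ∃ d < phaseDim ν k, IsSmoothSubmanifold d (A (f i))
      generalize f i = p
      refine ⟨?_, phaseDim ν k - 1, hd, ?_⟩
      · rcases p with c | p
        · exact fun x hx => hx.1
        · rintro x ⟨y, h1, -⟩
          exact h1.mem_left
      · rcases p with c | p
        · exact isSmoothSubmanifold_boundaryStratum hν hk hr c
        · exact isSmoothSubmanifold_degenerateSet hν hk hr p.1 p.2

end ExceptionalSet

/-! ### Evolution of neutral vectors along an orbit -/

section Neutral

variable {ν k : ℕ} {r a b : ℝ} {ω : Motion ν}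

open Classical in
/-- The sign with which a coordinate of a neutral vector is multiplied between two times without
ball-to-ball collisions in between. -/
noncomputable def Motion.flipSign (k : ℕ) (ω : Motion ν) (s t : ℝ) (β : Fin 2)
    (j : Fin ν) : ℝ :=
  if j.val < k then
    (-1) ^ {τ : ℝ | s < τ ∧ τ < t ∧ ω.q τ β j * (1 - ω.q τ β j) = 0}.ncard else 1

theorem Motion.flipSign_ne_zero (ω : Motion ν) (s t : ℝ) (β : Fin 2) (j : Fin ν) :
    ω.flipSign k s t β j ≠ 0 := by
  rw [Motion.flipSign]
  split_ifs <;> simp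

theorem Motion.mem_symmDiff_oddAxes_iff (ω : Motion ν) (s t : ℝ) (j : Fin ν) :
    j ∈ symmDiff (ω.oddAxes k 0 s t) (ω.oddAxes k 1 s t) ↔
      ω.flipSign k s t 0 j ≠ ω.flipSign k s t 1 j := by
  have hne : (-1 : ℝ) ≠ 1 := by norm_num
  simp only [Set.mem_symmDiff, Motion.oddAxes, nonperiodicAxes, Set.mem_ofPred_eq, Motion.flipSign]
  by_cases hj : j.val < k
  · simp only [hj, true_and, if_true]
    generalize {τ : ℝ | s < τ ∧ τ < t ∧ ω.q τ 0 j * (1 - ω.q τ 0 j) = 0}.ncard = m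
    generalize {τ : ℝ | s < τ ∧ τ < t ∧ ω.q τ 1 j * (1 - ω.q τ 1 j) = 0}.ncard = n
    rcases Nat.even_or_odd m with hm | hm <;> rcases Nat.even_or_odd n with hn | hn
    · simp [hm.neg_one_pow, hn.neg_one_pow, Nat.not_odd_iff_even.2 hm, Nat.not_odd_iff_even.2 hn]
    · simp [hm.neg_one_pow, hn.neg_one_pow, Nat.not_odd_iff_even.2 hm, hn, hne.symm]
    · simp [hm.neg_one_pow, hn.neg_one_pow, hm, Nat.not_odd_iff_even.2 hn, hne]
    · simp [hm.neg_one_pow, hn.neg_one_pow, hm, hn]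
  · simp [hj]

namespace IsNonsingularOrbit

/-- Every moment has a punctured neighbourhood free of collisions, so compactness leaves finitely
many. Without finiteness `ncard` would be zero and the parity of hits meaningless. -/
theorem finite_collisionTimes (hr : 0 < r) (h : IsNonsingularOrbit ν k r a b ω)
    (ha : ¬ ω.IsCollisionTime k r a) (hb : ¬ ω.IsCollisionTime k r b) :
    {t | t ∈ Set.Icc a b ∧ ω.IsCollisionTime k r t}.Finite := by
  by_contra hinf
  obtain ⟨τ, hτ, hacc⟩ := Set.Infinite.exists_accPt_of_subset_isCompact hinf isCompact_Icc
    fun t ht => ht.1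
  have hev : ∃ ε > 0, ∀ t ∈ Set.Icc a b, t ≠ τ → |t - τ| < ε → IsFree k r (ω.q t) := by
    by_cases hc : ω.IsCollisionTime k r τ
    · obtain ⟨c, hc'⟩ := hc
      have hτ' : τ ∈ Set.Ioo a b :=
        ⟨lt_of_le_of_ne hτ.1 fun h => ha (h ▸ ⟨c, hc'⟩),
          lt_of_le_of_ne hτ.2 fun h => hb (h ▸ ⟨c, hc'⟩)⟩
      obtain ⟨ε, hε, h1, -⟩ := h.steps_near_collision hr hτ' hc'
      exact ⟨ε, hε, fun t _ hne ht => (h1 t ht).2 hne⟩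
    · obtain ⟨ε, hε, h1⟩ := h.freeStep_near hr hτ hc
      exact ⟨ε, hε, fun t ht _ ht' => (h1 t ht t ht ht' ht').1⟩
  obtain ⟨ε, hε, hE⟩ := hev
  obtain ⟨t, ⟨ht1, ht2, c, hc⟩, ht3⟩ := accPt_iff_nhds.1 hacc _ (Metric.ball_mem_nhds τ hε)
  exact (hE t ht2 ht3 (by rwa [Metric.mem_ball, Real.dist_eq] at ht1)).not_touches c hc

theorem flowDeriv_step (hr : 0 < r) (h : IsNonsingularOrbit ν k r a b ω) (hab : a < b)
    (ha : ¬ ω.IsCollisionTime k r a) (hb : ¬ ω.IsCollisionTime k r b)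
    (h0 : 0 ∈ Set.Icc a b) (h0c : ¬ ω.IsCollisionTime k r 0) {s t : ℝ} (hs : s ∈ Set.Icc a b)
    (ht : t ∈ Set.Icc a b) (hsc : ¬ ω.IsCollisionTime k r s) (htc : ¬ ω.IsCollisionTime k r t)
    {w : State ν} (hw : w ∈ tangentSpace ν k (ω.phase 0)) :
    flowDeriv ν k r t (ω.phase 0) w =
        flowDeriv ν k r (t - s) (ω.phase s) (flowDeriv ν k r s (ω.phase 0) w) ∧
      flowDeriv ν k r s (ω.phase 0) w ∈ tangentSpace ν k (ω.phase s) := by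
  have hf := h.isFree_of_not_collisionTime hr h0 h0c
  have h1 := h.flowGerm hr hab ha hb h0 hs h0c hsc
  rw [sub_zero] at h1
  refine ⟨?_, ?_⟩
  · rw [← flowDeriv_add hr (h.mem 0 h0) hf hw h1 (h.flowGerm hr hab ha hb hs ht hsc htc),
      add_sub_cancel]
  · obtain ⟨γ, hγ⟩ := exists_isCurve hr (h.mem 0 h0) hf hw
    exact (hγ.flow hr h1).mem_tangentSpace

theorem velocity_mem_neutralSpace (hr : 0 < r) (h : IsNonsingularOrbit ν k r a b ω)
    (h0 : 0 ∈ Set.Icc a b) (h0c : ¬ ω.IsCollisionTime k r 0) :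
    (((ω.phase 0).2, 0) : State ν) ∈ neutralSpace ν k r a b ω ∧
      ∀ t ∈ Set.Icc a b, ¬ ω.IsCollisionTime k r t →
        flowDeriv ν k r t (ω.phase 0) ((ω.phase 0).2, 0) = ((ω.phase t).2, 0) := by
  have hf := h.isFree_of_not_collisionTime hr h0 h0c
  have key : ∀ t ∈ Set.Icc a b, ¬ ω.IsCollisionTime k r t →
      flowDeriv ν k r t (ω.phase 0) ((ω.phase 0).2, 0) = ((ω.phase t).2, 0) := fun t ht htc => by
    have h1 := h.flowsTo h0 ht
    rw [sub_zero] at h1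
    exact flowDeriv_velocity hr h1 hf (h.isFree_of_not_collisionTime hr ht htc)
  exact ⟨⟨velocity_mem_tangentSpace hr (h.mem 0 h0) hf, fun t ht htc => by rw [key t ht htc]⟩, key⟩

theorem not_collisionTime_of_isFree {t : ℝ} (hf : IsFree k r (ω.q t)) :
    ¬ ω.IsCollisionTime k r t := fun ⟨c, hc⟩ => hf.not_touches c hc

/-- Free flight adds the elapsed time times the velocity part to the position part, and for a
neutral vector the velocity part is zero. -/
theorem flowDeriv_eq_of_freeStep (hr : 0 < r) (h : IsNonsingularOrbit ν k r a b ω) (hab : a < b)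
    (ha : ¬ ω.IsCollisionTime k r a) (hb : ¬ ω.IsCollisionTime k r b)
    (h0 : 0 ∈ Set.Icc a b) (h0c : ¬ ω.IsCollisionTime k r 0) {s t : ℝ} (hs : s ∈ Set.Icc a b)
    (ht : t ∈ Set.Icc a b) (hsf : IsFree k r (ω.q s)) (htf : IsFree k r (ω.q t))
    (hst : FreeStep ν k r (t - s) (ω.phase s) (ω.phase t)) {w : State ν}
    (hw : w ∈ neutralSpace ν k r a b ω) :
    (flowDeriv ν k r t (ω.phase 0) w).1 = (flowDeriv ν k r s (ω.phase 0) w).1 := by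
  have hsc := not_collisionTime_of_isFree hsf
  obtain ⟨h1, h2⟩ := h.flowDeriv_step hr hab ha hb h0 h0c hs ht hsc
    (not_collisionTime_of_isFree htf) hw.1
  rw [h1, hst.flowDeriv_eq hr (h.mem s hs) hsf h2, freeFlight, hw.2 s hs hsc, smul_zero, add_zero]

/-- Neutral vectors before and after a ball-to-ball collision. -/
theorem exists_times_near_ball_collision (hr : 0 < r) (h : IsNonsingularOrbit ν k r a b ω)
    (hab : a < b) (ha : ¬ ω.IsCollisionTime k r a) (hb : ¬ ω.IsCollisionTime k r b)
    (h0 : 0 ∈ Set.Icc a b) (h0c : ¬ ω.IsCollisionTime k r 0) {τ : ℝ} (hτ : τ ∈ Set.Icc a b)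
    (hτb : ω.IsBallCollisionTime k r τ) :
    ∃ s t : ℚ, ((s : ℝ) ∈ Set.Icc a b ∧ ¬ ω.IsCollisionTime k r s) ∧
      ((t : ℝ) ∈ Set.Icc a b ∧ ¬ ω.IsCollisionTime k r t) ∧
      ∀ w ∈ neutralSpace ν k r a b ω,
        (∀ᶠ u in 𝓝[<] τ, (flowDeriv ν k r u (ω.phase 0) w).1 =
          (flowDeriv ν k r s (ω.phase 0) w).1) ∧
        (∀ᶠ u in 𝓝[>] τ, (flowDeriv ν k r u (ω.phase 0) w).1 =
          (flowDeriv ν k r t (ω.phase 0) w).1) ∧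
        (∃ α : ℝ, (flowDeriv ν k r s (ω.phase 0) w).1 0 - (flowDeriv ν k r s (ω.phase 0) w).1 1 =
            α • ((ω.phase s).2 0 - (ω.phase s).2 1) ∧
          (flowDeriv ν k r t (ω.phase 0) w).1 0 - (flowDeriv ν k r t (ω.phase 0) w).1 1 =
            α • ((ω.phase t).2 0 - (ω.phase t).2 1)) ∧
        (flowDeriv ν k r t (ω.phase 0) w).1 0 + (flowDeriv ν k r t (ω.phase 0) w).1 1 =
          (flowDeriv ν k r s (ω.phase 0) w).1 0 + (flowDeriv ν k r s (ω.phase 0) w).1 1 := by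
  obtain ⟨m, hm⟩ := hτb
  have hτ' : τ ∈ Set.Ioo a b :=
    ⟨lt_of_le_of_ne hτ.1 fun h => ha (h ▸ ⟨_, hm⟩), lt_of_le_of_ne hτ.2 fun h => hb (h ▸ ⟨_, hm⟩)⟩
  obtain ⟨ε, hε, h1, h2, h3, h4⟩ := h.steps_near_collision hr hτ' hm
  -- The sampling times are rational because the exceptional set controls relative velocities only
  -- at rational times.
  obtain ⟨s, hs⟩ := exists_rat_btwn (sub_lt_self τ hε)
  obtain ⟨t, ht⟩ := exists_rat_btwn (lt_add_of_pos_right τ hε)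
  have hl : ∀ u ∈ Set.Ioo (τ - ε) τ, u ∈ Set.Icc a b ∧ IsFree k r (ω.q u) := fun u hu => by
    have := h1 u (by rw [abs_lt]; constructor <;> linarith [hu.1, hu.2])
    exact ⟨this.1, this.2 hu.2.ne⟩
  have hr' : ∀ u ∈ Set.Ioo τ (τ + ε), u ∈ Set.Icc a b ∧ IsFree k r (ω.q u) := fun u hu => by
    have := h1 u (by rw [abs_lt]; constructor <;> linarith [hu.1, hu.2])
    exact ⟨this.1, this.2 hu.1.ne'⟩
  obtain ⟨hsI, hsf⟩ := hl s hs
  obtain ⟨htI, htf⟩ := hr' t ht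
  have hsc := not_collisionTime_of_isFree hsf
  have htc := not_collisionTime_of_isFree htf
  refine ⟨s, t, ⟨hsI, hsc⟩, ⟨htI, htc⟩, fun w hw => ⟨?_, ?_, ?_⟩⟩
  · filter_upwards [Ioo_mem_nhdsLT (sub_lt_self τ hε)] with u hu
    exact h.flowDeriv_eq_of_freeStep hr hab ha hb h0 h0c hsI (hl u hu).1 hsf (hl u hu).2
      (h2 s hs u hu) hw
  · filter_upwards [Ioo_mem_nhdsGT (lt_add_of_pos_right τ hε)] with u hu
    exact h.flowDeriv_eq_of_freeStep hr hab ha hb h0 h0c htI (hr' u hu).1 htf (hr' u hu).2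
      (h3 t ht u hu) hw
  · obtain ⟨e1, e2⟩ := h.flowDeriv_step hr hab ha hb h0 h0c hsI htI hsc htc hw.1
    have := (h4 s hs t ht).1.flowDeriv_ball hr (h.mem s hsI) hsf e2 (hw.2 s hsI hsc)
      (by rw [← e1]; exact hw.2 t htI htc)
    rwa [← e1] at this

/-- Between ball-to-ball collisions the coordinate changes only by a sign, exactly when ball `β`
hits a wall normal to axis `j`, so the number of hits determines the total sign. -/
theorem coord_eq_flipSign_mul (hr : 0 < r) (h : IsNonsingularOrbit ν k r a b ω)
    (hab : a < b) (ha : ¬ ω.IsCollisionTime k r a) (hb : ¬ ω.IsCollisionTime k r b)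
    (h0 : 0 ∈ Set.Icc a b) (h0c : ¬ ω.IsCollisionTime k r 0) {s t : ℝ} (hs : s ∈ Set.Icc a b)
    (ht : t ∈ Set.Icc a b) (hst : s < t)
    (hno : ∀ τ ∈ Set.Ioo s t, ¬ ω.IsBallCollisionTime k r τ) {w : State ν}
    (hw : w ∈ neutralSpace ν k r a b ω) (β : Fin 2) (j : Fin ν) {d₁ d₂ : Pair ν}
    (h₁ : ∀ᶠ u in 𝓝[>] s, (flowDeriv ν k r u (ω.phase 0) w).1 = d₁)
    (h₂ : ∀ᶠ u in 𝓝[<] t, (flowDeriv ν k r u (ω.phase 0) w).1 = d₂) :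
    d₂ β j = ω.flipSign k s t β j * d₁ β j := by
  -- The condition `j.val < k` makes `H` empty on a periodic axis, where passing the lifted values
  -- `0` or `1` is no collision and the sign is `1`.
  set H : Set ℝ := {τ | j.val < k ∧ ω.q τ β j * (1 - ω.q τ β j) = 0} with hH
  have hHt : ∀ τ, τ ∈ H ↔ ∃ top, Touches k r (ω.q τ) (.wall β j top) := fun τ => by
    simp only [hH, Set.mem_ofPred_eq, Touches, Bool.exists_bool, mul_eq_zero, sub_eq_zero]
    constructor
    · rintro ⟨hj, h1 | h1⟩
      · exact Or.inl ⟨hj, by simpa using h1⟩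
      · exact Or.inr ⟨hj, by simpa using h1.symm⟩
    · rintro (⟨hj, h1⟩ | ⟨hj, h1⟩)
      · exact ⟨hj, Or.inl (by simpa using h1)⟩
      · exact ⟨hj, Or.inr (by simpa using h1.symm)⟩
  have hfin : (H ∩ Set.Ioo s t).Finite := by
    refine (h.finite_collisionTimes hr ha hb).subset fun τ hτ => ?_
    obtain ⟨top, htop⟩ := (hHt τ).1 hτ.1
    exact ⟨⟨hs.1.trans hτ.2.1.le, hτ.2.2.le.trans ht.2⟩, _, htop⟩
  have hsign : ω.flipSign k s t β j = (-1) ^ (H ∩ Set.Ioo s t).ncard := by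
    rw [Motion.flipSign]
    split_ifs with hj
    · congr 2
      ext τ
      simp only [hH, Set.mem_ofPred_eq, Set.mem_inter_iff, Set.mem_Ioo, hj, true_and]
      tauto
    · have : H ∩ Set.Ioo s t = ∅ := by
        ext τ; simp [hH, hj]
      rw [this]; simp
  rw [hsign]
  refine eventually_eq_neg_one_pow hst hfin (fun u => (flowDeriv ν k r u (ω.phase 0) w).1 β j)
    (fun τ hτ => ?_) (h₁.mono fun u hu => by rw [hu]) (h₂.mono fun u hu => by rw [hu])
  have hτ' : τ ∈ Set.Ioo a b := ⟨hs.1.trans_lt hτ.1, hτ.2.trans_le ht.2⟩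
  have hτI : τ ∈ Set.Icc a b := ⟨hτ'.1.le, hτ'.2.le⟩
  by_cases hc : ω.IsCollisionTime k r τ
  · obtain ⟨c, hc⟩ := hc
    obtain ⟨ε, hε, f1, f2, f3, f4⟩ := h.steps_near_collision hr hτ' hc
    have hl : ∀ u ∈ Set.Ioo (τ - ε) τ, u ∈ Set.Icc a b ∧ IsFree k r (ω.q u) := fun u hu => by
      have := f1 u (by rw [abs_lt]; constructor <;> linarith [hu.1, hu.2])
      exact ⟨this.1, this.2 hu.2.ne⟩
    have hr' : ∀ u ∈ Set.Ioo τ (τ + ε), u ∈ Set.Icc a b ∧ IsFree k r (ω.q u) := fun u hu => by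
      have := f1 u (by rw [abs_lt]; constructor <;> linarith [hu.1, hu.2])
      exact ⟨this.1, this.2 hu.1.ne'⟩
    refine ⟨ε, hε, fun x hx y hy => ?_, fun x hx y hy => ?_, fun x hx y hy => ?_⟩
    · rw [h.flowDeriv_eq_of_freeStep hr hab ha hb h0 h0c (hl y hy).1 (hl x hx).1 (hl y hy).2
        (hl x hx).2 (f2 y hy x hx) hw]
    · rw [h.flowDeriv_eq_of_freeStep hr hab ha hb h0 h0c (hr' y hy).1 (hr' x hx).1 (hr' y hy).2
        (hr' x hx).2 (f3 y hy x hx) hw]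
    · cases c with
      | ball m => exact absurd ⟨m, hc⟩ (hno τ hτ)
      | wall β₀ j₀ top =>
        have hiff : τ ∈ H ↔ β = β₀ ∧ j = j₀ := by
          rw [hHt]
          constructor
          · rintro ⟨top', htop⟩
            have := h.simple τ hτI _ _ htop hc
            simp only [Collision.wall.injEq] at this
            exact ⟨this.1, this.2.1⟩
          · rintro ⟨rfl, rfl⟩
            exact ⟨top, hc⟩
        obtain ⟨hxI, hxf⟩ := hl x hx
        obtain ⟨hyI, hyf⟩ := hr' y hy
        have hxc := not_collisionTime_of_isFree hxf
        obtain ⟨e1, e2⟩ := h.flowDeriv_step hr hab ha hb h0 h0c hxI hyI hxc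
          (not_collisionTime_of_isFree hyf) hw.1
        have e3 := (f4 x hx y hy).1.flowDeriv_wall hr (h.mem x hxI) hxf e2 (hw.2 x hxI hxc) β j
        rw [← e1] at e3
        rw [hiff]
        constructor
        · intro hi
          rw [e3, if_pos hi]
        · intro hi
          rw [e3, if_neg hi]
  · obtain ⟨ε', hε', f1⟩ := h.freeStep_near hr hτI hc
    -- The window is shrunk to lie in `[a, b]`, where the step between two times is available.
    obtain ⟨ε, hε, hε1, hε2, hε3⟩ : ∃ ε > 0, ε ≤ ε' ∧ a ≤ τ - ε ∧ τ + ε ≤ b :=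
      ⟨min ε' (min (τ - a) (b - τ)),
        lt_min hε' (lt_min (sub_pos.2 hτ'.1) (sub_pos.2 hτ'.2)), min_le_left _ _,
        by linarith [(min_le_right ε' (min (τ - a) (b - τ))).trans (min_le_left _ _)],
        by linarith [(min_le_right ε' (min (τ - a) (b - τ))).trans (min_le_right _ _)]⟩
    have key : ∀ x y, |x - τ| < ε → |y - τ| < ε →
        (flowDeriv ν k r x (ω.phase 0) w).1 = (flowDeriv ν k r y (ω.phase 0) w).1 := by
      intro x y hx hy
      have hI : ∀ {u : ℝ}, |u - τ| < ε → u ∈ Set.Icc a b := fun hu => by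
        rw [abs_lt] at hu
        constructor <;> linarith
      have hx' := hx.trans_le hε1
      have hy' := hy.trans_le hε1
      exact h.flowDeriv_eq_of_freeStep hr hab ha hb h0 h0c (hI hy) (hI hx)
        (f1 y (hI hy) y (hI hy) hy' hy').1 (f1 x (hI hx) x (hI hx) hx' hx').1
        (f1 y (hI hy) x (hI hx) hy' hx').2 hw
    have hl : ∀ u ∈ Set.Ioo (τ - ε) τ, |u - τ| < ε := fun u hu => by
      rw [abs_lt]; constructor <;> linarith [hu.1, hu.2]
    have hr' : ∀ u ∈ Set.Ioo τ (τ + ε), |u - τ| < ε := fun u hu => by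
      rw [abs_lt]; constructor <;> linarith [hu.1, hu.2]
    have hτH : τ ∉ H := fun hτH => by
      obtain ⟨top, htop⟩ := (hHt τ).1 hτH
      exact hc ⟨_, htop⟩
    exact ⟨ε, hε, fun x hx y hy => by rw [key x y (hl x hx) (hl y hy)],
      fun x hx y hy => by rw [key x y (hr' x hx) (hr' y hy)],
      fun x hx y hy => ⟨fun hτ => absurd hτ hτH, fun _ => by rw [key y x (hr' y hy) (hl x hx)]⟩⟩

end IsNonsingularOrbit

end Neutral

/-! ### Sufficiency outside the exceptional set -/

section Main

variable {ν k : ℕ} {r a b : ℝ} {ω : Motion ν}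

theorem not_collisionTime_zero_of_notMem (h : IsNonsingularOrbit ν k r a b ω)
    (h0 : 0 ∈ Set.Icc a b) (hE : ω.phase 0 ∉ exceptionalSet ν k r) :
    ¬ ω.IsCollisionTime k r 0 := fun ⟨c, hc⟩ =>
  hE (Or.inl (Set.mem_iUnion.2 ⟨c, h.mem 0 h0, hc, fun c' hc' => h.simple 0 h0 c' c hc' hc⟩))

theorem relative_velocity_ne_zero_of_notMem (hr : 0 < r) (h : IsNonsingularOrbit ν k r a b ω)
    (h0 : 0 ∈ Set.Icc a b) (hE : ω.phase 0 ∉ exceptionalSet ν k r) {t : ℚ}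
    (ht : (t : ℝ) ∈ Set.Icc a b) (htc : ¬ ω.IsCollisionTime k r t) (j : Fin ν) :
    ((ω.phase t).2 0 - (ω.phase t).2 1) j ≠ 0 := fun hj => by
  have hfl := h.flowsTo h0 ht
  rw [sub_zero] at hfl
  exact hE (Or.inr (Set.mem_iUnion.2 ⟨(t, j), ω.phase t, hfl,
    h.isFree_of_not_collisionTime hr h0 (not_collisionTime_zero_of_notMem h h0 hE),
    h.isFree_of_not_collisionTime hr ht htc, hj⟩))

/-- Outside of the exceptional set, orbit segments with a combinatorially rich symbolic collision
sequence are sufficient. -/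
theorem isSufficient_of_isRich (hν : 2 ≤ ν) (hr : 0 < r) {S : SymbolicSequence ν}
    (hS : S.IsRich k) (h : IsNonsingularOrbit ν k r a b ω) (h0 : 0 ∈ Set.Icc a b)
    (ha : ¬ ω.IsCollisionTime k r a) (hb : ¬ ω.IsCollisionTime k r b)
    (hωS : HasSymbolicSequence ν k r a b ω S) (hE : ω.phase 0 ∉ exceptionalSet ν k r) :
    IsSufficient ν k r a b ω := by
  obtain ⟨hU, i₀, hi₀, hi₀'⟩ := hS
  obtain ⟨t, htmono, htrange, htZ⟩ := hωS
  have htb : ∀ i, t i ∈ Set.Icc a b ∧ ω.IsBallCollisionTime k r (t i) := fun i => by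
    have : t i ∈ Set.range t := ⟨i, rfl⟩
    rwa [htrange] at this
  have hab : a < b := (htb i₀.castSucc).1.1.trans_lt
    ((htmono i₀.castSucc_lt_succ).trans_le (htb i₀.succ).1.2)
  have h0c := not_collisionTime_zero_of_notMem h h0 hE
  have hno : ∀ i : Fin S.n, ∀ τ ∈ Set.Ioo (t i.castSucc) (t i.succ),
      ¬ ω.IsBallCollisionTime k r τ := fun i τ hτ hτb => by
    have : τ ∈ Set.range t := by
      rw [htrange]
      exact ⟨⟨(htb i.castSucc).1.1.trans hτ.1.le, hτ.2.le.trans (htb i.succ).1.2⟩, hτb⟩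
    obtain ⟨l, rfl⟩ := this
    have h1 := htmono.lt_iff_lt.1 hτ.1
    have h2 := htmono.lt_iff_lt.1 hτ.2
    exact absurd (Fin.castSucc_lt_iff_succ_le.1 h1) (not_le.2 h2)
  choose s s' hs hs' hss using fun i =>
    h.exists_times_near_ball_collision hr hab ha hb h0 h0c (htb i).1 (htb i).2
  have hV := fun i j => relative_velocity_ne_zero_of_notMem hr h h0 hE (hs i).1 (hs i).2 j
  have hV' := fun i j => relative_velocity_ne_zero_of_notMem hr h h0 hE (hs' i).1 (hs' i).2 j
  obtain ⟨hvN, hvt⟩ := h.velocity_mem_neutralSpace hr h0 h0c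
  set x := ω.phase 0 with hx
  -- a neutral vector without advance at the collision preceding the segment `i₀` vanishes
  have main : ∀ w ∈ neutralSpace ν k r a b ω,
      (flowDeriv ν k r (s' i₀.castSucc) x w).1 0 = (flowDeriv ν k r (s' i₀.castSucc) x w).1 1 →
      w = 0 := by
    intro w hw hadv
    choose e1 e2 e3 e4 using fun i => hss i w hw
    choose α hα hα' using e3
    -- Any single coordinate gives this, as none of the relative velocity vanishes; axis `0` exists
    -- because `ν ≥ 2`.
    have hα0 : α i₀.castSucc = 0 := by
      have h1 := congrArg (fun u : Vec ν => u ⟨0, by omega⟩) (hα' i₀.castSucc)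
      simp only [hadv, sub_self] at h1
      exact (mul_eq_zero.1 h1.symm).resolve_right (hV' _ _)
    have hne : ∃ j, j ∈ S.Z i₀ := Set.nonempty_of_ncard_ne_zero hi₀.ne'
    have hnt : ∃ j, j ∉ S.Z i₀ := by
      by_contra hcon
      push Not at hcon
      rw [Set.eq_univ_of_forall hcon, Set.ncard_univ, Nat.card_fin] at hi₀'
      exact lt_irrefl _ hi₀'
    have hz : ∀ β j, (flowDeriv ν k r (s' i₀.castSucc) x w).1 β j = 0 := fun β j =>
      neutral_vector_eq_zero (k := k) (Z := S.Z)
        (Dm := fun i β j => (flowDeriv ν k r (s i) x w).1 β j)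
        (Dp := fun i β j => (flowDeriv ν k r (s' i) x w).1 β j)
        (ε := fun i β j => ω.flipSign k (t i.castSucc) (t i.succ) β j)
        hV hV' (fun i j => congrArg (fun u : Vec ν => u j) (hα i))
        (fun i j => congrArg (fun u : Vec ν => u j) (hα' i))
        (fun i j => congrArg (fun u : Vec ν => u j) (e4 i))
        (fun i β j => h.coord_eq_flipSign_mul hr hab ha hb h0 h0c (htb _).1 (htb _).1
          (htmono i.castSucc_lt_succ) (hno i) hw β j (e2 i.castSucc) (e1 i.succ))
        (fun i β j => ω.flipSign_ne_zero _ _ β j)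
        (fun i j => by rw [htZ i]; exact ω.mem_symmDiff_oddAxes_iff _ _ j)
        -- Transported vectors remain tangent to the phase space, so their position sum vanishes on
        -- periodic axes.
        (fun i j hj => (h.flowDeriv_step hr hab ha hb h0 h0c (hs' i).1 h0 (hs' i).2 h0c
          hw.1).2.1 j hj)
        (fun j hj => by
          have : j ∈ ⋃ i, S.Z i := by rw [hU]; exact hj
          exact Set.mem_iUnion.1 this)
        hne hnt hα0 β j
    have hz0 : flowDeriv ν k r (s' i₀.castSucc) x w = 0 :=
      Prod.ext (funext fun β => PiLp.ext fun j => hz β j)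
        (hw.2 _ (hs' i₀.castSucc).1 (hs' i₀.castSucc).2)
    -- Flowing back to time zero recovers `w` from its vanishing image.
    have h1 := (h.flowDeriv_step hr hab ha hb h0 h0c (hs' i₀.castSucc).1 h0 (hs' i₀.castSucc).2 h0c
      hw.1).1
    rw [← hx, hz0, map_zero,
      flowDeriv_zero hr (h.mem 0 h0) (h.isFree_of_not_collisionTime hr h0 h0c) hw.1] at h1
    exact h1
  have hnz : (⟨(x.2, 0), hvN⟩ : neutralSpace ν k r a b ω) ≠ 0 := fun hcon => by
    have h1 : x.2 = 0 := congrArg (fun u : neutralSpace ν k r a b ω => u.1.1) hcon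
    have h2 := (h.mem 0 h0).2.2
    rw [← hx, h1] at h2
    simp at h2
  refine (finrank_eq_one_iff_of_nonzero' _ hnz).2 fun ⟨w, hw⟩ => ?_
  obtain ⟨-, -, ⟨α, -, hα⟩, -⟩ := hss i₀.castSucc w hw
  refine ⟨α, Subtype.ext ?_⟩
  -- The flow direction has advance one, so subtracting `α` times it removes the advance of `w` at
  -- the collision that precedes the segment `i₀`.
  have hwN : w - α • ((x.2, 0) : State ν) ∈ neutralSpace ν k r a b ω :=
    Submodule.sub_mem _ hw (Submodule.smul_mem _ _ hvN)
  have := main _ hwN (by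
    rw [map_sub, map_smul, hvt _ (hs' i₀.castSucc).1 (hs' i₀.castSucc).2]
    simp only [Prod.fst_sub, Prod.smul_fst, Pi.sub_apply, Pi.smul_apply]
    rw [smul_sub] at hα
    rw [sub_eq_sub_iff_add_eq_add] at hα ⊢
    rw [hα, add_comm])
  exact (sub_eq_zero.1 this).symm

end Main

end TwoBalls

theorem mainTheorem2 (ν k : ℕ) (hν : 2 ≤ ν) (hk : k ≤ ν) (r : ℝ) (hr0 : 0 < r) (hr : r < 1 / 4)
    (S : TwoBalls.SymbolicSequence ν) (hS : S.IsRich k) :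
    ∃ E : Set (TwoBalls.State ν), TwoBalls.IsCountableUnionOfProperSubmanifolds ν k r E ∧
      ∀ (a b : ℝ) (ω : TwoBalls.Motion ν), a ≤ 0 → 0 ≤ b →
        TwoBalls.IsNonsingularOrbit ν k r a b ω →
        ¬ ω.IsCollisionTime k r a → ¬ ω.IsCollisionTime k r b →
        TwoBalls.HasSymbolicSequence ν k r a b ω S →
        ω.phase 0 ∉ E →
        TwoBalls.IsSufficient ν k r a b ω :=
  ⟨TwoBalls.exceptionalSet ν k r, TwoBalls.isCountableUnion_exceptionalSet hν hk hr0,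
    fun _ _ _ ha hb h hac hbc hω hE =>
      TwoBalls.isSufficient_of_isRich hν hr0 hS h ⟨ha, hb⟩ hac hbc hω hE⟩
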